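/- **Notation.** Let $\mathcal P$ be the set of partitions; $|\mu|$ is the size, $l(\mu)$ the number of nonzero parts and $\mu^t$ the conjugate of $\mu$, and $\kappa(\mu)=|\mu|+\sum_{j=1}^{l(\mu)}\mu_j(\mu_j-2j)$. Let $s_{\lambda/\mu}$ denote the skew Schur function, $s_\lambda=s_{\lambda/\emptyset}$. We work over the field $\mathbb Q(q^{1/2})$. For $\nu\in\mathcal P$, $q^{\nu+\rho}$ denotes the set of variables $x_i=q^{\nu_i-i+1/2}$ and $q^{-\nu-\rho}$ the set of variables $x_i=q^{-\nu_i+i-1/2}$ ($i\ge1$); symmetric functions of these are understood as rational functions of $q^{1/2}$, i.e. through the power sums $$p_k(q^{\pm(\nu+\rho)})=\sum_{i=1}^{l(\nu)}\bigl(q^{\pm k(\nu_i-i+1/2)}-q^{\pm k(-i+1/2)}\bigr)+\frac{1}{q^{\pm k/2}-q^{\mp k/2}}\qquad(k\ge1),$$ obtained by summing the geometric series. For sets of variables $x,y$, $(x,y)$ is their union and $Qx=(Qx_1,Qx_2,\dots)$. The topological vertex is $$C_{\lambda_1,\lambda_2,\lambda_3}(q)=q^{\frac12\kappa(\lambda_3)}s_{\lambda_2}(q^\rho)\sum_{\mu\in\mathcal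 P}s_{\lambda_1/\mu}(q^{\lambda_2^t+\rho})\,s_{\lambda_3^t/\mu}(q^{\lambda_2+\rho}),$$ where $q^\rho=q^{\emptyset+\rho}$. For fixed partitions $\lambda_1,\lambda_2,\lambda_3,\lambda_4$ define the formal power series over $\mathbb Q(q^{1/2})$, in the variables $Q_0$ and $Q_0^+$ respectively, $$Z_0(q,Q_0)=\sum_{\mu\in\mathcal P}(-Q_0)^{|\mu|}C_{\lambda_1,\lambda_2,\mu^t}(q)\,C_{\lambda_3,\lambda_4,\mu}(q),\qquad Z_0^+(q,Q_0^+)=\sum_{\mu\in\mathcal P}(-Q_0^+)^{|\mu|}C_{\lambda_1,\mu^t,\lambda_4}(q)\,C_{\lambda_3,\mu,\lambda_2}(q),$$ and $$Z_{(-1,-1)}(q,Q)=\prod_{k\ge1}(1-Qq^k)^k=\exp\Bigl(-\sum_{n\ge1}\frac{Q^n}{n}\,\frac{q^n}{(1-q^n)^2}\Bigr),$$ the second expression giving its meaning over $\mathbb Q(q^{1/2})$. Put $Z_0'=Z_0/Z_{(-1,-1)}(q,Q_0)$ and $Z_0^{+\prime}=Z_0^+/Z_{(-1,-1)}(q,Q_0^+)$.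 Finally let $$f_\mu(q)=\frac{q}{q-1}\sum_{i\ge1}(q^{\mu_i-i}-q^{-i}),\qquad f_{\mu,\nu}(q)=(q-2+q^{-1})f_\mu(q)f_\nu(q)+f_\mu(q)+f_\nu(q)=\sum_{k\in\mathbb Z}C_k(\mu,\nu)\,q^k ,$$ which are Laurent polynomials in $q$ with integer coefficients. **Theorem.** For all partitions $\lambda_1,\lambda_2,\lambda_3,\lambda_4$: (1) $$\begin{aligned}Z_0'(q,Q_0)={}&q^{\frac12\kappa(\lambda_2)+\frac12\kappa(\lambda_4)}\,s_{\lambda_1}(q^\rho)s_{\lambda_3}(q^\rho)\prod_{k\in\mathbb Z}(1-Q_0q^k)^{C_k(\lambda_1^t,\lambda_3^t)}\\&\times\sum_{\tau\in\mathcal P}(-Q_0)^{|\tau|}\,s_{\lambda_2^t/\tau^t}(q^{\lambda_1+\rho},Q_0q^{-\lambda_3-\rho})\,s_{\lambda_4^t/\tau}(q^{\lambda_3+\rho},Q_0q^{-\lambda_1-\rho}),\end{aligned}$$ (2) $$\begin{aligned}Z_0^{+\prime}(q,Q_0^+)={}&s_{\lambda_1}(q^\rho)s_{\lambda_3}(q^\rho)\prod_{k\in\mathbb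 Z}(1-Q_0^+q^k)^{C_k(\lambda_1,\lambda_3)}\\&\times\sum_{\tau\in\mathcal P}(-Q_0^+)^{|\tau|}\,s_{\lambda_2/\tau}(q^{\lambda_3^t+\rho},Q_0^+q^{-\lambda_1^t-\rho})\,s_{\lambda_4/\tau^t}(q^{\lambda_1^t+\rho},Q_0^+q^{-\lambda_3^t-\rho}).\end{aligned}$$ (3) $Z_0^{+\prime}(q,Q_0^+)$ is a polynomial in $Q_0^+$ (with coefficients in $\mathbb Q(q^{1/2})$) of degree at most $|\lambda_1|+|\lambda_2|+|\lambda_3|+|\lambda_4|$. (4) If $\lambda_3=\lambda_4=\emptyset$, then $Z_0^{+\prime}(q,Q_0^+)$ is a polynomial in $Q_0^+$ of degree exactly $|\lambda_1|+|\lambda_2|$. -/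

import Mathlib

namespace TopVertex

/-! Partitions are Young diagrams; rows and columns are numbered from `0`, so the part called
`μ_i` (`i ≥ 1`) in the usual notation is `μ.rowLen (i - 1)`, and `l(μ) = μ.colLen 0`. -/

/-- Every partition of `n` fits into an `n × n` box, so there are finitely many of them. -/
theorem finite_card_eq (n : ℕ) : {μ : YoungDiagram | μ.card = n}.Finite := by
  have hinj : Function.Injective YoungDiagram.cells := fun a b h => YoungDiagram.ext h
  refine Set.Finite.of_finite_image (f := YoungDiagram.cells) ?_ hinj.injOn
  refine ((Finset.range n ×ˢ Finset.range n).powerset.finite_toSet).subset ?_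
  rintro _ ⟨μ, hμ, rfl⟩
  simp only [Finset.coe_powerset, Set.mem_preimage, Set.mem_powerset_iff, Finset.coe_subset]
  rintro ⟨i, j⟩ hij
  have hij' : (i, j) ∈ μ := hij
  have hr : j < μ.rowLen i := YoungDiagram.mem_iff_lt_rowLen.1 hij'
  have hc : i < μ.colLen j := YoungDiagram.mem_iff_lt_colLen.1 hij'
  rw [YoungDiagram.rowLen_eq_card] at hr
  rw [YoungDiagram.colLen_eq_card] at hc
  have h1 : (μ.row i).card ≤ μ.card := Finset.card_le_card (Finset.filter_subset _ _)
  have h2 : (μ.col j).card ≤ μ.card := Finset.card_le_card (Finset.filter_subset _ _)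
  have h3 : μ.card = n := hμ
  simp only [Finset.mem_product, Finset.mem_range]
  omega

/-- A partition contains only finitely many partitions. -/
theorem finite_le (l : YoungDiagram) : {μ : YoungDiagram | μ ≤ l}.Finite := by
  have hinj : Function.Injective YoungDiagram.cells := fun a b h => YoungDiagram.ext h
  refine Set.Finite.of_finite_image (f := YoungDiagram.cells) ?_ hinj.injOn
  refine (l.cells.powerset.finite_toSet).subset ?_
  rintro _ ⟨μ, hμ, rfl⟩
  simpa using YoungDiagram.cells_subset_iff.2 hμ

/-- `κ(μ) = |μ| + ∑_{j=1}^{l(μ)} μ_j (μ_j - 2 j)`. -/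
def kappa (μ : YoungDiagram) : ℤ :=
  (μ.card : ℤ) +
    ∑ j ∈ Finset.range (μ.colLen 0), (μ.rowLen j : ℤ) * ((μ.rowLen j : ℤ) - 2 * ((j : ℤ) + 1))

/-! ### Symmetric functions of an alphabet given by its power sums

The ring of symmetric functions over `ℚ` is freely generated by the power sums `p_1, p_2, …`.
Hence an alphabet (specialization of the variables) in a commutative `ℚ`-algebra `A` is given by
the sequence `p : ℕ → A` of its power sums (the value `p 0` is never used). The union of
two alphabets has the sum of the power sums, and multiplying all variables by `c` multiplies `p k`
by `c ^ k`. -/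

section Symmetric

variable {A : Type*} [CommRing A] [Algebra ℚ A]

/-- The complete homogeneous symmetric functions `h_n` of the alphabet with power sums `p`,
determined by Newton's identities `h_0 = 1`, `n h_n = ∑_{k=1}^{n} p_k h_{n-k}`; equivalently
`∑ h_n u ^ n = exp (∑_{k ≥ 1} p_k u ^ k / k) = ∏_x (1 - x u)⁻¹`. -/
noncomputable def completeH (p : ℕ → A) : ℕ → A
  | 0 => 1
  | n + 1 => ((n : ℚ) + 1)⁻¹ • ∑ k : Fin (n + 1), p (k + 1) * completeH p (n - k)

/-- `h_n` for an integer index, with `h_n = 0` for `n < 0`. -/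
noncomputable def completeHInt (p : ℕ → A) (n : ℤ) : A :=
  if 0 ≤ n then completeH p n.toNat else 0

open scoped Classical in
/-- The skew Schur function `s_{l/m} = det (h_{l_i - m_j - i + j})_{1 ≤ i, j ≤ l(l)}` of the
alphabet with power sums `p`; it is `0` unless `m ⊆ l`. -/
noncomputable def skewSchur (p : ℕ → A) (l m : YoungDiagram) : A :=
  if m ≤ l then
    Matrix.det (Matrix.of fun i j : Fin (l.colLen 0) =>
      completeHInt p ((l.rowLen i : ℤ) - (m.rowLen j : ℤ) - (i : ℤ) + (j : ℤ)))
  else 0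

/-- The Schur function `s_l = s_{l/∅}`. -/
noncomputable def schur (p : ℕ → A) (l : YoungDiagram) : A := skewSchur p l ⊥

/-- Newton's identities in terms of the generating function: `H' = (∑ p_{k+1} u ^ k) H`. -/
theorem derivative_completeH (p : ℕ → A) :
    PowerSeries.derivative A (PowerSeries.mk (completeH p)) =
      PowerSeries.mk (fun k => p (k + 1)) * PowerSeries.mk (completeH p) := by
  ext n
  rw [PowerSeries.coeff_derivative, PowerSeries.coeff_mul,
    Finset.Nat.sum_antidiagonal_eq_sum_range_succ_mk]
  simp only [PowerSeries.coeff_mk]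
  rw [completeH, Finset.sum_range]
  have h : ((n : A) + 1) = algebraMap ℚ A ((n : ℚ) + 1) := by simp
  rw [h, Algebra.smul_mul_assoc, mul_comm, ← Algebra.smul_def, smul_smul, inv_mul_cancel₀,
    one_smul]
  positivity

/-- The generating function of the `h_n` is determined by Newton's identities. -/
theorem mk_completeH_unique (p : ℕ → A) (F : PowerSeries A) (h0 : PowerSeries.coeff 0 F = 1)
    (h : PowerSeries.derivative A F = PowerSeries.mk (fun k => p (k + 1)) * F) :
    PowerSeries.mk (completeH p) = F := by
  ext n
  rw [PowerSeries.coeff_mk]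
  induction n using Nat.strong_induction_on with
  | _ n ih =>
    cases n with
    | zero => rw [completeH, h0]
    | succ n =>
      have h1 := congrArg (PowerSeries.coeff n) h
      rw [PowerSeries.coeff_derivative, PowerSeries.coeff_mul,
        Finset.Nat.sum_antidiagonal_eq_sum_range_succ_mk, Finset.sum_range] at h1
      simp only [PowerSeries.coeff_mk] at h1
      have h2 : ((n : A) + 1) = algebraMap ℚ A ((n : ℚ) + 1) := by simp
      rw [completeH, Finset.sum_congr rfl (fun k _ => by rw [ih (n - k) (by omega)]), ← h1, h2,
        mul_comm, ← Algebra.smul_def, smul_smul, inv_mul_cancel₀, one_smul]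
      positivity

/-- For a union of alphabets the generating functions of the `h_n` multiply. -/
theorem mk_completeH_add (p p' : ℕ → A) :
    PowerSeries.mk (completeH fun k => p k + p' k) =
      PowerSeries.mk (completeH p) * PowerSeries.mk (completeH p') := by
  apply mk_completeH_unique
  · simp [completeH]
  · rw [Derivation.leibniz, derivative_completeH, derivative_completeH]
    have : PowerSeries.mk (fun k => p (k + 1) + p' (k + 1)) =
        PowerSeries.mk (fun k => p (k + 1)) + PowerSeries.mk (fun k => p' (k + 1)) := by
      ext; simp
    rw [this, smul_eq_mul, smul_eq_mul]
    ring

/-- For a single variable `x` the generating function of the `h_n` is `∑ (x u) ^ n`. -/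
theorem completeH_pow (x : A) (n : ℕ) : completeH (fun k => x ^ k) n = x ^ n := by
  induction n using Nat.strong_induction_on with
  | _ n ih =>
    cases n with
    | zero => simp [completeH]
    | succ n =>
      rw [completeH, Finset.sum_congr rfl (g := fun _ => x ^ (n + 1))]
      · rw [Finset.sum_const, Finset.card_univ, Fintype.card_fin, ← Nat.cast_smul_eq_nsmul ℚ,
          smul_smul, Nat.cast_add, Nat.cast_one, inv_mul_cancel₀, one_smul]
        positivity
      · intro k _
        rw [ih (n - k) (by omega), ← pow_add]
        congr 1
        omega

end Symmetric

/-! ### The alphabets `q^{ν+ρ}` and `q^{-ν-ρ}` -/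

/-- With `t = q^{1/2}`: the `k`-th power sum (`k ≥ 1`) of the alphabet `q^{ν+ρ}`, that is, of the
variables `x_i = q^{ν_i - i + 1/2}` (`i ≥ 1`), as a rational function of `t`. The geometric series
`∑_{i ≥ 1} q^{k(-i+1/2)}` is summed to `1 / (q^{k/2} - q^{-k/2})`. Replacing `t` by `t⁻¹` gives the
power sums of `q^{-ν-ρ}`. -/
noncomputable def rhoPowerSum {K : Type*} [Field K] (t : K) (ν : YoungDiagram) (k : ℕ) : K :=
  ∑ i ∈ Finset.range (ν.colLen 0),
      ((t ^ (2 * (ν.rowLen i : ℤ) - 2 * (i : ℤ) - 1)) ^ k - (t ^ (-2 * (i : ℤ) - 1)) ^ k)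
    + 1 / (t ^ k - (t⁻¹) ^ k)

/-- Where the infinite sum of `k`-th powers converges, it has the value `rhoPowerSum`. -/
theorem hasSum_rhoPowerSum (t : ℂ) (ht : 1 < ‖t‖) (ν : YoungDiagram) (k : ℕ) (hk : 1 ≤ k) :
    HasSum (fun i : ℕ => (t ^ (2 * (ν.rowLen i : ℤ) - 2 * (i : ℤ) - 1)) ^ k)
      (rhoPowerSum t ν k) := by
  have t0 : t ≠ 0 := by rintro rfl; simp at ht; linarith
  have hrow : ∀ i, i ∉ Finset.range (ν.colLen 0) → ν.rowLen i = 0 := by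
    intro i hi
    by_contra h
    have : (i, 0) ∈ ν := YoungDiagram.mem_iff_lt_rowLen.2 (Nat.pos_of_ne_zero h)
    exact hi (Finset.mem_range.2 (YoungDiagram.mem_iff_lt_colLen.1 this))
  have h1 : HasSum (fun i : ℕ =>
      (t ^ (2 * (ν.rowLen i : ℤ) - 2 * (i : ℤ) - 1)) ^ k - (t ^ (-2 * (i : ℤ) - 1)) ^ k)
      (∑ i ∈ Finset.range (ν.colLen 0),
      ((t ^ (2 * (ν.rowLen i : ℤ) - 2 * (i : ℤ) - 1)) ^ k - (t ^ (-2 * (i : ℤ) - 1)) ^ k)) := by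
    apply hasSum_sum_of_ne_finset_zero
    intro i hi
    simp [hrow i hi]
  have hlt : ‖((t⁻¹) ^ k) ^ 2‖ < 1 := by
    rw [norm_pow, norm_pow, norm_inv, ← pow_mul]
    exact pow_lt_one₀ (by positivity) (inv_lt_one_of_one_lt₀ ht) (by omega)
  have h2 := (hasSum_geometric_of_norm_lt_one hlt).mul_left ((t⁻¹) ^ k)
  have h3 : (t⁻¹) ^ k * (1 - ((t⁻¹) ^ k) ^ 2)⁻¹ = 1 / (t ^ k - (t⁻¹) ^ k) := by
    have hk0 : t ^ k ≠ 0 := pow_ne_zero _ t0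
    have hne : 1 - ((t⁻¹) ^ k) ^ 2 ≠ 0 := by
      intro h
      rw [← sub_eq_zero.1 h] at hlt
      simp at hlt
    have : t ^ k - (t⁻¹) ^ k = t ^ k * (1 - ((t⁻¹) ^ k) ^ 2) := by
      rw [inv_pow]; field_simp
    rw [this, one_div, mul_inv, inv_pow]
  rw [h3] at h2
  have h4 : (fun i : ℕ => (t⁻¹) ^ k * (((t⁻¹) ^ k) ^ 2) ^ i) =
      fun i : ℕ => (t ^ (-2 * (i : ℤ) - 1)) ^ k := by
    funext i
    have : t ^ (-2 * (i : ℤ) - 1) = (t⁻¹) ^ (2 * i + 1) := by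
      rw [inv_pow, ← zpow_natCast, ← zpow_neg]
      congr 1
      push_cast
      ring
    rw [this]
    ring
  rw [h4] at h2
  have h5 := h1.add h2
  simpa [rhoPowerSum] using h5

/-- The coefficient field `ℚ(q^{1/2})`. -/
abbrev Kq : Type := RatFunc ℚ

/-- The element `q^{1/2}`. -/
noncomputable def qHalf : Kq := RatFunc.X

/-- The element `q`. -/
noncomputable def q : Kq := qHalf ^ 2

/-- The alphabet `q^{ν+ρ}`. -/
noncomputable def qRho (ν : YoungDiagram) : ℕ → Kq := rhoPowerSum qHalf ν

/-- The alphabet `q^{-ν-ρ}`. -/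
noncomputable def qNegRho (ν : YoungDiagram) : ℕ → Kq := rhoPowerSum qHalf⁻¹ ν

/-- The alphabet `(q^{α+ρ}, Q q^{-β-ρ})` in `ℚ(q^{1/2})⟦Q⟧`, where `Q` is the power series
variable. -/
noncomputable def pairAlphabet (α β : YoungDiagram) (k : ℕ) : PowerSeries Kq :=
  PowerSeries.C (qRho α k) + PowerSeries.X ^ k * PowerSeries.C (qNegRho β k)

/-! ### The topological vertex and the partition functions -/

/-- The topological vertex
`C_{l₁,l₂,l₃}(q) = q^{κ(l₃)/2} s_{l₂}(q^ρ) ∑_μ s_{l₁/μ}(q^{l₂ᵗ+ρ}) s_{l₃ᵗ/μ}(q^{l₂+ρ})`.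
Only the finitely many `μ ⊆ l₁` contribute to the sum. -/
noncomputable def vertex (l₁ l₂ l₃ : YoungDiagram) : Kq :=
  qHalf ^ kappa l₃ * schur (qRho ⊥) l₂ *
    ∑ᶠ μ : YoungDiagram, skewSchur (qRho l₂.transpose) l₁ μ * skewSchur (qRho l₂) l₃.transpose μ

/-- `Z₀(q,Q) = ∑_μ (-Q)^{|μ|} C_{l₁,l₂,μᵗ}(q) C_{l₃,l₄,μ}(q)`, a power series in `Q`; the
coefficient of `Q ^ n` collects the finitely many `μ` with `|μ| = n`. -/
noncomputable def Z0 (l₁ l₂ l₃ l₄ : YoungDiagram) : PowerSeries Kq :=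
  PowerSeries.mk fun n =>
    ∑ μ ∈ (finite_card_eq n).toFinset, (-1) ^ n * vertex l₁ l₂ μ.transpose * vertex l₃ l₄ μ

/-- `Z₀⁺(q,Q) = ∑_μ (-Q)^{|μ|} C_{l₁,μᵗ,l₄}(q) C_{l₃,μ,l₂}(q)`. -/
noncomputable def Z0plus (l₁ l₂ l₃ l₄ : YoungDiagram) : PowerSeries Kq :=
  PowerSeries.mk fun n =>
    ∑ μ ∈ (finite_card_eq n).toFinset, (-1) ^ n * vertex l₁ μ.transpose l₄ * vertex l₃ μ l₂

/-- The `n`-th power sum (`n ≥ 1`) `∑_{k ≥ 1} k q^{k n}` of the alphabet in which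
`q ^ k` occurs `k` times, as a rational function of `q`. -/
noncomputable def conifoldPowerSum {K : Type*} [Field K] (x : K) (n : ℕ) : K :=
  x ^ n / (1 - x ^ n) ^ 2

/-- Where the infinite sum converges, it has the value `conifoldPowerSum`. -/
theorem hasSum_conifoldPowerSum (x : ℂ) (hx : ‖x‖ < 1) (n : ℕ) (hn : 1 ≤ n) :
    HasSum (fun k : ℕ => (k : ℂ) * (x ^ k) ^ n) (conifoldPowerSum x n) := by
  have h : ‖x ^ n‖ < 1 := by
    rw [norm_pow]; exact pow_lt_one₀ (norm_nonneg _) hx (by omega)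
  have := hasSum_coe_mul_geometric_of_norm_lt_one h
  simpa [conifoldPowerSum, ← pow_mul, mul_comm] using this

/-- `Z_{(-1,-1)}(q,Q) = ∏_{k ≥ 1} (1 - Q q^k)^k = exp (-∑_{n ≥ 1} (∑_{k ≥ 1} k q^{k n}) Q^n / n)`,
a power series in `Q` over `ℚ(q^{1/2})`: the inverse of `∑ h_n Q^n = ∏_{k ≥ 1} (1 - Q q^k)^{-k}`. -/
noncomputable def Zconifold : PowerSeries Kq :=
  (PowerSeries.mk (completeH (conifoldPowerSum q)))⁻¹

/-- `Z₀' = Z₀ / Z_{(-1,-1)}`. -/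
noncomputable def Z0prime (l₁ l₂ l₃ l₄ : YoungDiagram) : PowerSeries Kq :=
  Z0 l₁ l₂ l₃ l₄ * Zconifold⁻¹

/-- `Z₀⁺' = Z₀⁺ / Z_{(-1,-1)}`. -/
noncomputable def Z0plusPrime (l₁ l₂ l₃ l₄ : YoungDiagram) : PowerSeries Kq :=
  Z0plus l₁ l₂ l₃ l₄ * Zconifold⁻¹

/-! ### The exponents `C_k(μ,ν)` -/

open LaurentPolynomial in
/-- `f_μ(q) = (q / (q - 1)) ∑_{i ≥ 1} (q^{μ_i - i} - q^{-i})`, written as the Laurent polynomial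
`∑_{i ≥ 1} ∑_{j=1}^{μ_i} q^{j-i}`; see `sub_one_mul_fPoly`. -/
noncomputable def fPoly (μ : YoungDiagram) : LaurentPolynomial ℤ :=
  ∑ i ∈ Finset.range (μ.colLen 0), ∑ j ∈ Finset.range (μ.rowLen i), T ((j : ℤ) - (i : ℤ))

open LaurentPolynomial in
/-- The defining identity `(q - 1) f_μ = q ∑_i (q^{μ_i - i} - q^{-i})`. -/
theorem sub_one_mul_fPoly (μ : YoungDiagram) :
    (T 1 - 1) * fPoly μ = T 1 * ∑ i ∈ Finset.range (μ.colLen 0),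
      (T ((μ.rowLen i : ℤ) - ((i : ℤ) + 1)) - T (-((i : ℤ) + 1))) := by
  rw [fPoly, Finset.mul_sum, Finset.mul_sum]
  refine Finset.sum_congr rfl fun i _ => ?_
  generalize μ.rowLen i = m
  induction m with
  | zero => simp
  | succ m ih =>
    rw [Finset.sum_range_succ, mul_add, ih]
    simp only [mul_sub, sub_mul, one_mul, ← T_add, Nat.cast_add, Nat.cast_one]
    ring_nf

open LaurentPolynomial in
/-- `f_{μ,ν}(q) = (q - 2 + q⁻¹) f_μ(q) f_ν(q) + f_μ(q) + f_ν(q)`. -/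
noncomputable def fPair (μ ν : YoungDiagram) : LaurentPolynomial ℤ :=
  (T 1 - 2 + T (-1)) * fPoly μ * fPoly ν + fPoly μ + fPoly ν

/-- `C_k(μ,ν)`, the coefficient of `q^k` in `f_{μ,ν}(q)`. -/
noncomputable def Ccoeff (μ ν : YoungDiagram) (k : ℤ) : ℤ := (fPair μ ν).coeff k

/-- Integer powers of a power series over a field (used for constant coefficient `1`). -/
noncomputable def seriesZPow {K : Type*} [Field K] (F : PowerSeries K) (n : ℤ) : PowerSeries K :=
  if 0 ≤ n then F ^ n.toNat else (F⁻¹) ^ (-n).toNat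

/-- `∏_{k ∈ ℤ} (1 - Q q^k)^{C_k(μ,ν)}`; the product runs over the finitely many `k` with
`C_k(μ,ν) ≠ 0`. -/
noncomputable def Cprod (μ ν : YoungDiagram) : PowerSeries Kq :=
  ∏ k ∈ (fPair μ ν).coeff.support,
    seriesZPow (1 - PowerSeries.X * PowerSeries.C (q ^ k)) (Ccoeff μ ν k)

end TopVertex

open TopVertex

/-! The theorem rests on the cyclic symmetry C_{a,b,c} = C_{c,a,b} of the vertex
(`genVertex_cyclic`). It rotates both vertices so that l₁ and l₃ sit in the middle, and the
summation partition μ then enters only through skew Schur functions s_{μ/·} and s_{μᵗ/·} (`Z0_eq`,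
`Z0plus_eq`). The sum over μ is a dual skew Cauchy sum with two outer partitions
(`mk_sum_pairing_mul_pairing`): a finite sum over τ times exp(-∑ p_k(q^{a+ρ}) p_k(q^{b+ρ}) Q^k / k).
With [k] = q^{k/2} - q^{-k/2} one has p_k(q^{ν+ρ}) = 1/[k] + [k] f_ν(q^k), so the product of two
such power sums is 1/[k]² + f_{a,b}(q^k). The first term gives Z_{(-1,-1)}, the second gives ∏ (1 -
Q q^k)^{C_k} (`conifold_sub_eq`).

For the cyclic symmetry, both sides are shown to satisfy the same recursions under adding a box to
one leg. The eigenvalues p_1(q^{b'ᵗ+ρ}) separate the partitions b' covering a given b, so a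
Vandermonde argument shows that such families are determined by their values at the empty partition
(`eq_zero_of_recursions_two`, `eq_zero_of_recursions_three`). The recursions come from one
observation: adding a box of content c to ν adds to q^{ν+ρ} the virtual alphabet t - t⁻¹ scaled by
q^c. The vertex operator with this alphabet (`vmat`) is diagonal in degree 0 with eigenvalue (t -
t⁻¹) p_1(q^{ν+ρ}), and in degree ±1 it only adds or removes one box. The remaining input, the sum of
s_{b'}(q^ρ) q^{jc} over boxes added to b, is a partial fraction identity
(`sum_ups_schur_rho_mul_zpow`).

The theory of skew Schur functions is built from Jacobi–Trudi determinants. Cauchy–Binet gives the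
rule for unions of alphabets. Conjugation and the skew Cauchy identity are proved one letter at a
time and then carried over to arbitrary power sums, because over an algebraically closed field
finitely many power sums are always those of finitely many letters (`exists_listAlphabet`).

For (3) and (4), the exponents C_k are nonnegative by a counting argument and add up to |μ| + |ν|
(`Ccoeff_nonneg`, `sum_Ccoeff`), so the product is a polynomial of known degree. The exact degree
needs s_d(q^{b+ρ}) ≠ 0. This is seen by sending q^{1/2} to a transcendental real number greater than
1, where the recursions and the cyclic symmetry make the value positive (`schur_rhoPowerSum_pos`).
-/

namespace TopVertex

/-! ### Young diagrams by rows -/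

theorem rowLen_eq_zero_iff (μ : YoungDiagram) (i : ℕ) : μ.rowLen i = 0 ↔ μ.colLen 0 ≤ i := by
  rw [← not_lt, ← YoungDiagram.mem_iff_lt_colLen, YoungDiagram.mem_iff_lt_rowLen]
  omega

theorem rowLen_eq_zero {μ : YoungDiagram} {i : ℕ} (h : μ.colLen 0 ≤ i) : μ.rowLen i = 0 :=
  (rowLen_eq_zero_iff μ i).2 h

theorem le_iff_rowLen {μ ν : YoungDiagram} : μ ≤ ν ↔ ∀ i, μ.rowLen i ≤ ν.rowLen i := by
  constructor
  · intro h i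
    by_contra hlt
    push Not at hlt
    have h1 : (i, ν.rowLen i) ∈ μ := YoungDiagram.mem_iff_lt_rowLen.2 hlt
    exact absurd (YoungDiagram.mem_iff_lt_rowLen.1 (h h1)) (lt_irrefl _)
  · rintro h ⟨i, j⟩ hij
    exact YoungDiagram.mem_iff_lt_rowLen.2 ((YoungDiagram.mem_iff_lt_rowLen.1 hij).trans_le (h i))

theorem ext_rowLen {μ ν : YoungDiagram} (h : ∀ i, μ.rowLen i = ν.rowLen i) : μ = ν :=
  le_antisymm (le_iff_rowLen.2 fun i => (h i).le) (le_iff_rowLen.2 fun i => (h i).ge)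

theorem colLen_mono {μ ν : YoungDiagram} (h : μ ≤ ν) (j : ℕ) : μ.colLen j ≤ ν.colLen j := by
  rw [← YoungDiagram.rowLen_transpose, ← YoungDiagram.rowLen_transpose]
  exact le_iff_rowLen.1 (YoungDiagram.transpose_le_iff.2 h) j

theorem sum_cells {M : Type*} [AddCommMonoid M] (μ : YoungDiagram) {n : ℕ}
    (h : μ.colLen 0 ≤ n) (f : ℕ × ℕ → M) :
    ∑ c ∈ μ.cells, f c = ∑ i ∈ Finset.range n, ∑ j ∈ Finset.range (μ.rowLen i), f (i, j) := by
  rw [Finset.sum_sigma']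
  refine Finset.sum_bij' (fun c _ => ⟨c.1, c.2⟩) (fun s _ => (s.1, s.2)) ?_ ?_ ?_ ?_ ?_
  · rintro ⟨i, j⟩ hc
    have hc' : (i, j) ∈ μ := hc
    have h1 := YoungDiagram.mem_iff_lt_rowLen.1 hc'
    have h2 : ¬ μ.colLen 0 ≤ i := fun hh => by rw [rowLen_eq_zero hh] at h1; omega
    simp only [Finset.mem_sigma, Finset.mem_range]
    omega
  · rintro ⟨i, j⟩ hs
    simp only [Finset.mem_sigma, Finset.mem_range] at hs
    exact YoungDiagram.mem_iff_lt_rowLen.2 hs.2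
  · intros; rfl
  · intros; rfl
  · intros; rfl

theorem card_eq_sum_rowLen (μ : YoungDiagram) {n : ℕ} (h : μ.colLen 0 ≤ n) :
    μ.card = ∑ i ∈ Finset.range n, μ.rowLen i := by
  have := sum_cells μ h (fun _ => 1)
  simpa using this

theorem card_mono {μ ν : YoungDiagram} (h : μ ≤ ν) : μ.card ≤ ν.card :=
  Finset.card_le_card (YoungDiagram.cells_subset_iff.2 h)

theorem eq_of_le_of_card {μ ν : YoungDiagram} (h : μ ≤ ν) (hc : ν.card ≤ μ.card) : μ = ν :=
  YoungDiagram.ext (Finset.eq_of_subset_of_card_le (YoungDiagram.cells_subset_iff.2 h) hc)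

theorem card_transpose (μ : YoungDiagram) : μ.transpose.card = μ.card := by
  simp [YoungDiagram.card, YoungDiagram.transpose]

theorem card_bot : (⊥ : YoungDiagram).card = 0 := by simp [YoungDiagram.card]

theorem card_eq_zero_iff (μ : YoungDiagram) : μ.card = 0 ↔ μ = ⊥ :=
  ⟨fun h => (eq_of_le_of_card bot_le (by omega)).symm, by rintro rfl; exact card_bot⟩

theorem transpose_bot : (⊥ : YoungDiagram).transpose = ⊥ := by
  rw [← card_eq_zero_iff, card_transpose, card_bot]

theorem rowLen_bot (i : ℕ) : (⊥ : YoungDiagram).rowLen i = 0 := by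
  by_contra h
  exact YoungDiagram.notMem_bot (i, 0) (YoungDiagram.mem_iff_lt_rowLen.2 (Nat.pos_of_ne_zero h))

theorem colLen_bot (i : ℕ) : (⊥ : YoungDiagram).colLen i = 0 := by
  rw [← YoungDiagram.rowLen_transpose, transpose_bot, rowLen_bot]

theorem colLen_le_card (μ : YoungDiagram) (j : ℕ) : μ.colLen j ≤ μ.card := by
  rw [YoungDiagram.colLen_eq_card]
  exact Finset.card_le_card (Finset.filter_subset _ _)

theorem rowLen_le_card (μ : YoungDiagram) (j : ℕ) : μ.rowLen j ≤ μ.card := by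
  rw [YoungDiagram.rowLen_eq_card]
  exact Finset.card_le_card (Finset.filter_subset _ _)

/-- The diagram with prescribed row lengths. -/
def ofRows (f : ℕ → ℕ) (hf : Antitone f) (n : ℕ) (_hn : f n = 0) : YoungDiagram where
  cells := (Finset.range n).sigma (fun i => Finset.range (f i)) |>.map
    (Equiv.sigmaEquivProd ℕ ℕ).toEmbedding
  isLowerSet := by
    rintro ⟨i, j⟩ ⟨i', j'⟩ hle hm
    simp only [Finset.coe_map, Equiv.coe_toEmbedding, Set.mem_image, Finset.mem_coe,
      Finset.mem_sigma, Finset.mem_range, Sigma.exists, Equiv.sigmaEquivProd_apply,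
      Prod.mk.injEq] at hm ⊢
    obtain ⟨a, b, ⟨h1, h2⟩, rfl, rfl⟩ := hm
    refine ⟨i', j', ⟨lt_of_le_of_lt hle.1 h1, ?_⟩, rfl, rfl⟩
    exact lt_of_le_of_lt hle.2 (lt_of_lt_of_le h2 (hf hle.1))

theorem rowLen_ofRows (f : ℕ → ℕ) (hf : Antitone f) (n : ℕ) (hn : f n = 0) (i : ℕ) :
    (ofRows f hf n hn).rowLen i = f i := by
  have key : ∀ j, (i, j) ∈ ofRows f hf n hn ↔ j < f i := by
    intro j
    rw [← YoungDiagram.mem_cells]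
    simp only [ofRows, Finset.mem_map, Equiv.coe_toEmbedding, Finset.mem_sigma, Finset.mem_range,
      Sigma.exists, Equiv.sigmaEquivProd_apply, Prod.mk.injEq]
    constructor
    · rintro ⟨a, b, ⟨h1, h2⟩, rfl, rfl⟩; exact h2
    · intro h
      refine ⟨i, j, ⟨?_, h⟩, rfl, rfl⟩
      by_contra hh
      have := hf (not_lt.1 hh)
      omega
  apply le_antisymm
  · by_contra h
    have := (key (f i)).1 (YoungDiagram.mem_iff_lt_rowLen.2 (not_le.1 h))
    omega
  · by_contra h
    have := YoungDiagram.mem_iff_lt_rowLen.1 ((key _).2 (not_le.1 h))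
    omega

theorem colLen_ofRows_le (f : ℕ → ℕ) (hf : Antitone f) (n : ℕ) (hn : f n = 0) :
    (ofRows f hf n hn).colLen 0 ≤ n := by
  rw [← rowLen_eq_zero_iff, rowLen_ofRows, hn]

/-- The partitions of `n`. -/
noncomputable def parts (n : ℕ) : Finset YoungDiagram := (finite_card_eq n).toFinset

theorem mem_parts {n : ℕ} {μ : YoungDiagram} : μ ∈ parts n ↔ μ.card = n := by
  simp [parts]

/-- The partitions contained in `l`. -/
noncomputable def below (l : YoungDiagram) : Finset YoungDiagram := (finite_le l).toFinset

theorem mem_below {l μ : YoungDiagram} : μ ∈ below l ↔ μ ≤ l := by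
  simp [below]

/-! ### Contents -/

/-- Row i has content sum μ_i(μ_i - 1)/2 - i μ_i. In this form conjugation changes the sign, and a
new box changes κ by twice its content. -/
theorem kappa_eq_sum_cells (μ : YoungDiagram) :
    kappa μ = 2 * ∑ c ∈ μ.cells, ((c.2 : ℤ) - (c.1 : ℤ)) := by
  have h2 : ∀ m : ℕ, 2 * ∑ j ∈ Finset.range m, (j : ℤ) = m * (m - 1) := by
    intro m
    induction m with
    | zero => simp
    | succ m ih => rw [Finset.sum_range_succ, mul_add, ih]; push_cast; ring
  rw [kappa, sum_cells μ le_rfl, card_eq_sum_rowLen μ le_rfl, Finset.mul_sum, Nat.cast_sum,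
    ← Finset.sum_add_distrib]
  refine Finset.sum_congr rfl fun i _ => ?_
  simp only
  rw [Finset.sum_sub_distrib, mul_sub (2 : ℤ), h2, Finset.sum_const, Finset.card_range, nsmul_eq_mul]
  ring

theorem kappa_transpose (μ : YoungDiagram) : kappa μ.transpose = -kappa μ := by
  rw [kappa_eq_sum_cells, kappa_eq_sum_cells, ← mul_neg, ← Finset.sum_neg_distrib]
  congr 1
  refine Finset.sum_bij' (fun c _ => c.swap) (fun c _ => c.swap) ?_ ?_ ?_ ?_ ?_
  · intro c hc
    exact YoungDiagram.mem_transpose.1 hc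
  · intro c hc
    exact YoungDiagram.mem_transpose.2 (by simpa using hc)
  · simp
  · simp
  · simp

theorem kappa_bot : kappa ⊥ = 0 := by
  rw [kappa_eq_sum_cells]; simp

/-! ### Adding a box -/

/-- `ν` is `μ` with one more box. -/
def Covers (μ ν : YoungDiagram) : Prop := μ ≤ ν ∧ ν.card = μ.card + 1

theorem Covers.transpose {μ ν : YoungDiagram} (h : Covers μ ν) :
    Covers μ.transpose ν.transpose :=
  ⟨YoungDiagram.transpose_le_iff.2 h.1, by rw [card_transpose, card_transpose, h.2]⟩

/-- The new box of a cover ends one row. -/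
theorem Covers.exists_row {μ ν : YoungDiagram} (h : Covers μ ν) :
    ∃ r, ν.rowLen r = μ.rowLen r + 1 ∧ ∀ i, i ≠ r → ν.rowLen i = μ.rowLen i := by
  set n := ν.colLen 0 with hn
  have h1 := card_eq_sum_rowLen ν (n := n) le_rfl
  have h2 := card_eq_sum_rowLen μ (n := n) (colLen_mono h.1 0)
  have hle := le_iff_rowLen.1 h.1
  have h3 : ∃ r ∈ Finset.range n, μ.rowLen r < ν.rowLen r := by
    apply Finset.exists_lt_of_sum_lt
    rw [← h1, ← h2, h.2]; omega
  obtain ⟨r, hr, hlt⟩ := h3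
  have h4 := h.2
  rw [h1, h2, ← Finset.add_sum_erase _ _ hr, ← Finset.add_sum_erase _ μ.rowLen hr] at h4
  have h5 : ∑ i ∈ (Finset.range n).erase r, μ.rowLen i ≤
      ∑ i ∈ (Finset.range n).erase r, ν.rowLen i := Finset.sum_le_sum fun i _ => hle i
  refine ⟨r, by omega, fun i hi => ?_⟩
  have h6 : ∑ i ∈ (Finset.range n).erase r, μ.rowLen i =
      ∑ i ∈ (Finset.range n).erase r, ν.rowLen i := by omega
  by_cases hin : i < n
  · exact ((Finset.sum_eq_sum_iff_of_le fun i _ => hle i).1 h6 i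
      (Finset.mem_erase.2 ⟨hi, Finset.mem_range.2 hin⟩)).symm
  · have := rowLen_eq_zero (not_lt.1 hin)
    have := hle i
    omega

theorem kappa_sub_of_covers {μ ν : YoungDiagram} {r : ℕ} (h : Covers μ ν)
    (hr : ν.rowLen r = μ.rowLen r + 1) (hi : ∀ i, i ≠ r → ν.rowLen i = μ.rowLen i) :
    kappa ν - kappa μ = 2 * ((μ.rowLen r : ℤ) - r) := by
  have hrn : r ∈ Finset.range (ν.colLen 0) := by
    rw [Finset.mem_range]
    by_contra hh
    have := rowLen_eq_zero (not_lt.1 hh)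
    omega
  rw [kappa_eq_sum_cells, kappa_eq_sum_cells, ← mul_sub, sum_cells ν le_rfl,
    sum_cells μ (colLen_mono h.1 0), ← Finset.add_sum_erase _ _ hrn,
    ← Finset.add_sum_erase _ (fun i => ∑ j ∈ Finset.range (μ.rowLen i), ((j : ℤ) - (i : ℤ))) hrn,
    hr, Finset.sum_range_succ]
  have h1 : ∑ i ∈ (Finset.range (ν.colLen 0)).erase r, ∑ j ∈ Finset.range (ν.rowLen i),
      ((j : ℤ) - (i : ℤ)) = ∑ i ∈ (Finset.range (ν.colLen 0)).erase r,
      ∑ j ∈ Finset.range (μ.rowLen i), ((j : ℤ) - (i : ℤ)) :=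
    Finset.sum_congr rfl (fun i hi' => by rw [hi i (Finset.ne_of_mem_erase hi')])
  simp only at h1 ⊢
  rw [h1]
  ring

/-- Every nonempty partition arises from a smaller one by adding a box. -/
theorem exists_covers {ν : YoungDiagram} (h : ν ≠ ⊥) : ∃ μ, Covers μ ν := by
  set n := ν.colLen 0 with hn
  have hn0 : 0 < n := by
    by_contra h0
    apply h
    refine ext_rowLen fun i => ?_
    rw [rowLen_bot, rowLen_eq_zero_iff]; omega
  have hpos : 0 < ν.rowLen (n - 1) := by
    by_contra h0
    have := (rowLen_eq_zero_iff ν (n - 1)).1 (by omega)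
    omega
  have hz : ∀ i, n ≤ i → ν.rowLen i = 0 := fun i hi => rowLen_eq_zero hi
  -- The last box of the last row is always removable.
  let f : ℕ → ℕ := fun i => if i = n - 1 then ν.rowLen i - 1 else ν.rowLen i
  have hf : Antitone f := by
    refine antitone_nat_of_succ_le fun i => ?_
    have h3 := ν.rowLen_anti i (i + 1) (by omega)
    have := hz (i + 1)
    simp only [f]
    split_ifs with h1 h2
    · omega
    · omega
    · rw [this (by omega)]; omega
    · omega
  refine ⟨ofRows f hf n (by simp [f, hz]), ?_, ?_⟩
  · rw [le_iff_rowLen]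
    intro i
    rw [rowLen_ofRows]
    simp only [f]; split_ifs <;> omega
  · rw [card_eq_sum_rowLen _ (colLen_ofRows_le f hf n _), card_eq_sum_rowLen ν (n := n) le_rfl]
    have hm : n - 1 ∈ Finset.range n := Finset.mem_range.2 (by omega)
    rw [← Finset.add_sum_erase _ _ hm, ← Finset.add_sum_erase _ (ofRows f hf n _).rowLen hm,
      Finset.sum_congr rfl (g := (ofRows f hf n (by simp [f, hz])).rowLen)]
    · rw [rowLen_ofRows]; simp only [f, if_pos]; omega
    · intro i hi
      rw [rowLen_ofRows]; simp [f, Finset.ne_of_mem_erase hi]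

/-- Induction on partitions, one box at a time. -/
theorem covers_induction {P : YoungDiagram → Prop} (h0 : P ⊥)
    (h : ∀ μ ν, Covers μ ν → P μ → P ν) (ν : YoungDiagram) : P ν := by
  induction hn : ν.card generalizing ν with
  | zero => rw [(card_eq_zero_iff ν).1 hn]; exact h0
  | succ n ih =>
    obtain ⟨μ, hμ⟩ := exists_covers (ν := ν) (by rintro rfl; rw [card_bot] at hn; omega)
    exact h μ ν hμ (ih μ (by have := hμ.2; omega))

end TopVertex

namespace TopVertex

/-! ### The Cauchy–Binet formula -/

/-- The strictly decreasing sequence `μ_i + (n - 1 - i)` that encodes a partition with at most `n`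
rows. -/
def beta (n : ℕ) (μ : YoungDiagram) (i : Fin n) : ℕ := μ.rowLen i + (n - 1 - i)

theorem beta_strictAnti (n : ℕ) (μ : YoungDiagram) : StrictAnti (beta n μ) := by
  intro i j hij
  have h1 := μ.rowLen_anti i j (le_of_lt hij)
  have h2 : (i : ℕ) < j := hij
  have := j.2
  simp only [beta]
  omega

theorem beta_injective (n : ℕ) (μ : YoungDiagram) : Function.Injective (beta n μ) :=
  (beta_strictAnti n μ).injective

theorem eq_of_beta_eq {n : ℕ} {μ ν : YoungDiagram} (hμ : μ.colLen 0 ≤ n) (hν : ν.colLen 0 ≤ n)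
    (h : beta n μ = beta n ν) : μ = ν := by
  refine ext_rowLen fun i => ?_
  by_cases hi : i < n
  · have := congrFun h ⟨i, hi⟩
    simp only [beta] at this
    omega
  · rw [rowLen_eq_zero (by omega), rowLen_eq_zero (by omega)]

theorem exists_beta_eq {n : ℕ} (g : Fin n → ℕ) (hg : StrictAnti g) :
    ∃ μ : YoungDiagram, μ.colLen 0 ≤ n ∧ beta n μ = g := by
  have step : ∀ i (hi : i + 1 < n), g ⟨i + 1, hi⟩ < g ⟨i, by omega⟩ := fun i hi =>
    hg (by simp)
  -- Strict decrease forces `g (n - 1 - k) ≥ k`, so the natural subtraction in `f` below does not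
  -- truncate.
  have low : ∀ k (hk : k < n), k ≤ g ⟨n - 1 - k, by omega⟩ := by
    intro k
    induction k with
    | zero => intro _; exact Nat.zero_le _
    | succ k ih =>
      intro hk
      have h1 := ih (by omega)
      have h2 := step (n - 1 - (k + 1)) (by omega)
      have h3 : n - 1 - (k + 1) + 1 = n - 1 - k := by omega
      simp only [h3] at h2
      omega
  let f : ℕ → ℕ := fun i => if h : i < n then g ⟨i, h⟩ - (n - 1 - i) else 0
  have hf : Antitone f := by
    refine antitone_nat_of_succ_le fun i => ?_
    simp only [f]
    split_ifs with h1 h2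
    · have := step i h1
      omega
    · omega
    · omega
    · omega
  refine ⟨ofRows f hf n (by simp [f]), colLen_ofRows_le _ _ _ _, funext fun i => ?_⟩
  have := low (n - 1 - i) (by omega)
  have h3 : n - 1 - (n - 1 - (i : ℕ)) = i := by omega
  simp only [h3] at this
  simp only [beta, rowLen_ofRows, f, i.2, dif_pos, Fin.eta] at this ⊢
  omega

/-- Multilinearity in the rows: each row is a sum over m, and choosing one summand per row is
choosing a function f. -/
theorem det_sum_eq_sum_prod_mul_det {A : Type*} [CommRing A] {n : ℕ} (s : Finset ℕ)
    (F G : Fin n → ℕ → A) :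
    Matrix.det (Matrix.of fun i j => ∑ m ∈ s, F i m * G j m) =
      ∑ f ∈ Fintype.piFinset (fun _ : Fin n => s),
        (∏ i, F i (f i)) * Matrix.det (Matrix.of fun i j => G j (f i)) := by
  have h1 : (Matrix.of fun i j => ∑ m ∈ s, F i m * G j m) =
      (fun i => ∑ m ∈ s, F i m • (fun j => G j m)) := by
    funext i j
    simp [Finset.sum_apply]
  have h2 := (Matrix.detRowAlternating (n := Fin n) (R := A)).toMultilinearMap.map_sum_finset
    (fun i m => F i m • (fun j => G j m)) (fun _ => s)
  rw [h1]
  refine Eq.trans h2 (Finset.sum_congr rfl fun f _ => ?_)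
  exact (Matrix.detRowAlternating (n := Fin n) (R := A)).toMultilinearMap.map_smul_univ
    (fun i => F i (f i)) (fun i => fun j => G j (f i))

/-- The Cauchy–Binet formula; the `n`-subsets of `{0, …, N - 1}` are encoded by partitions. -/
theorem cauchyBinet {A : Type*} [CommRing A] {n : ℕ} (N : ℕ) (S : Finset YoungDiagram)
    (hS : ∀ ν : YoungDiagram, ν ∈ S ↔ ν.colLen 0 ≤ n ∧ ∀ i, beta n ν i < N)
    (F G : Fin n → ℕ → A) :
    Matrix.det (Matrix.of fun i j => ∑ m ∈ Finset.range N, F i m * G j m) =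
      ∑ ν ∈ S, Matrix.det (Matrix.of fun i j => F i (beta n ν j)) *
        Matrix.det (Matrix.of fun i j => G i (beta n ν j)) := by
  classical
  rw [det_sum_eq_sum_prod_mul_det]
  have hdet : ∀ f : Fin n → ℕ, ¬ Function.Injective f →
      Matrix.det (Matrix.of fun i j => G j (f i)) = 0 := by
    intro f hf
    simp only [Function.Injective, not_forall] at hf
    obtain ⟨i, j, h, hij⟩ := hf
    exact Matrix.det_zero_of_row_eq hij (by funext k; simp [h])
  have hR : ∀ ν ∈ S, Matrix.det (Matrix.of fun i j => F i (beta n ν j)) *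
        Matrix.det (Matrix.of fun i j => G i (beta n ν j)) =
      ∑ σ : Equiv.Perm (Fin n), (∏ i, F i (beta n ν (σ i))) *
        Matrix.det (Matrix.of fun i j => G j (beta n ν (σ i))) := by
    intro ν _
    rw [← Matrix.det_transpose, Matrix.det_apply', Finset.sum_mul]
    refine Finset.sum_congr rfl fun σ _ => ?_
    have h1 := Matrix.det_permute σ (Matrix.of fun i j => G j (beta n ν i))
    have h2 : (Matrix.of fun i j => G j (beta n ν i)).submatrix σ id =
      Matrix.of fun i j => G j (beta n ν (σ i)) := rfl
    rw [h2] at h1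
    rw [h1, ← Matrix.det_transpose (Matrix.of fun i j => G j (beta n ν i))]
    simp only [Matrix.transpose_apply, Matrix.of_apply]
    have h3 : (Matrix.of fun i j => G j (beta n ν i)).transpose =
      Matrix.of fun i j => G i (beta n ν j) := rfl
    rw [h3]; ring
  rw [Finset.sum_congr rfl hR, ← Finset.sum_product']
  symm
  -- An injective f is β ∘ σ for exactly one partition and one permutation. The remaining f give two
  -- equal rows.
  refine Finset.sum_of_injOn (fun p => beta n p.1 ∘ p.2) ?_ ?_ ?_ ?_
  · rintro ⟨ν, σ⟩ h1 ⟨ν', σ'⟩ h2 h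
    simp only [Finset.coe_product, Set.mem_prod, Finset.mem_coe, hS] at h1 h2
    simp only at h
    have h3 : beta n ν = beta n ν' := by
      apply ((beta_strictAnti n ν).range_inj (beta_strictAnti n ν')).1
      rw [← σ.surjective.range_comp, h, σ'.surjective.range_comp]
    have h4 := eq_of_beta_eq h1.1.1 h2.1.1 h3
    subst h4
    have h5 : σ = σ' := by
      ext i
      rw [beta_injective n ν (congrFun h i)]
    rw [h5]
  · rintro ⟨ν, σ⟩ h1
    simp only [Finset.coe_product, Set.mem_prod, Finset.mem_coe, hS] at h1
    simp only [Finset.mem_coe, Fintype.mem_piFinset, Finset.mem_range, Function.comp_apply]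
    exact fun i => h1.1.2 _
  · intro f hf hnot
    rw [hdet f, mul_zero]
    intro hinj
    apply hnot
    rw [Fintype.mem_piFinset] at hf
    -- Sorting gives an increasing sequence; composing with `Fin.rev` gives the decreasing one that
    -- encodes a partition.
    have hsm : StrictMono (f ∘ Tuple.sort f) :=
      (Tuple.monotone_sort f).strictMono_of_injective (hinj.comp (Tuple.sort f).injective)
    obtain ⟨ν, hν, hb⟩ := exists_beta_eq ((f ∘ Tuple.sort f) ∘ Fin.rev)
      (hsm.comp_strictAnti Fin.rev_strictAnti)
    refine ⟨(ν, (Tuple.sort f).symm.trans Fin.revPerm), ?_, ?_⟩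
    · simp only [Finset.coe_product, Set.mem_prod, Finset.mem_coe, hS, Finset.mem_univ, and_true]
      refine ⟨hν, fun i => ?_⟩
      rw [hb]
      exact Finset.mem_range.1 (hf _)
    · funext i
      simp [hb]
  · rintro ⟨ν, σ⟩ _
    rfl

/-! ### Jacobi–Trudi determinants with a varying number of rows -/

section JacobiTrudi

variable {A : Type*} [CommRing A]

/-- The zero block has n - r rows and r + 1 columns, so by the pigeonhole principle every
permutation meets it. -/
theorem det_eq_zero_of_block {n : ℕ} (M : Matrix (Fin n) (Fin n) A) (r : Fin n)
    (h : ∀ i j, r ≤ i → j ≤ r → M i j = 0) : M.det = 0 := by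
  rw [Matrix.det_apply]
  refine Finset.sum_eq_zero fun σ _ => ?_
  have : ∃ j ≤ r, r ≤ σ j := by
    by_contra hc
    push Not at hc
    have h1 : (Finset.Iic r).card ≤ (Finset.Iio r).card := by
      refine Finset.card_le_card_of_injOn σ ?_ σ.injective.injOn
      intro j hj
      simp only [Finset.coe_Iic, Set.mem_Iic] at hj
      simpa using hc j hj
    simp at h1
  obtain ⟨j, hj, hr⟩ := this
  have h2 : ∏ i, M (σ i) i = 0 := Finset.prod_eq_zero (Finset.mem_univ j) (h _ _ hr hj)
  rw [h2, smul_zero]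

/-- Since a_n = 0, the last row has negative indices before the diagonal, so it is (0, …, 0, 1), and
expansion along it removes it. -/
theorem jacobiTrudi_succ (h : ℤ → A) (h0 : h 0 = 1) (hneg : ∀ n < 0, h n = 0) (n : ℕ)
    (a b : ℕ → ℕ) (ha : a n = 0) (hb : b n = 0) :
    Matrix.det (Matrix.of fun i j : Fin (n + 1) =>
      h ((a i : ℤ) - (b j : ℤ) - (i : ℤ) + (j : ℤ))) =
    Matrix.det (Matrix.of fun i j : Fin n =>
      h ((a i : ℤ) - (b j : ℤ) - (i : ℤ) + (j : ℤ))) := by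
  rw [Matrix.det_succ_row _ (Fin.last n), Finset.sum_eq_single (Fin.last n)]
  · simp only [Fin.val_last, Matrix.of_apply, ha, hb, Matrix.submatrix, Fin.succAbove_last]
    rw [show ((n : ℕ) + n) = 2 * n by ring, pow_mul]
    simp [h0]
  · intro j _ hj
    have : (j : ℕ) < n := by
      have := j.2
      have h3 : (j : ℕ) ≠ n := fun hh => hj (Fin.ext hh)
      omega
    rw [Matrix.of_apply, hneg, mul_zero, zero_mul]
    simp only [Fin.val_last, ha]
    omega
  · simp

end JacobiTrudi

/-! ### Skew Schur functions as determinants, and the rule for unions of alphabets. -/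

section Skew

variable {A : Type*} [CommRing A] [Algebra ℚ A]

theorem completeHInt_of_neg (p : ℕ → A) {n : ℤ} (h : n < 0) : completeHInt p n = 0 := by
  rw [completeHInt, if_neg (by omega)]

theorem completeHInt_natCast (p : ℕ → A) (n : ℕ) : completeHInt p n = completeH p n := by
  rw [completeHInt, if_pos (by omega), Int.toNat_natCast]

theorem completeH_zero (p : ℕ → A) : completeH p 0 = 1 := by rw [completeH]

theorem completeHInt_zero (p : ℕ → A) : completeHInt p 0 = 1 := by
  simpa [completeH_zero] using completeHInt_natCast p 0

/-- The Jacobi–Trudi determinant may be taken with any sufficiently large number of rows. -/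
theorem skewSchur_eq_det (p : ℕ → A) {l m : YoungDiagram} {n : ℕ} (hl : l.colLen 0 ≤ n)
    (hm : m.colLen 0 ≤ n) :
    skewSchur p l m = Matrix.det (Matrix.of fun i j : Fin n =>
      completeHInt p ((beta n l i : ℤ) - (beta n m j : ℤ))) := by
  have hent : (Matrix.of fun i j : Fin n =>
      completeHInt p ((beta n l i : ℤ) - (beta n m j : ℤ))) = Matrix.of fun i j : Fin n =>
      completeHInt p ((l.rowLen i : ℤ) - (m.rowLen j : ℤ) - (i : ℤ) + (j : ℤ)) := by
    ext i j
    simp only [Matrix.of_apply, beta]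
    congr 1
    have := i.2
    have := j.2
    omega
  rw [hent, skewSchur]
  split_ifs with hle
  · clear hm hent
    induction n, hl using Nat.le_induction with
    | base => rfl
    | succ n hn ih =>
      rw [ih]
      exact (jacobiTrudi_succ _ (completeHInt_zero p) (fun _ => completeHInt_of_neg p) n _ _
        (rowLen_eq_zero hn) (rowLen_eq_zero ((colLen_mono hle 0).trans hn))).symm
  -- A row r with l_r < m_r makes all indices with i ≥ r and j ≤ r negative, so the determinant
  -- vanishes as the definition demands.
  · rw [le_iff_rowLen] at hle
    push Not at hle
    obtain ⟨r, hr⟩ := hle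
    have hrn : r < n := by
      by_contra h
      rw [rowLen_eq_zero (μ := m) (by omega)] at hr
      omega
    symm
    apply det_eq_zero_of_block _ ⟨r, hrn⟩
    intro i j hi hj
    have h1 : r ≤ i := hi
    have h2 : (j : ℕ) ≤ r := hj
    have h3 := l.rowLen_anti r i h1
    have h4 := m.rowLen_anti j r h2
    rw [Matrix.of_apply]
    apply completeHInt_of_neg
    omega

theorem skewSchur_of_not_le (p : ℕ → A) {l m : YoungDiagram} (h : ¬ m ≤ l) :
    skewSchur p l m = 0 := by
  rw [skewSchur, if_neg h]

theorem skewSchur_self (p : ℕ → A) (l : YoungDiagram) : skewSchur p l l = 1 := by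
  rw [skewSchur_eq_det p le_rfl le_rfl, Matrix.det_of_isUpperTriangular]
  · exact Finset.prod_eq_one fun i _ => by simp [completeHInt_zero]
  · intro i j hij
    rw [Matrix.of_apply]
    apply completeHInt_of_neg
    have := beta_strictAnti _ l (show j < i from hij)
    omega

/-- The indices in the determinant are at most l_i + j ≤ 2|l|. This bound lets an alphabet be
replaced by a finite list of letters. -/
theorem skewSchur_congr {p p' : ℕ → A} {l : YoungDiagram}
    (h : ∀ n ≤ 2 * l.card, completeH p n = completeH p' n) (m : YoungDiagram) :
    skewSchur p l m = skewSchur p' l m := by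
  rw [skewSchur, skewSchur]
  split_ifs
  · congr 2
    ext i j
    simp only [completeHInt]
    split_ifs
    · apply h
      have := rowLen_le_card l i
      have := colLen_le_card l 0
      have := j.2
      omega
    · rfl
  · rfl

theorem completeH_congr {p p' : ℕ → A} (h : ∀ k, 1 ≤ k → p k = p' k) (n : ℕ) :
    completeH p n = completeH p' n := by
  have : PowerSeries.mk (completeH p) = PowerSeries.mk (completeH p') := by
    apply mk_completeH_unique
    · simp [completeH_zero]
    · rw [derivative_completeH]
      simp [h]
  simpa using congrArg (PowerSeries.coeff n) this

theorem skewSchur_congr_powerSum {p p' : ℕ → A} (h : ∀ k, 1 ≤ k → p k = p' k)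
    (l m : YoungDiagram) : skewSchur p l m = skewSchur p' l m :=
  skewSchur_congr (fun n _ => completeH_congr h n) m

theorem map_completeH {B : Type*} [CommRing B] [Algebra ℚ B] (f : A →+* B) (p : ℕ → A) (n : ℕ) :
    f (completeH p n) = completeH (fun k => f (p k)) n := by
  induction n using Nat.strong_induction_on with
  | _ n ih =>
    cases n with
    | zero => simp [completeH_zero]
    | succ n =>
      rw [completeH, completeH, map_rat_smul f, map_sum]
      congr 1
      refine Finset.sum_congr rfl fun k _ => ?_
      rw [map_mul, ih (n - k) (by omega)]

theorem map_skewSchur {B : Type*} [CommRing B] [Algebra ℚ B] (f : A →+* B) (p : ℕ → A)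
    (l m : YoungDiagram) : f (skewSchur p l m) = skewSchur (fun k => f (p k)) l m := by
  rw [skewSchur, skewSchur]
  split_ifs
  · rw [RingHom.map_det]
    congr 1
    ext i j
    simp only [RingHom.mapMatrix_apply, Matrix.map_apply, Matrix.of_apply, completeHInt]
    split_ifs
    · exact map_completeH f p _
    · simp
  · simp

theorem completeH_add (p p' : ℕ → A) (n : ℕ) :
    completeH (fun k => p k + p' k) n =
      ∑ m ∈ Finset.range (n + 1), completeH p m * completeH p' (n - m) := by
  have := congrArg (PowerSeries.coeff n) (mk_completeH_add p p')
  rw [PowerSeries.coeff_mul, Finset.Nat.sum_antidiagonal_eq_sum_range_succ_mk] at this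
  simpa using this

/-- The bounds on a and b ensure that the window [0, N) contains every m for which both factors are
nonzero. The right side is an entry of a product of two matrices, ready for `cauchyBinet`. -/
theorem completeHInt_add (p p' : ℕ → A) (a b : ℤ) (N : ℕ) (ha : a < N) (hb : 0 ≤ b) :
    completeHInt (fun k => p k + p' k) (a - b) =
      ∑ m ∈ Finset.range N, completeHInt p (a - m) * completeHInt p' (m - b) := by
  by_cases hab : a - b < 0
  · rw [completeHInt_of_neg _ hab, eq_comm]
    refine Finset.sum_eq_zero fun m _ => ?_
    by_cases h : a - m < 0
    · rw [completeHInt_of_neg _ h, zero_mul]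
    · rw [completeHInt_of_neg p' (by omega), mul_zero]
  · obtain ⟨d, hd⟩ := Int.eq_ofNat_of_zero_le (not_lt.1 hab)
    obtain ⟨b, rfl⟩ := Int.eq_ofNat_of_zero_le hb
    rw [hd, completeHInt_natCast]
    have h1 := completeH_add p' p d
    simp only [add_comm (p' _)] at h1
    rw [h1]
    refine Finset.sum_of_injOn (fun m => m + b) ?_ ?_ ?_ ?_
    · intro x _ y _ h
      simpa using h
    · intro m hm
      simp only [Finset.coe_range, Set.mem_Iio] at hm ⊢
      omega
    · intro m hm hnot
      by_cases h2 : (m : ℤ) - b < 0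
      · rw [completeHInt_of_neg p' h2, mul_zero]
      · rw [completeHInt_of_neg p, zero_mul]
        by_contra h3
        apply hnot
        refine ⟨m - b, ?_, ?_⟩
        · simp only [Finset.coe_range, Set.mem_Iio]; omega
        · simp only; omega
    · intro m hm
      rw [Finset.mem_range] at hm
      have e1 : a - ((m + b : ℕ) : ℤ) = ((d - m : ℕ) : ℤ) := by omega
      have e2 : ((m + b : ℕ) : ℤ) - b = (m : ℤ) := by omega
      rw [e1, e2, completeHInt_natCast, completeHInt_natCast, mul_comm]

/-- Partitions with at most `n` rows of length at most `N - n`. -/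
theorem exists_finset_beta_lt (n N : ℕ) : ∃ S : Finset YoungDiagram,
    ∀ ν : YoungDiagram, ν ∈ S ↔ ν.colLen 0 ≤ n ∧ ∀ i, beta n ν i < N := by
  have hfin : {ν : YoungDiagram | ν.colLen 0 ≤ n ∧ ∀ i, beta n ν i < N}.Finite := by
    refine ((Set.finite_Iic (n * N)).biUnion (fun k _ => finite_card_eq k)).subset ?_
    rintro ν ⟨h1, h2⟩
    simp only [Set.mem_iUnion]
    refine ⟨ν.card, ?_, rfl⟩
    rw [Set.mem_Iic, card_eq_sum_rowLen ν h1]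
    calc ∑ i ∈ Finset.range n, ν.rowLen i ≤ ∑ i ∈ Finset.range n, N := by
          refine Finset.sum_le_sum fun i hi => ?_
          have := h2 ⟨i, Finset.mem_range.1 hi⟩
          simp only [beta] at this
          omega
      _ = n * N := by simp
  exact ⟨hfin.toFinset, fun ν => by simp⟩

/-- Products of skew Schur functions with a common inner shape as one determinant. -/
theorem sum_skewSchur_mul_skewSchur_inner (p p' : ℕ → A) (l m : YoungDiagram) (n N : ℕ)
    (hl : l.colLen 0 ≤ n) (hm : m.colLen 0 ≤ n) (hN : ∀ i, beta n l i < N) :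
    ∑ ν ∈ below l, skewSchur p l ν * skewSchur p' m ν =
      Matrix.det (Matrix.of fun i j : Fin n => ∑ k ∈ Finset.range N,
        completeHInt p ((beta n l i : ℤ) - k) * completeHInt p' ((beta n m j : ℤ) - k)) := by
  obtain ⟨S, hS⟩ := exists_finset_beta_lt n N
  rw [cauchyBinet N S hS (fun i k => completeHInt p ((beta n l i : ℤ) - k))
    (fun i k => completeHInt p' ((beta n m i : ℤ) - k))]
  trans ∑ ν ∈ S, skewSchur p l ν * skewSchur p' m ν
  · apply Finset.sum_subset
    · intro ν hν
      rw [mem_below] at hν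
      rw [hS]
      refine ⟨(colLen_mono hν 0).trans hl, fun i => lt_of_le_of_lt ?_ (hN i)⟩
      have := le_iff_rowLen.1 hν i
      simp only [beta]; omega
    · intro ν _ hν
      rw [mem_below] at hν
      rw [skewSchur_of_not_le p hν, zero_mul]
  · refine Finset.sum_congr rfl fun ν hν => ?_
    rw [hS] at hν
    rw [skewSchur_eq_det p hl hν.1, skewSchur_eq_det p' hm hν.1]

/-- Skew Schur functions of a union of alphabets. -/
theorem skewSchur_add (p p' : ℕ → A) (l m : YoungDiagram) :
    skewSchur (fun k => p k + p' k) l m =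
      ∑ ν ∈ below l, skewSchur p l ν * skewSchur p' ν m := by
  set n := max (l.colLen 0) (m.colLen 0) with hn
  have hl : l.colLen 0 ≤ n := le_max_left _ _
  have hm : m.colLen 0 ≤ n := le_max_right _ _
  set N := l.rowLen 0 + n with hNdef
  have hN : ∀ i, beta n l i < N := by
    intro i
    have := l.rowLen_anti 0 i (Nat.zero_le _)
    have := i.2
    simp only [beta]; omega
  obtain ⟨S, hS⟩ := exists_finset_beta_lt n N
  -- The Jacobi–Trudi matrix of the union is the product of those of the two alphabets, and the
  -- minors are indexed by the intermediate partitions ν.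
  have key := cauchyBinet N S hS (fun i k => completeHInt p ((beta n l i : ℤ) - k))
    (fun j k => completeHInt p' ((k : ℤ) - (beta n m j : ℤ)))
  rw [skewSchur_eq_det _ hl hm]
  have h1 : ∀ i j : Fin n, completeHInt (fun k => p k + p' k)
      ((beta n l i : ℤ) - (beta n m j : ℤ)) = ∑ k ∈ Finset.range N,
        completeHInt p ((beta n l i : ℤ) - k) * completeHInt p' ((k : ℤ) - (beta n m j : ℤ)) :=
    fun i j => completeHInt_add p p' _ _ N (by exact_mod_cast hN i) (by omega)
  simp only [h1]
  rw [key, Finset.sum_congr rfl (g := fun ν => skewSchur p l ν * skewSchur p' ν m)]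
  · symm
    apply Finset.sum_subset
    · intro ν hν
      rw [mem_below] at hν
      rw [hS]
      refine ⟨(colLen_mono hν 0).trans hl, fun i => lt_of_le_of_lt ?_ (hN i)⟩
      have := le_iff_rowLen.1 hν i
      simp only [beta]; omega
    · intro ν _ hν
      rw [mem_below] at hν
      rw [skewSchur_of_not_le p hν, zero_mul]
  · intro ν hν
    rw [hS] at hν
    rw [skewSchur_eq_det p hl hν.1, skewSchur_eq_det p' hν.1 hm, ← Matrix.det_transpose
      (Matrix.of fun i j : Fin n => completeHInt p' ((beta n ν i : ℤ) - (beta n m j : ℤ)))]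
    rfl

end Skew

end TopVertex

namespace TopVertex

/-! ### Homogeneity of skew Schur functions. -/

section Scaling

variable {A : Type*} [CommRing A] [Algebra ℚ A]

theorem completeH_scale (c : A) (p : ℕ → A) (n : ℕ) :
    completeH (fun k => c ^ k * p k) n = c ^ n * completeH p n := by
  induction n using Nat.strong_induction_on with
  | _ n ih =>
    cases n with
    | zero => simp [completeH_zero]
    | succ n =>
      rw [completeH, completeH, mul_smul_comm, Finset.mul_sum]
      congr 1
      refine Finset.sum_congr rfl fun k _ => ?_
      have hk : c ^ (n + 1) = c ^ ((k : ℕ) + 1) * c ^ (n - k) := by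
        rw [← pow_add]; congr 1; have := k.2; omega
      rw [ih (n - k) (by omega), hk]
      ring

theorem sum_beta {n : ℕ} {l : YoungDiagram} (h : l.colLen 0 ≤ n) :
    ∑ i : Fin n, beta n l i = l.card + ∑ i : Fin n, (n - 1 - (i : ℕ)) := by
  simp only [beta]
  rw [Finset.sum_add_distrib, card_eq_sum_rowLen l h, Finset.sum_range]

/-- Each nonzero term of the determinant has total degree ∑ β(l) - ∑ β(m) = |l| - |m|. -/
theorem skewSchur_scale (c : A) (p : ℕ → A) (l m : YoungDiagram) :
    skewSchur (fun k => c ^ k * p k) l m = c ^ (l.card - m.card) * skewSchur p l m := by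
  by_cases hle : m ≤ l
  swap
  · rw [skewSchur_of_not_le _ hle, skewSchur_of_not_le _ hle, mul_zero]
  have hm := colLen_mono hle 0
  rw [skewSchur_eq_det _ le_rfl hm, skewSchur_eq_det _ le_rfl hm]
  set n := l.colLen 0 with hn
  rw [Matrix.det_apply, Matrix.det_apply, Finset.mul_sum]
  refine Finset.sum_congr rfl fun σ _ => ?_
  rw [mul_smul_comm]
  congr 1
  simp only [Matrix.of_apply]
  -- A negative index kills the term on both sides; otherwise the differences of the β are honest
  -- natural numbers.
  by_cases hneg : ∃ i, (beta n l (σ i) : ℤ) - (beta n m i : ℤ) < 0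
  · obtain ⟨i, hi⟩ := hneg
    rw [Finset.prod_eq_zero (Finset.mem_univ i) (completeHInt_of_neg _ hi),
      Finset.prod_eq_zero (Finset.mem_univ i) (completeHInt_of_neg _ hi), mul_zero]
  · push Not at hneg
    have h1 : ∀ i, (beta n l (σ i) : ℤ) - (beta n m i : ℤ) =
        ((beta n l (σ i) - beta n m i : ℕ) : ℤ) := fun i => by have := hneg i; omega
    simp only [h1, completeHInt_natCast, completeH_scale]
    rw [Finset.prod_mul_distrib, Finset.prod_pow_eq_pow_sum]
    congr 2
    have h2 : ∑ i, (beta n l (σ i) - beta n m i) + ∑ i, beta n m i = ∑ i, beta n l i := by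
      rw [← Finset.sum_add_distrib, ← Equiv.sum_comp σ (beta n l)]
      exact Finset.sum_congr rfl fun i _ => by have := hneg i; omega
    rw [sum_beta hn.ge, sum_beta hm] at h2
    omega

open scoped Classical in
theorem skewSchur_zero (l m : YoungDiagram) :
    skewSchur (fun _ => (0 : A)) l m = if l = m then 1 else 0 := by
  split_ifs with h
  · rw [h, skewSchur_self]
  · by_cases hle : m ≤ l
    -- The empty alphabet is itself scaled by 0, so homogeneity leaves the factor 0 to the power |l|
    -- - |m| > 0.
    · rw [skewSchur_congr_powerSum (p' := fun k => (0 : A) ^ k * 0), skewSchur_scale, zero_pow,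
        zero_mul]
      · intro h0
        exact h (eq_of_le_of_card hle (by omega)).symm
      · simp
    · rw [skewSchur_of_not_le _ hle]

theorem completeH_zero_alphabet (n : ℕ) :
    completeH (fun _ => (0 : A)) n = if n = 0 then 1 else 0 := by
  cases n with
  | zero => simp [completeH_zero]
  | succ n => simp [completeH]

/-- Two skewing steps by different alphabets may be interchanged degree by degree. -/
theorem sum_skewSchur_mul_comm (x y : ℕ → A) (w : ℕ → A) (c τ : YoungDiagram) :
    ∑ κ ∈ below c, w (κ.card - τ.card) * (skewSchur x c κ * skewSchur y κ τ) =
      ∑ κ ∈ below c, w (c.card - κ.card) * (skewSchur y c κ * skewSchur x κ τ) := by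
  -- The letters of y are marked by a variable X. Both sides then expand the same skew Schur
  -- function of the union, in the two possible orders.
  let x' : ℕ → Polynomial A := fun k => Polynomial.C (x k)
  let y' : ℕ → Polynomial A := fun k => Polynomial.X ^ k * Polynomial.C (y k)
  have hx : ∀ l m, skewSchur x' l m = Polynomial.C (skewSchur x l m) := fun l m =>
    (map_skewSchur (Polynomial.C) x l m).symm
  have hy : ∀ l m, skewSchur y' l m =
      Polynomial.X ^ (l.card - m.card) * Polynomial.C (skewSchur y l m) := fun l m => by
    rw [map_skewSchur (Polynomial.C) y l m]
    exact skewSchur_scale _ _ l m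
  have h1 : ∑ κ ∈ below c, skewSchur x' c κ * skewSchur y' κ τ =
      ∑ κ ∈ below c, skewSchur y' c κ * skewSchur x' κ τ := by
    rw [← skewSchur_add, ← skewSchur_add]
    simp only [add_comm]
  -- The functional X^d ↦ w d turns the degree in y into the weight.
  have h2 := congrArg (Polynomial.lsum (fun d => LinearMap.mulLeft A (w d))) h1
  simp only [map_sum, hx, hy] at h2
  refine Eq.trans (Finset.sum_congr rfl fun κ _ => ?_)
    (h2.trans (Finset.sum_congr rfl fun κ _ => ?_))
  · rw [show Polynomial.C (skewSchur x c κ) * (Polynomial.X ^ (κ.card - τ.card) *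
        Polynomial.C (skewSchur y κ τ)) = Polynomial.monomial (κ.card - τ.card)
        (skewSchur x c κ * skewSchur y κ τ) by
      rw [← Polynomial.C_mul_X_pow_eq_monomial, Polynomial.C_mul]; ring]
    simp [Polynomial.lsum_apply]
  · rw [show Polynomial.X ^ (c.card - κ.card) * Polynomial.C (skewSchur y c κ) *
        Polynomial.C (skewSchur x κ τ) = Polynomial.monomial (c.card - κ.card)
        (skewSchur y c κ * skewSchur x κ τ) by
      rw [← Polynomial.C_mul_X_pow_eq_monomial, Polynomial.C_mul]; ring]
    simp [Polynomial.lsum_apply]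

end Scaling

/-! ### Alphabets with a single letter -/

/-- `l / m` is a horizontal strip. -/
def HorizontalStrip (l m : YoungDiagram) : Prop :=
  m ≤ l ∧ ∀ i, l.rowLen (i + 1) ≤ m.rowLen i

/-- `l / m` is a vertical strip. -/
def VerticalStrip (l m : YoungDiagram) : Prop :=
  m ≤ l ∧ ∀ i, l.rowLen i ≤ m.rowLen i + 1

theorem horizontalStrip_transpose_iff (l m : YoungDiagram) :
    HorizontalStrip l.transpose m.transpose ↔ VerticalStrip l m := by
  rw [HorizontalStrip, VerticalStrip, YoungDiagram.transpose_le_iff]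
  refine and_congr_right fun _ => ?_
  simp only [YoungDiagram.rowLen_transpose]
  constructor
  · intro h i
    by_contra hlt
    have h1 : (i, m.rowLen i + 1) ∈ l := YoungDiagram.mem_iff_lt_rowLen.2 (by omega)
    have h2 := (YoungDiagram.mem_iff_lt_colLen.1 h1).trans_le (h (m.rowLen i))
    have h3 := YoungDiagram.mem_iff_lt_rowLen.1 (YoungDiagram.mem_iff_lt_colLen.2 h2)
    omega
  · intro h j
    by_contra hlt
    have h1 : (m.colLen j, j + 1) ∈ l := YoungDiagram.mem_iff_lt_colLen.2 (by omega)
    have h2 := (YoungDiagram.mem_iff_lt_rowLen.1 h1).trans_le (h (m.colLen j))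
    have h3 := YoungDiagram.mem_iff_lt_colLen.1 (YoungDiagram.mem_iff_lt_rowLen.2
      (show j < m.rowLen (m.colLen j) by omega))
    omega

section SingleLetter

variable {A : Type*} [CommRing A] [Algebra ℚ A]

open scoped Classical in
-- All h_n with n ≥ 0 equal 1, so the matrix has entries 0 and 1: unitriangular for a horizontal
-- strip, with two equal rows otherwise.
theorem skewSchur_one (l m : YoungDiagram) :
    skewSchur (fun _ => (1 : A)) l m = if HorizontalStrip l m then 1 else 0 := by
  by_cases hle : m ≤ l
  swap
  · rw [skewSchur_of_not_le _ hle, if_neg (fun h => hle h.1)]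
  have hH : ∀ z : ℤ, completeHInt (fun _ => (1 : A)) z = if 0 ≤ z then 1 else 0 := by
    intro z
    rw [completeHInt]
    split_ifs
    · simpa using completeH_pow (1 : A) z.toNat
    · rfl
  rw [skewSchur_eq_det _ le_rfl (colLen_mono hle 0)]
  set n := l.colLen 0 with hn
  have hle' := le_iff_rowLen.1 hle
  split_ifs with hs
  · rw [Matrix.det_of_isUpperTriangular]
    · refine Finset.prod_eq_one fun i _ => ?_
      rw [Matrix.of_apply, hH, if_pos]
      have := hle' i
      simp only [beta]; omega
    · intro i j hij
      have hij' : (j : ℕ) < i := hij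
      rw [Matrix.of_apply, hH, if_neg]
      have h1 := hs.2 j
      have h2 := l.rowLen_anti (j + 1) i hij'
      have := i.2
      simp only [beta]; omega
  · have hex : ∃ i, m.rowLen i < l.rowLen (i + 1) := by
      by_contra h
      push Not at h
      exact hs ⟨hle, h⟩
    classical
    -- By minimality of r, rows r and r + 1 both vanish in the columns before r; from column r on,
    -- both consist of ones.
    set r := Nat.find hex with hr
    have hr1 : m.rowLen r < l.rowLen (r + 1) := Nat.find_spec hex
    have hr2 : ∀ j < r, l.rowLen (j + 1) ≤ m.rowLen j := fun j hj =>
      not_lt.1 (Nat.find_min hex hj)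
    have hrn : r + 1 < n := by
      by_contra h
      rw [rowLen_eq_zero (μ := l) (by omega)] at hr1
      omega
    refine Matrix.det_zero_of_row_eq (i := ⟨r, by omega⟩) (j := ⟨r + 1, hrn⟩)
      (by simp [Fin.ext_iff]) ?_
    funext j
    simp only [Matrix.of_apply, hH, beta]
    have h0 := l.rowLen_anti r (r + 1) (by omega)
    rcases lt_or_ge (j : ℕ) r with hj | hj
    · have h1 := hr2 j hj
      have h2 := l.rowLen_anti (j + 1) r hj
      rw [if_neg (by omega), if_neg (by omega)]
    · have h1 := m.rowLen_anti r j hj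
      rw [if_pos (by omega), if_pos (by omega)]

open scoped Classical in
theorem skewSchur_single (x : A) (l m : YoungDiagram) :
    skewSchur (fun k => x ^ k) l m = if HorizontalStrip l m then x ^ (l.card - m.card) else 0 := by
  have := skewSchur_scale x (fun _ => (1 : A)) l m
  simpa [skewSchur_one] using this

/-- This alphabet is the conjugate of the single letter 1: its generating function is 1 + u in place
of 1/(1 - u). -/
theorem completeH_sign (n : ℕ) :
    completeH (fun k => (-1 : A) ^ (k + 1)) n = if n ≤ 1 then 1 else 0 := by
  have h : PowerSeries.mk (completeH (fun k => (-1 : A) ^ (k + 1))) = 1 + PowerSeries.X := by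
    apply mk_completeH_unique
    · simp
    · have h1 : PowerSeries.derivative A (1 + PowerSeries.X : PowerSeries A) = 1 := by
        ext n
        rw [PowerSeries.coeff_derivative, map_add, PowerSeries.coeff_one, PowerSeries.coeff_X,
          PowerSeries.coeff_one]
        cases n <;> simp
      rw [h1]
      ext n
      rw [mul_add, mul_one, map_add, PowerSeries.coeff_mk]
      cases n with
      | zero => simp
      | succ n =>
        rw [PowerSeries.coeff_succ_mul_X, PowerSeries.coeff_mk, PowerSeries.coeff_one,
          if_neg (by omega)]
        ring
  have h2 := congrArg (PowerSeries.coeff n) h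
  rw [PowerSeries.coeff_mk, map_add, PowerSeries.coeff_one, PowerSeries.coeff_X] at h2
  rw [h2]
  rcases n with _ | _ | n <;> simp

open scoped Classical in
-- An entry is 1 exactly when its index is 0 or 1, and only the identity permutation can meet such
-- entries alone.
theorem skewSchur_sign (l m : YoungDiagram) :
    skewSchur (fun k => (-1 : A) ^ (k + 1)) l m = if VerticalStrip l m then 1 else 0 := by
  by_cases hle : m ≤ l
  swap
  · rw [skewSchur_of_not_le _ hle, if_neg (fun h => hle h.1)]
  have hH : ∀ z : ℤ, completeHInt (fun k => (-1 : A) ^ (k + 1)) z =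
      if 0 ≤ z ∧ z ≤ 1 then 1 else 0 := by
    intro z
    rw [completeHInt]
    by_cases hz : 0 ≤ z
    · rw [if_pos hz, completeH_sign]
      congr 1
      simp only [eq_iff_iff]
      omega
    · rw [if_neg hz, if_neg (by omega)]
  rw [skewSchur_eq_det _ le_rfl (colLen_mono hle 0)]
  set n := l.colLen 0 with hn
  have hle' := le_iff_rowLen.1 hle
  rw [Matrix.det_apply, Finset.sum_eq_single 1]
  · simp only [Equiv.Perm.sign_one, one_smul, Equiv.Perm.one_apply, Matrix.of_apply, hH]
    split_ifs with hv
    · refine Finset.prod_eq_one fun i _ => ?_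
      rw [if_pos]
      have := hle' i
      have := hv.2 i
      simp only [beta]; omega
    · have hex : ∃ i, m.rowLen i + 1 < l.rowLen i := by
        by_contra h
        push Not at h
        exact hv ⟨hle, h⟩
      obtain ⟨i, hi⟩ := hex
      have hin : i < n := by
        by_contra h
        rw [rowLen_eq_zero (μ := l) (by omega)] at hi
        omega
      refine Finset.prod_eq_zero (Finset.mem_univ ⟨i, hin⟩) ?_
      rw [if_neg]
      simp only [beta]; omega
  · intro σ _ hσ
    by_cases hz : ∃ i, ¬ (0 ≤ (beta n l (σ i) : ℤ) - (beta n m i : ℤ) ∧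
        (beta n l (σ i) : ℤ) - (beta n m i : ℤ) ≤ 1)
    · obtain ⟨i, hi⟩ := hz
      have h2 : ∏ i, (Matrix.of fun i j : Fin n => completeHInt (fun k => (-1 : A) ^ (k + 1))
          ((beta n l i : ℤ) - (beta n m j : ℤ))) (σ i) i = 0 := by
        refine Finset.prod_eq_zero (Finset.mem_univ i) ?_
        rw [Matrix.of_apply, hH, if_neg hi]
      rw [h2, smul_zero]
    · push Not at hz
      exfalso
      apply hσ
      -- An inversion of σ would need two strict drops of β, while all differences β(l) - β(m) lie
      -- in {0, 1}.
      have hmono : StrictMono σ := by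
        intro i j hij
        by_contra hlt
        have h1 : σ j < σ i := lt_of_le_of_ne (not_lt.1 hlt)
          (fun h => hij.ne' (σ.injective h))
        have h2 := beta_strictAnti n l h1
        have h3 := beta_strictAnti n m hij
        have := hz i
        have := hz j
        omega
      have h4 := (hmono.range_inj strictMono_id).1 (by rw [σ.surjective.range_eq]; simp)
      ext i
      simp [h4]
  · simp

end SingleLetter

end TopVertex

namespace TopVertex

/-! ### Reduction to finitely many letters -/

/-- The power sums of a finite list of letters. -/
def listAlphabet {A : Type*} [CommRing A] (xs : List A) (k : ℕ) : A :=
  (xs.map (· ^ k)).sum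

theorem listAlphabet_nil {A : Type*} [CommRing A] :
    listAlphabet ([] : List A) = fun _ => 0 := by
  funext k; simp [listAlphabet]

theorem listAlphabet_cons {A : Type*} [CommRing A] (x : A) (xs : List A) :
    listAlphabet (x :: xs) = fun k => x ^ k + listAlphabet xs k := by
  funext k; simp [listAlphabet]

section Truncation

variable {A : Type*} [CommRing A] [Algebra ℚ A]

theorem completeH_congr_le {p p' : ℕ → A} {N : ℕ} (h : ∀ k, 1 ≤ k → k ≤ N → p k = p' k) (n : ℕ)
    (hn : n ≤ N) : completeH p n = completeH p' n := by
  induction n using Nat.strong_induction_on with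
  | _ n ih =>
    cases n with
    | zero => rw [completeH_zero, completeH_zero]
    | succ n =>
      rw [completeH, completeH]
      congr 1
      refine Finset.sum_congr rfl fun k _ => ?_
      have := k.2
      rw [ih (n - k) (by omega) (by omega), h (k + 1) (by omega) (by omega)]

/-- Newton's identities can be solved for p_k, because its coefficient is h_0 = 1. -/
theorem powerSum_eq_of_completeH_eq {p p' : ℕ → A} {N : ℕ}
    (h : ∀ n ≤ N, completeH p n = completeH p' n) (k : ℕ) (hk : 1 ≤ k) (hN : k ≤ N) :
    p k = p' k := by
  induction k using Nat.strong_induction_on with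
  | _ k ih =>
    obtain ⟨n, rfl⟩ : ∃ n, k = n + 1 := ⟨k - 1, by omega⟩
    have h1 := h (n + 1) hN
    rw [completeH, completeH] at h1
    have h2 : ∑ k : Fin (n + 1), p (k + 1) * completeH p (n - k) =
        ∑ k : Fin (n + 1), p' (k + 1) * completeH p' (n - k) := by
      have h3 : (n : ℚ) + 1 ≠ 0 := by positivity
      have h4 := congrArg (fun a => ((n : ℚ) + 1) • a) h1
      simpa only [smul_smul, mul_inv_cancel₀ h3, one_smul] using h4
    rw [Fin.sum_univ_castSucc, Fin.sum_univ_castSucc] at h2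
    simp only [Fin.val_castSucc, Fin.val_last, Nat.sub_self, completeH_zero, mul_one] at h2
    rw [Finset.sum_congr rfl (fun (k : Fin n) _ => by
      have := k.2
      rw [ih (k + 1) (by omega) (by omega) (by omega), h (n - k) (by omega)])] at h2
    exact add_left_cancel h2

theorem mk_completeH_listAlphabet_mul (xs : List A) :
    PowerSeries.mk (completeH (listAlphabet xs)) *
      (xs.map (fun x => 1 - PowerSeries.C x * PowerSeries.X)).prod = 1 := by
  induction xs with
  | nil =>
    rw [listAlphabet_nil]
    ext n
    simp [completeH_zero_alphabet, PowerSeries.coeff_one]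
  | cons x xs ih =>
    rw [listAlphabet_cons, mk_completeH_add, List.map_cons, List.prod_cons]
    have h : PowerSeries.mk (completeH fun k => x ^ k) *
        (1 - PowerSeries.C x * PowerSeries.X) = 1 := by
      ext n
      rw [mul_sub, mul_one, map_sub, mul_left_comm, PowerSeries.coeff_C_mul, PowerSeries.coeff_mk,
        completeH_pow, PowerSeries.coeff_one]
      cases n with
      | zero => simp
      | succ n =>
        rw [PowerSeries.coeff_succ_mul_X, PowerSeries.coeff_mk, completeH_pow, pow_succ']
        simp
    linear_combination (PowerSeries.mk (completeH fun k => x ^ k) *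
        (1 - PowerSeries.C x * PowerSeries.X)) * ih + h

end Truncation

section Density

variable {F : Type*} [Field F]

/-- The letters are the reciprocals of the roots, which are nonzero as the constant coefficient is
1. -/
theorem exists_prod_one_sub [IsAlgClosed F] (P : Polynomial F) (h : P.coeff 0 = 1) :
    ∃ xs : List F, P = (xs.map (fun x => 1 - Polynomial.C x * Polynomial.X)).prod := by
  have hP := (IsAlgClosed.splits P).eq_prod_roots
  have hne : P ≠ 0 := by rintro rfl; simp at h
  have h0 : ∀ r ∈ P.roots, r ≠ 0 := by
    rintro r hr rfl
    have := (Polynomial.mem_roots hne).1 hr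
    rw [Polynomial.IsRoot.def, ← Polynomial.coeff_zero_eq_eval_zero, h] at this
    exact one_ne_zero this
  obtain ⟨rs, hrs⟩ := Quot.exists_rep P.roots
  have hrs' : P.roots = (rs : Multiset F) := hrs.symm
  have h0' : ∀ r ∈ rs, r ≠ 0 := fun r hr => h0 r (by rw [hrs']; simpa using hr)
  have key : ∀ rs : List F, (∀ r ∈ rs, r ≠ 0) →
      (rs.map (fun r => Polynomial.X - Polynomial.C r)).prod =
      Polynomial.C (rs.map (fun r => -r)).prod *
        ((rs.map (fun r => r⁻¹)).map (fun x => 1 - Polynomial.C x * Polynomial.X)).prod := by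
    intro rs hrs
    induction rs with
    | nil => simp
    | cons r rs ih =>
      have hr : r ≠ 0 := hrs r (by simp)
      simp only [List.map_cons, List.prod_cons, Polynomial.C_mul] at ih ⊢
      rw [ih (fun r' hr' => hrs r' (by simp [hr']))]
      have h1 : (Polynomial.X - Polynomial.C r : Polynomial F) =
          Polynomial.C (-r) * (1 - Polynomial.C r⁻¹ * Polynomial.X) := by
        rw [mul_sub, ← mul_assoc, ← Polynomial.C_mul, neg_mul, mul_inv_cancel₀ hr]
        simp
        ring
      rw [h1]; ring
  refine ⟨rs.map (fun r => r⁻¹), ?_⟩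
  rw [hrs', Multiset.map_coe, Multiset.prod_coe, key rs h0', ← mul_assoc, ← Polynomial.C_mul] at hP
  set Q := ((rs.map (fun r => r⁻¹)).map (fun x => 1 - Polynomial.C x * Polynomial.X)).prod with hQ
  have hQ0 : Q.coeff 0 = 1 := by
    rw [Polynomial.coeff_zero_eq_eval_zero, hQ, ← Polynomial.coe_evalRingHom, map_list_prod]
    refine List.prod_eq_one ?_
    simp
  have h2 := h
  rw [hP, Polynomial.coeff_C_mul, hQ0, mul_one] at h2
  rw [hP, h2]; simp

/-- Over an algebraically closed field the first power sums of any alphabet are those of finitely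
many letters. -/
theorem exists_listAlphabet [IsAlgClosed F] [Algebra ℚ F] (p : ℕ → F) (N : ℕ) :
    ∃ xs : List F, ∀ k, 1 ≤ k → k ≤ N → p k = listAlphabet xs k := by
  set H := PowerSeries.mk (completeH p) with hH
  have hH0 : PowerSeries.constantCoeff H ≠ 0 := by
    rw [← PowerSeries.coeff_zero_eq_constantCoeff_apply, hH, PowerSeries.coeff_mk, completeH_zero]
    exact one_ne_zero
  -- If the truncation P of 1/H factors as ∏ (1 - x u), the letters x have generating function 1/P,
  -- which agrees with H through degree N.
  set P := PowerSeries.trunc (N + 1) H⁻¹ with hP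
  have hP0 : P.coeff 0 = 1 := by
    rw [hP, PowerSeries.coeff_trunc, if_pos (by omega), PowerSeries.coeff_zero_eq_constantCoeff,
      PowerSeries.constantCoeff_inv, ← PowerSeries.coeff_zero_eq_constantCoeff_apply, hH,
      PowerSeries.coeff_mk, completeH_zero, inv_one]
  obtain ⟨xs, hxs⟩ := exists_prod_one_sub P hP0
  refine ⟨xs, powerSum_eq_of_completeH_eq fun n hn => ?_⟩
  have h1 := mk_completeH_listAlphabet_mul xs
  have h2 : (xs.map (fun x => 1 - PowerSeries.C x * PowerSeries.X)).prod = (P : PowerSeries F) := by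
    rw [hxs]
    clear h1 hxs
    induction xs with
    | nil => simp
    | cons x xs ih => simp [ih]
  rw [h2] at h1
  set G := PowerSeries.mk (completeH (listAlphabet xs)) with hG
  have h3 : G = G * H⁻¹ * H := by rw [mul_assoc, PowerSeries.inv_mul_cancel _ hH0, mul_one]
  have h4 : ∃ R : PowerSeries F, H⁻¹ = (P : PowerSeries F) + PowerSeries.X ^ (N + 1) * R := by
    have : PowerSeries.X ^ (N + 1) ∣ H⁻¹ - (P : PowerSeries F) := by
      rw [PowerSeries.X_pow_dvd_iff]
      intro m hm
      rw [map_sub, hP, Polynomial.coeff_coe, PowerSeries.coeff_trunc, if_pos hm, sub_self]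
    obtain ⟨R, hR⟩ := this
    exact ⟨R, by rw [← hR]; ring⟩
  obtain ⟨R, hR⟩ := h4
  have h5 : G = H + PowerSeries.X ^ (N + 1) * (G * R * H) := by
    conv_lhs => rw [h3, hR]
    linear_combination H * h1
  have h6 := congrArg (PowerSeries.coeff n) h5
  rw [map_add, PowerSeries.coeff_X_pow_mul', if_neg (by omega), add_zero, hG, hH,
    PowerSeries.coeff_mk, PowerSeries.coeff_mk] at h6
  exact h6.symm

end Density

/-! ### Conjugation -/

section Conjugation

theorem sum_below_transpose {M : Type*} [AddCommMonoid M] (l : YoungDiagram)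
    (f : YoungDiagram → M) : ∑ ν ∈ below l.transpose, f ν = ∑ ν ∈ below l, f ν.transpose := by
  refine Finset.sum_bij' (fun ν _ => ν.transpose) (fun ν _ => ν.transpose) ?_ ?_ ?_ ?_ ?_
  · intro ν hν
    rw [mem_below] at hν ⊢
    rw [← YoungDiagram.transpose_le_iff, YoungDiagram.transpose_transpose]; exact hν
  · intro ν hν
    rw [mem_below] at hν ⊢
    exact YoungDiagram.transpose_le_iff.2 hν
  · simp
  · simp
  · simp

variable {A : Type*} [CommRing A] [Algebra ℚ A]

/-- The one-letter case of conjugation: transposing exchanges vertical and horizontal strips. -/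
theorem skewSchur_sign_scale (x : A) (l m : YoungDiagram) :
    skewSchur (fun k => (-1) ^ (k + 1) * x ^ k) l m =
      skewSchur (fun k => x ^ k) l.transpose m.transpose := by
  have h1 := skewSchur_scale x (fun k => (-1 : A) ^ (k + 1)) l m
  simp only [mul_comm (x ^ _)] at h1
  rw [h1, skewSchur_sign, skewSchur_single]
  rw [card_transpose, card_transpose]
  by_cases h : VerticalStrip l m
  · rw [if_pos h, if_pos ((horizontalStrip_transpose_iff l m).2 h), one_mul]
  · rw [if_neg h, if_neg (fun h' => h ((horizontalStrip_transpose_iff l m).1 h')), zero_mul]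

theorem skewSchur_transpose_list (xs : List A) (l m : YoungDiagram) :
    skewSchur (listAlphabet xs) l.transpose m.transpose =
      skewSchur (fun k => (-1) ^ (k + 1) * listAlphabet xs k) l m := by
  induction xs generalizing l m with
  | nil =>
    rw [listAlphabet_nil]
    rw [skewSchur_congr_powerSum (p := fun k => (-1) ^ (k + 1) * (fun _ => (0 : A)) k)
      (p' := fun _ => 0) (by simp)]
    rw [skewSchur_zero, skewSchur_zero]
    by_cases h : l = m
    · rw [if_pos h, if_pos (by rw [h])]
    · rw [if_neg h, if_neg (fun h' => h (YoungDiagram.transpose_eq_iff.1 h'))]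
  | cons x xs ih =>
    rw [listAlphabet_cons]
    rw [show (fun k => (-1) ^ (k + 1) * (fun k => x ^ k + listAlphabet xs k) k) =
      fun k => (-1) ^ (k + 1) * x ^ k + (-1) ^ (k + 1) * listAlphabet xs k by funext k; ring]
    rw [skewSchur_add, skewSchur_add, sum_below_transpose]
    refine Finset.sum_congr rfl fun ν _ => ?_
    rw [ih, skewSchur_sign_scale]

/-- Skew Schur functions of conjugate partitions. -/
theorem skewSchur_transpose {K : Type*} [Field K] [Algebra ℚ K] (p : ℕ → K)
    (l m : YoungDiagram) : skewSchur p l.transpose m.transpose =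
      skewSchur (fun k => (-1) ^ (k + 1) * p k) l m := by
  let f := algebraMap K (AlgebraicClosure K)
  apply f.injective
  rw [map_skewSchur, map_skewSchur]
  -- Both sides depend only on h_n with n ≤ 2|l|, so the finite list computes them.
  obtain ⟨xs, hxs⟩ := exists_listAlphabet (fun k => f (p k)) (2 * l.card)
  have h1 := skewSchur_transpose_list xs l m
  rw [skewSchur_congr (p' := listAlphabet xs), h1]
  · refine skewSchur_congr (fun n hn => (completeH_congr_le (N := 2 * l.card) ?_ n hn)) _
    intro k hk hk'
    simp only [map_mul, map_pow, map_neg, map_one]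
    rw [← hxs k hk hk']
  · intro n hn
    rw [card_transpose] at hn
    exact completeH_congr_le hxs n hn

end Conjugation

/-! ### The skew Cauchy identity -/

section Cauchy

/-- Reflecting an interlacing partition in the intervals cut out by `η` and `ξ`. -/
theorem card_add_card_of_reflect {η ξ l τ : YoungDiagram}
    (h : ∀ i, l.rowLen (i + 1) + τ.rowLen i = min (η.rowLen i) (ξ.rowLen i) +
      max (η.rowLen (i + 1)) (ξ.rowLen (i + 1))) :
    l.card + τ.card + max (η.rowLen 0) (ξ.rowLen 0) = l.rowLen 0 + η.card + ξ.card := by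
  set M := max (max (η.colLen 0) (ξ.colLen 0)) (max (l.colLen 0) (τ.colLen 0)) with hM
  rw [card_eq_sum_rowLen l (n := M + 1) (by omega), card_eq_sum_rowLen τ (n := M) (by omega),
    card_eq_sum_rowLen η (n := M) (by omega), card_eq_sum_rowLen ξ (n := M) (by omega),
    Finset.sum_range_succ']
  have h1 : ∑ i ∈ Finset.range M, l.rowLen (i + 1) + ∑ i ∈ Finset.range M, τ.rowLen i =
      ∑ i ∈ Finset.range M, min (η.rowLen i) (ξ.rowLen i) +
      ∑ i ∈ Finset.range M, max (η.rowLen (i + 1)) (ξ.rowLen (i + 1)) := by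
    rw [← Finset.sum_add_distrib, ← Finset.sum_add_distrib]
    exact Finset.sum_congr rfl fun i _ => h i
  have h2 : ∑ i ∈ Finset.range M, max (η.rowLen (i + 1)) (ξ.rowLen (i + 1)) +
      max (η.rowLen 0) (ξ.rowLen 0) = ∑ i ∈ Finset.range M, max (η.rowLen i) (ξ.rowLen i) := by
    rw [← Finset.sum_range_succ' (fun i => max (η.rowLen i) (ξ.rowLen i)), Finset.sum_range_succ,
      rowLen_eq_zero (μ := η) (by omega), rowLen_eq_zero (μ := ξ) (by omega)]
    simp
  have h3 : ∑ i ∈ Finset.range M, min (η.rowLen i) (ξ.rowLen i) +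
      ∑ i ∈ Finset.range M, max (η.rowLen i) (ξ.rowLen i) =
      ∑ i ∈ Finset.range M, η.rowLen i + ∑ i ∈ Finset.range M, ξ.rowLen i := by
    rw [← Finset.sum_add_distrib, ← Finset.sum_add_distrib]
    exact Finset.sum_congr rfl fun i _ => min_add_max _ _
  omega

/-- Interlacing confines l_{i+1} to the interval from max(η_{i+1}, ξ_{i+1}) to min(η_i, ξ_i). The
reflected point τ_i lies in the same interval, which says that τ interlaces η and ξ from below. -/
theorem exists_reflect_down {η ξ l : YoungDiagram} (h1 : HorizontalStrip l η)
    (h2 : HorizontalStrip l ξ) : ∃ τ : YoungDiagram, HorizontalStrip η τ ∧ HorizontalStrip ξ τ ∧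
      ∀ i, l.rowLen (i + 1) + τ.rowLen i = min (η.rowLen i) (ξ.rowLen i) +
        max (η.rowLen (i + 1)) (ξ.rowLen (i + 1)) := by
  have a1 := le_iff_rowLen.1 h1.1
  have a2 := le_iff_rowLen.1 h2.1
  have b1 := h1.2
  have b2 := h2.2
  let f : ℕ → ℕ := fun i => min (η.rowLen i) (ξ.rowLen i) +
        max (η.rowLen (i + 1)) (ξ.rowLen (i + 1)) - l.rowLen (i + 1)
  have hf : Antitone f := by
    refine antitone_nat_of_succ_le fun i => ?_
    have := a1 (i + 1); have := a2 (i + 1); have := a1 (i + 1 + 1); have := a2 (i + 1 + 1)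
    have := b1 i; have := b2 i; have := b1 (i + 1); have := b2 (i + 1)
    simp only [f]
    omega
  have hz : f (l.colLen 0) = 0 := by
    simp only [f]
    rw [rowLen_eq_zero (μ := l) (by omega), rowLen_eq_zero (μ := η) (i := l.colLen 0)
      (colLen_mono h1.1 0), rowLen_eq_zero (μ := η) (i := l.colLen 0 + 1)
      ((colLen_mono h1.1 0).trans (by omega)), rowLen_eq_zero (μ := ξ) (i := l.colLen 0 + 1)
      ((colLen_mono h2.1 0).trans (by omega))]
    simp
  refine ⟨ofRows f hf _ hz, ⟨le_iff_rowLen.2 fun i => ?_, fun i => ?_⟩,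
    ⟨le_iff_rowLen.2 fun i => ?_, fun i => ?_⟩, fun i => ?_⟩ <;>
  · rw [rowLen_ofRows]
    have := a1 (i + 1); have := a2 (i + 1)
    have := b1 i; have := b2 i
    simp only [f]
    omega

/-- The inverse reflection leaves the first row of l free above max(η_0, ξ_0). The excess j accounts
for the Cauchy factor. -/
theorem exists_reflect_up {η ξ τ : YoungDiagram} (h1 : HorizontalStrip η τ)
    (h2 : HorizontalStrip ξ τ) (j : ℕ) :
    ∃ l : YoungDiagram, HorizontalStrip l η ∧ HorizontalStrip l ξ ∧
      l.rowLen 0 = max (η.rowLen 0) (ξ.rowLen 0) + j ∧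
      ∀ i, l.rowLen (i + 1) + τ.rowLen i = min (η.rowLen i) (ξ.rowLen i) +
        max (η.rowLen (i + 1)) (ξ.rowLen (i + 1)) := by
  have a1 := le_iff_rowLen.1 h1.1
  have a2 := le_iff_rowLen.1 h2.1
  have b1 := h1.2
  have b2 := h2.2
  let f : ℕ → ℕ := fun i => match i with
    | 0 => max (η.rowLen 0) (ξ.rowLen 0) + j
    | i + 1 => min (η.rowLen i) (ξ.rowLen i) +
        max (η.rowLen (i + 1)) (ξ.rowLen (i + 1)) - τ.rowLen i
  have hf : Antitone f := by
    refine antitone_nat_of_succ_le fun i => ?_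
    cases i with
    | zero =>
      have := a1 0; have := a2 0; have := b1 0; have := b2 0
      simp only [f]
      omega
    | succ i =>
      have := a1 (i + 1); have := a2 (i + 1); have := a1 i; have := a2 i
      have := b1 i; have := b2 i; have := b1 (i + 1); have := b2 (i + 1)
      simp only [f]
      omega
  have hz : f (max (η.colLen 0) (ξ.colLen 0) + 1) = 0 := by
    simp only [f]
    rw [rowLen_eq_zero (μ := η) (i := max (η.colLen 0) (ξ.colLen 0)) (by omega),
      rowLen_eq_zero (μ := η) (i := max (η.colLen 0) (ξ.colLen 0) + 1) (by omega),
      rowLen_eq_zero (μ := ξ) (i := max (η.colLen 0) (ξ.colLen 0) + 1) (by omega)]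
    simp
  refine ⟨ofRows f hf (max (η.colLen 0) (ξ.colLen 0) + 1) hz, ⟨le_iff_rowLen.2 fun i => ?_, fun i => ?_⟩,
    ⟨le_iff_rowLen.2 fun i => ?_, fun i => ?_⟩, ?_, fun i => ?_⟩
  · rw [rowLen_ofRows]
    cases i with
    | zero => simp only [f]; omega
    | succ i =>
      have := a1 i; have := a2 i; have := b1 i; have := b2 i
      simp only [f]; omega
  · rw [rowLen_ofRows]
    have := a1 i; have := a2 i; have := b1 i; have := b2 i
    simp only [f]; omega
  · rw [rowLen_ofRows]
    cases i with
    | zero => simp only [f]; omega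
    | succ i =>
      have := a1 i; have := a2 i; have := b1 i; have := b2 i
      simp only [f]; omega
  · rw [rowLen_ofRows]
    have := a1 i; have := a2 i; have := b1 i; have := b2 i
    simp only [f]; omega
  · rw [rowLen_ofRows]
  · rw [rowLen_ofRows]
    have := a1 i; have := a2 i; have := b1 i; have := b2 i
    simp only [f]; omega

open scoped Classical in
-- By `card_add_card_of_reflect`, fixing |l| = n forces j = n + |τ| - |η| - |ξ|, so τ is hit exactly
-- when this number is nonnegative.
theorem card_horizontalStrip_eq (n : ℕ) (η ξ : YoungDiagram) :
    ((parts n).filter fun l => HorizontalStrip l η ∧ HorizontalStrip l ξ).card =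
      ((below η).filter fun τ => (HorizontalStrip η τ ∧ HorizontalStrip ξ τ) ∧
        η.card + ξ.card ≤ n + τ.card).card := by
  refine Finset.card_bij' (fun l _ => if h : HorizontalStrip l η ∧ HorizontalStrip l ξ then
      (exists_reflect_down h.1 h.2).choose else ⊥)
    (fun τ _ => if h : HorizontalStrip η τ ∧ HorizontalStrip ξ τ then
      (exists_reflect_up h.1 h.2 (n + τ.card - η.card - ξ.card)).choose else ⊥) ?_ ?_ ?_ ?_
  · intro l hl
    simp only [Finset.mem_filter, mem_parts] at hl
    rw [dif_pos hl.2]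
    obtain ⟨h1, h2, h3⟩ := (exists_reflect_down hl.2.1 hl.2.2).choose_spec
    have h4 := card_add_card_of_reflect h3
    have h5 := le_iff_rowLen.1 hl.2.1.1 0
    have h6 := le_iff_rowLen.1 hl.2.2.1 0
    simp only [Finset.mem_filter, mem_below]
    exact ⟨h1.1, ⟨h1, h2⟩, by omega⟩
  · intro τ hτ
    simp only [Finset.mem_filter, mem_below] at hτ
    rw [dif_pos hτ.2.1]
    obtain ⟨h1, h2, h0, h3⟩ := (exists_reflect_up hτ.2.1.1 hτ.2.1.2
      (n + τ.card - η.card - ξ.card)).choose_spec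
    have h4 := card_add_card_of_reflect h3
    simp only [Finset.mem_filter, mem_parts]
    exact ⟨by omega, h1, h2⟩
  · intro l hl
    simp only [Finset.mem_filter, mem_parts] at hl
    simp only [dif_pos hl.2]
    obtain ⟨h1, h2, h3⟩ := (exists_reflect_down hl.2.1 hl.2.2).choose_spec
    have h4 := card_add_card_of_reflect h3
    have h5 := le_iff_rowLen.1 hl.2.1.1 0
    have h6 := le_iff_rowLen.1 hl.2.2.1 0
    rw [dif_pos ⟨h1, h2⟩]
    obtain ⟨g1, g2, g0, g3⟩ := (exists_reflect_up h1 h2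
      (n + (exists_reflect_down hl.2.1 hl.2.2).choose.card - η.card - ξ.card)).choose_spec
    refine ext_rowLen fun i => ?_
    cases i with
    | zero => rw [g0]; omega
    | succ i => have := h3 i; have := g3 i; omega
  · intro τ hτ
    simp only [Finset.mem_filter, mem_below] at hτ
    simp only [dif_pos hτ.2.1]
    obtain ⟨h1, h2, h0, h3⟩ := (exists_reflect_up hτ.2.1.1 hτ.2.1.2
      (n + τ.card - η.card - ξ.card)).choose_spec
    rw [dif_pos ⟨h1, h2⟩]
    obtain ⟨g1, g2, g3⟩ := (exists_reflect_down h1 h2).choose_spec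
    refine ext_rowLen fun i => ?_
    have := h3 i; have := g3 i; omega

variable {A : Type*} [CommRing A] [Algebra ℚ A]

/-- The skew Cauchy identity in each degree, as a property of a pair of alphabets. -/
def SkewCauchy (x y : ℕ → A) : Prop := ∀ (n : ℕ) (η ξ : YoungDiagram),
  ∑ l ∈ parts n, skewSchur x l η * skewSchur y l ξ =
    ∑ τ ∈ below η, completeHInt (fun k => x k * y k)
      ((n : ℤ) - η.card - ξ.card + τ.card) * (skewSchur x ξ τ * skewSchur y η τ)

/-- Every nonzero summand on either side is u^{n-|η|} v^{n-|ξ|}, so the identity reduces to an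
equality of cardinalities. -/
theorem skewCauchy_single (u v : A) : SkewCauchy (fun k => u ^ k) (fun k => v ^ k) := by
  classical
  intro n η ξ
  have hprod : (fun k => u ^ k * v ^ k) = fun k => (u * v) ^ k := by
    funext k; rw [mul_pow]
  rw [hprod]
  have hL : ∀ l ∈ parts n, skewSchur (fun k => u ^ k) l η * skewSchur (fun k => v ^ k) l ξ =
      if HorizontalStrip l η ∧ HorizontalStrip l ξ then
        u ^ (n - η.card) * v ^ (n - ξ.card) else 0 := by
    intro l hl
    rw [mem_parts] at hl
    rw [skewSchur_single, skewSchur_single, hl]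
    split_ifs <;> simp_all
  have hR : ∀ τ ∈ below η, completeHInt (fun k => (u * v) ^ k)
      ((n : ℤ) - η.card - ξ.card + τ.card) *
        (skewSchur (fun k => u ^ k) ξ τ * skewSchur (fun k => v ^ k) η τ) =
      if (HorizontalStrip η τ ∧ HorizontalStrip ξ τ) ∧ η.card + ξ.card ≤ n + τ.card then
        u ^ (n - η.card) * v ^ (n - ξ.card) else 0 := by
    intro τ _
    rw [skewSchur_single, skewSchur_single]
    by_cases h1 : HorizontalStrip η τ
    swap
    · simp [h1]
    by_cases h2 : HorizontalStrip ξ τ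
    swap
    · simp [h2]
    rw [if_pos h1, if_pos h2]
    have c1 := card_mono h1.1
    have c2 := card_mono h2.1
    by_cases h3 : η.card + ξ.card ≤ n + τ.card
    · rw [if_pos ⟨⟨h1, h2⟩, h3⟩]
      have : (n : ℤ) - η.card - ξ.card + τ.card = ((n + τ.card - η.card - ξ.card : ℕ) : ℤ) := by
        omega
      rw [this, completeHInt_natCast, completeH_pow, mul_pow]
      have e1 : n - η.card = (n + τ.card - η.card - ξ.card) + (ξ.card - τ.card) := by omega
      have e2 : n - ξ.card = (n + τ.card - η.card - ξ.card) + (η.card - τ.card) := by omega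
      rw [e1, e2, pow_add, pow_add]
      ring
    · rw [if_neg (fun h => h3 h.2), completeHInt_of_neg _ (by omega), zero_mul]
  rw [Finset.sum_congr rfl hL, Finset.sum_congr rfl hR, ← Finset.sum_filter, ← Finset.sum_filter,
    Finset.sum_const, Finset.sum_const, card_horizontalStrip_eq]

theorem SkewCauchy.symm {x y : ℕ → A} (h : SkewCauchy x y) : SkewCauchy y x := by
  intro n η ξ
  have h1 := h n ξ η
  simp only [mul_comm (skewSchur x _ _), mul_comm (x _)] at h1
  rw [h1]
  have hs : ∀ a b : YoungDiagram, ∑ τ ∈ below a, completeHInt (fun k => y k * x k)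
      ((n : ℤ) - b.card - a.card + τ.card) * (skewSchur y b τ * skewSchur x a τ) =
    ∑ τ ∈ below (a ⊓ b), completeHInt (fun k => y k * x k)
      ((n : ℤ) - b.card - a.card + τ.card) * (skewSchur y b τ * skewSchur x a τ) := by
    intro a b
    symm
    apply Finset.sum_subset
    · intro τ hτ
      rw [mem_below] at hτ ⊢
      exact hτ.trans inf_le_left
    · intro τ h2 h3
      rw [mem_below] at h2 h3
      rw [skewSchur_of_not_le y (fun hb => h3 (le_inf h2 hb)), zero_mul, mul_zero]
  have hs' : ∀ a b : YoungDiagram, ∑ τ ∈ below b, completeHInt (fun k => y k * x k)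
      ((n : ℤ) - b.card - a.card + τ.card) * (skewSchur y b τ * skewSchur x a τ) =
    ∑ τ ∈ below (a ⊓ b), completeHInt (fun k => y k * x k)
      ((n : ℤ) - b.card - a.card + τ.card) * (skewSchur y b τ * skewSchur x a τ) := by
    intro a b
    symm
    apply Finset.sum_subset
    · intro τ hτ
      rw [mem_below] at hτ ⊢
      exact hτ.trans inf_le_right
    · intro τ h2 h3
      rw [mem_below] at h2 h3
      rw [skewSchur_of_not_le x (fun hb => h3 (le_inf hb h2)), mul_zero, mul_zero]
  have h2 := (hs' η ξ).trans (hs η ξ).symm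
  rw [h2]
  refine Finset.sum_congr rfl fun τ _ => ?_
  congr 2
  ring

theorem SkewCauchy.zero_left (y : ℕ → A) : SkewCauchy (fun _ => 0) y := by
  classical
  intro n η ξ
  simp only [zero_mul, skewSchur_zero]
  have hH : ∀ z : ℤ, completeHInt (fun _ => (0 : A)) z = if z = 0 then 1 else 0 := by
    intro z
    rw [completeHInt]
    by_cases hz : 0 ≤ z
    · rw [if_pos hz, completeH_zero_alphabet]
      congr 1
      simp only [eq_iff_iff]; omega
    · rw [if_neg hz, if_neg (by omega)]
  simp only [hH, ite_mul, one_mul, zero_mul]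
  by_cases hle : ξ ≤ η
  · rw [Finset.sum_eq_single ξ (fun τ _ h => by rw [if_neg (Ne.symm h)]; simp)
      (fun h => absurd (mem_below.2 hle) h)]
    simp only [if_true]
    by_cases hn : η.card = n
    · rw [Finset.sum_eq_single η (fun l _ h => by rw [if_neg h])
        (fun h => absurd (mem_parts.2 hn) h), if_pos rfl, if_pos (by omega)]
    · rw [if_neg (by omega)]
      refine Finset.sum_eq_zero fun l hl => ?_
      rw [if_neg]
      rintro rfl
      exact hn (mem_parts.1 hl)
  · rw [Finset.sum_eq_zero, Finset.sum_eq_zero]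
    · intro τ hτ
      rw [if_neg (c := ξ = τ)]
      · simp
      · rintro rfl
        exact hle (mem_below.1 hτ)
    · intro l _
      split_ifs with h
      · rw [h, skewSchur_of_not_le _ hle]
      · rfl

/-- After splitting x ∪ x', y is moved first past x and then past x'. The two factors h merge by
`completeHInt_add`. -/
theorem SkewCauchy.add_left {x x' y : ℕ → A} (h : SkewCauchy x y) (h' : SkewCauchy x' y) :
    SkewCauchy (fun k => x k + x' k) y := by
  classical
  intro n η ξ
  have hexp : ∀ l ∈ parts n, skewSchur (fun k => x k + x' k) l η =
      ∑ m ∈ Finset.range (n + 1), ∑ ν ∈ parts m, skewSchur x l ν * skewSchur x' ν η := by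
    intro l hl
    rw [mem_parts] at hl
    rw [skewSchur_add, ← Finset.sum_biUnion]
    · apply Finset.sum_subset
      · intro ν hν
        rw [mem_below] at hν
        rw [Finset.mem_biUnion]
        exact ⟨ν.card, Finset.mem_range.2 (by have := card_mono hν; omega), mem_parts.2 rfl⟩
      · intro ν _ hν
        rw [mem_below] at hν
        rw [skewSchur_of_not_le _ hν, zero_mul]
    · intro a _ b _ hab
      rw [Function.onFun, Finset.disjoint_left]
      intro ν h1 h2
      exact hab ((mem_parts.1 h1).symm.trans (mem_parts.1 h2))
  calc ∑ l ∈ parts n, skewSchur (fun k => x k + x' k) l η * skewSchur y l ξ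
      = ∑ m ∈ Finset.range (n + 1), ∑ ν ∈ parts m, skewSchur x' ν η *
          ∑ l ∈ parts n, skewSchur y l ξ * skewSchur x l ν := by
        rw [Finset.sum_congr rfl (fun l hl => by rw [hexp l hl, Finset.sum_mul])]
        rw [Finset.sum_comm]
        refine Finset.sum_congr rfl fun m _ => ?_
        simp only [Finset.sum_mul, Finset.mul_sum]
        rw [Finset.sum_comm]
        refine Finset.sum_congr rfl fun ν _ => Finset.sum_congr rfl fun l _ => ?_
        ring
    _ = ∑ m ∈ Finset.range (n + 1), ∑ ν ∈ parts m, skewSchur x' ν η *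
          ∑ τ ∈ below ξ, completeHInt (fun k => y k * x k)
            ((n : ℤ) - ξ.card - m + τ.card) * (skewSchur y ν τ * skewSchur x ξ τ) := by
        refine Finset.sum_congr rfl fun m _ => Finset.sum_congr rfl fun ν hν => ?_
        rw [h.symm n ξ ν, mem_parts.1 hν]
    _ = ∑ τ ∈ below ξ, skewSchur x ξ τ * ∑ m ∈ Finset.range (n + 1),
          completeHInt (fun k => y k * x k) ((n : ℤ) - ξ.card - m + τ.card) *
          ∑ ν ∈ parts m, skewSchur x' ν η * skewSchur y ν τ := by
        simp only [Finset.mul_sum]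
        symm
        rw [Finset.sum_comm]
        refine Finset.sum_congr rfl fun m _ => ?_
        rw [Finset.sum_comm]
        refine Finset.sum_congr rfl fun ν _ => Finset.sum_congr rfl fun τ _ => ?_
        ring
    _ = ∑ τ ∈ below ξ, skewSchur x ξ τ * ∑ m ∈ Finset.range (n + 1),
          completeHInt (fun k => y k * x k) ((n : ℤ) - ξ.card - m + τ.card) *
          ∑ σ ∈ below η, completeHInt (fun k => x' k * y k)
            ((m : ℤ) - η.card - τ.card + σ.card) * (skewSchur x' τ σ * skewSchur y η σ) := by
        refine Finset.sum_congr rfl fun τ _ => ?_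
        congr 1
        refine Finset.sum_congr rfl fun m _ => ?_
        rw [h' m η τ]
    _ = ∑ τ ∈ below ξ, ∑ σ ∈ below η, completeHInt (fun k => (x k + x' k) * y k)
            ((n : ℤ) - η.card - ξ.card + σ.card) *
            (skewSchur x ξ τ * skewSchur x' τ σ * skewSchur y η σ) := by
        refine Finset.sum_congr rfl fun τ hτ => ?_
        have hτξ := card_mono (mem_below.1 hτ)
        have hcomm : ∀ σ ∈ below η, completeHInt (fun k => (x k + x' k) * y k)
            ((n : ℤ) - η.card - ξ.card + σ.card) = ∑ m ∈ Finset.range (n + 1),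
            completeHInt (fun k => y k * x k) ((n : ℤ) - ξ.card - m + τ.card) *
            completeHInt (fun k => x' k * y k) ((m : ℤ) - η.card - τ.card + σ.card) := by
          intro σ hσ
          have hση := card_mono (mem_below.1 hσ)
          have := completeHInt_add (fun k => y k * x k) (fun k => x' k * y k)
            ((n : ℤ) - ξ.card + τ.card) ((η.card : ℤ) + τ.card - σ.card) (n + 1)
            (by push_cast; omega) (by omega)
          rw [show (fun k => (x k + x' k) * y k) = fun k => y k * x k + x' k * y k by
            funext k; ring]
          rw [show (n : ℤ) - η.card - ξ.card + σ.card = (n : ℤ) - ξ.card + τ.card -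
            ((η.card : ℤ) + τ.card - σ.card) by ring, this]
          refine Finset.sum_congr rfl fun m _ => ?_
          congr 2 <;> ring
        symm
        refine (Finset.sum_congr rfl fun σ hσ => by rw [hcomm σ hσ]).trans ?_
        simp only [Finset.mul_sum, Finset.sum_mul]
        symm
        rw [Finset.sum_comm]
        refine Finset.sum_congr rfl fun σ _ => Finset.sum_congr rfl fun m _ => ?_
        ring
    _ = _ := by
        rw [Finset.sum_comm]
        refine Finset.sum_congr rfl fun σ _ => ?_
        rw [skewSchur_add, Finset.sum_mul, Finset.mul_sum]

theorem skewCauchy_list (xs ys : List A) : SkewCauchy (listAlphabet xs) (listAlphabet ys) := by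
  induction xs with
  | nil => rw [listAlphabet_nil]; exact SkewCauchy.zero_left _
  | cons x xs ih =>
    rw [listAlphabet_cons]
    refine SkewCauchy.add_left ?_ ih
    clear ih
    induction ys with
    | nil => rw [listAlphabet_nil]; exact (SkewCauchy.zero_left _).symm
    | cons y ys ih =>
      rw [listAlphabet_cons]
      exact (SkewCauchy.add_left (skewCauchy_single y x) ih.symm).symm

/-- The skew Cauchy identity. -/
theorem skewCauchy {K : Type*} [Field K] [Algebra ℚ K] (x y : ℕ → K) : SkewCauchy x y := by
  intro n η ξ
  let f := algebraMap K (AlgebraicClosure K)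
  apply f.injective
  -- N bounds every index that occurs: those in the determinants for l, η and ξ, and the index of
  -- the Cauchy factor.
  set N := 2 * (n + η.card + ξ.card) with hN
  obtain ⟨xs, hxs⟩ := exists_listAlphabet (fun k => f (x k)) N
  obtain ⟨ys, hys⟩ := exists_listAlphabet (fun k => f (y k)) N
  have h1 := skewCauchy_list xs ys n η ξ
  have hx : ∀ l m : YoungDiagram, 2 * l.card ≤ N →
      f (skewSchur x l m) = skewSchur (listAlphabet xs) l m := by
    intro l m hl
    rw [map_skewSchur]
    exact skewSchur_congr (fun n hn => completeH_congr_le hxs n (hn.trans hl)) m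
  have hy : ∀ l m : YoungDiagram, 2 * l.card ≤ N →
      f (skewSchur y l m) = skewSchur (listAlphabet ys) l m := by
    intro l m hl
    rw [map_skewSchur]
    exact skewSchur_congr (fun n hn => completeH_congr_le hys n (hn.trans hl)) m
  have hxy : ∀ z : ℤ, z ≤ N → f (completeHInt (fun k => x k * y k) z) =
      completeHInt (fun k => listAlphabet xs k * listAlphabet ys k) z := by
    intro z hz
    rw [completeHInt, completeHInt]
    split_ifs
    · rw [map_completeH]
      refine completeH_congr_le (N := N) ?_ _ (by omega)
      intro k hk hk'
      rw [map_mul, ← hxs k hk hk', ← hys k hk hk']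
    · simp
  simp only [map_sum, map_mul]
  refine Eq.trans (Finset.sum_congr rfl fun l hl => ?_) (h1.trans
    (Finset.sum_congr rfl fun τ hτ => ?_))
  · rw [mem_parts] at hl
    rw [hx l η (by omega), hy l ξ (by omega)]
  · have := card_mono (mem_below.1 hτ)
    rw [hxy _ (by omega), hx ξ τ (by omega), hy η τ (by omega)]

end Cauchy

end TopVertex

namespace TopVertex

/-! ### Pieri rules for one box -/

section Pieri

open scoped Classical in
/-- The partitions obtained by adding a box. -/
noncomputable def ups (μ : YoungDiagram) : Finset YoungDiagram :=
  (parts (μ.card + 1)).filter fun ν => μ ≤ ν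

open scoped Classical in
/-- The partitions obtained by removing a box. -/
noncomputable def downs (ν : YoungDiagram) : Finset YoungDiagram :=
  (below ν).filter fun μ => ν.card = μ.card + 1

theorem mem_ups {μ ν : YoungDiagram} : ν ∈ ups μ ↔ Covers μ ν := by
  classical
  rw [ups, Finset.mem_filter, mem_parts, Covers, and_comm]

theorem mem_downs {μ ν : YoungDiagram} : μ ∈ downs ν ↔ Covers μ ν := by
  rw [downs, Finset.mem_filter, mem_below, Covers]

theorem downs_bot : downs ⊥ = ∅ := by
  rw [Finset.eq_empty_iff_forall_notMem]
  intro μ hμ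
  have := (mem_downs.1 hμ).2
  rw [card_bot] at this
  omega

theorem sum_ups_transpose {M : Type*} [AddCommMonoid M] (μ : YoungDiagram)
    (f : YoungDiagram → M) : ∑ ν ∈ ups μ.transpose, f ν = ∑ ν ∈ ups μ, f ν.transpose := by
  refine Finset.sum_bij' (fun ν _ => ν.transpose) (fun ν _ => ν.transpose) ?_ ?_ ?_ ?_ ?_
  · intro ν hν
    rw [mem_ups] at hν ⊢
    simpa using hν.transpose
  · intro ν hν
    rw [mem_ups] at hν ⊢
    exact hν.transpose
  all_goals simp

theorem sum_downs_transpose {M : Type*} [AddCommMonoid M] (μ : YoungDiagram)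
    (f : YoungDiagram → M) : ∑ ν ∈ downs μ.transpose, f ν = ∑ ν ∈ downs μ, f ν.transpose := by
  refine Finset.sum_bij' (fun ν _ => ν.transpose) (fun ν _ => ν.transpose) ?_ ?_ ?_ ?_ ?_
  · intro ν hν
    rw [mem_downs] at hν ⊢
    simpa using hν.transpose
  · intro ν hν
    rw [mem_downs] at hν ⊢
    exact hν.transpose
  all_goals simp

variable {A : Type*} [CommRing A] [Algebra ℚ A]

theorem Covers.horizontalStrip {μ ν : YoungDiagram} (h : Covers μ ν) : HorizontalStrip ν μ := by
  refine ⟨h.1, fun i => ?_⟩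
  obtain ⟨r, hr, hi⟩ := h.exists_row
  have h1 := ν.rowLen_anti i (i + 1) (by omega)
  have h2 := μ.rowLen_anti i (i + 1) (by omega)
  by_cases hir : i + 1 = r
  · have := hi i (by omega)
    omega
  · rw [hi (i + 1) hir]; exact h2

theorem skewSchur_one_of_covers {μ ν : YoungDiagram} (h : Covers μ ν) :
    skewSchur (fun _ => (1 : A)) ν μ = 1 := by
  rw [skewSchur_one, if_pos h.horizontalStrip]

/-- Removing a box is skewing by p_1, which commutes with skewing by Y: the degree-one part, in the
letter 1, of `sum_skewSchur_mul_comm`. -/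
theorem sum_downs_skewSchur (Y : ℕ → A) (c τ : YoungDiagram) :
    ∑ κ ∈ downs c, skewSchur Y κ τ = ∑ τ' ∈ ups τ, skewSchur Y c τ' := by
  classical
  have h := sum_skewSchur_mul_comm Y (fun _ => (1 : A)) (fun d => if d = 1 then 1 else 0) c τ
  have h1 : ∑ κ ∈ below c, (if c.card - κ.card = 1 then (1 : A) else 0) *
      (skewSchur (fun _ => (1 : A)) c κ * skewSchur Y κ τ) = ∑ κ ∈ downs c, skewSchur Y κ τ := by
    rw [downs, Finset.sum_filter]
    refine Finset.sum_congr rfl fun κ hκ => ?_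
    by_cases hc : c.card = κ.card + 1
    · rw [if_pos (by omega), if_pos hc, skewSchur_one_of_covers ⟨mem_below.1 hκ, hc⟩]
      ring
    · rw [if_neg (by omega), if_neg hc, zero_mul]
  have h2 : ∑ κ ∈ below c, (if κ.card - τ.card = 1 then (1 : A) else 0) *
      (skewSchur Y c κ * skewSchur (fun _ => (1 : A)) κ τ) = ∑ τ' ∈ ups τ, skewSchur Y c τ' := by
    have h3 : ∀ κ, (if κ.card - τ.card = 1 then (1 : A) else 0) *
      (skewSchur Y c κ * skewSchur (fun _ => (1 : A)) κ τ) =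
        if Covers τ κ then skewSchur Y c κ else 0 := by
      intro κ
      by_cases hc : Covers τ κ
      · rw [if_pos hc, if_pos (by have := hc.2; omega), skewSchur_one_of_covers hc]
        ring
      · rw [if_neg hc]
        by_cases hle : τ ≤ κ
        · rw [if_neg (fun h => hc ⟨hle, by omega⟩), zero_mul]
        · rw [skewSchur_of_not_le _ hle, mul_zero, mul_zero]
    rw [Finset.sum_congr rfl (fun κ _ => h3 κ), ← Finset.sum_filter]
    apply Finset.sum_subset
    · intro κ hκ
      rw [Finset.mem_filter] at hκ
      exact mem_ups.2 hκ.2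
    · intro κ hκ hn
      rw [mem_ups] at hκ
      rw [Finset.mem_filter, mem_below, not_and'] at hn
      exact skewSchur_of_not_le _ (hn hκ)
  rw [← h1, ← h2, h]

theorem completeH_one (p : ℕ → A) : completeH p 1 = p 1 := by
  rw [completeH]; simp [completeH_zero]

/-- The skew Cauchy identity with x the letter 1 in degree |a| + 1. The index of h is 1 - |μ| + |τ|,
so only τ = μ and τ one box below μ survive. -/
theorem sum_ups_skewSchur {K : Type*} [Field K] [Algebra ℚ K] (Y : ℕ → K) (a μ : YoungDiagram) :
    ∑ a' ∈ ups a, skewSchur Y a' μ =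
      Y 1 * skewSchur Y a μ + ∑ μ' ∈ downs μ, skewSchur Y a μ' := by
  classical
  have h := skewCauchy (fun _ => (1 : K)) Y (a.card + 1) a μ
  have h1 : ∑ l ∈ parts (a.card + 1), skewSchur (fun _ => (1 : K)) l a * skewSchur Y l μ =
      ∑ a' ∈ ups a, skewSchur Y a' μ := by
    rw [ups, Finset.sum_filter]
    refine Finset.sum_congr rfl fun l hl => ?_
    split_ifs with hle
    · rw [skewSchur_one_of_covers ⟨hle, mem_parts.1 hl⟩, one_mul]
    · rw [skewSchur_of_not_le _ hle, zero_mul]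
  rw [← h1, h]
  simp only [one_mul]
  have h2 : ∀ τ ∈ below a, completeHInt (fun k => Y k)
      (((a.card + 1 : ℕ) : ℤ) - a.card - μ.card + τ.card) *
      (skewSchur (fun _ => (1 : K)) μ τ * skewSchur Y a τ) =
      (if τ = μ then Y 1 * skewSchur Y a μ else 0) +
        (if Covers τ μ then skewSchur Y a τ else 0) := by
    intro τ _
    by_cases hle : τ ≤ μ
    · have hc := card_mono hle
      by_cases h3 : τ = μ
      · subst h3
        rw [if_pos rfl, if_neg (fun h => by have := h.2; omega), skewSchur_self]
        have : (((a.card + 1 : ℕ) : ℤ) - a.card - τ.card + τ.card) = ((1 : ℕ) : ℤ) := by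
          push_cast; ring
        rw [this, completeHInt_natCast, completeH_one]; ring
      · rw [if_neg h3, zero_add]
        by_cases h4 : Covers τ μ
        · rw [if_pos h4, skewSchur_one_of_covers h4]
          have := h4.2
          have : (((a.card + 1 : ℕ) : ℤ) - a.card - μ.card + τ.card) = 0 := by
            push_cast; omega
          rw [this, completeHInt_zero]; ring
        · rw [if_neg h4, completeHInt_of_neg, zero_mul]
          have h5 : τ.card ≠ μ.card := fun h => h3 (eq_of_le_of_card hle (by omega))
          have h6 : μ.card ≠ τ.card + 1 := fun h => h4 ⟨hle, h⟩
          omega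
    · rw [skewSchur_of_not_le _ hle, if_neg (fun h => hle h.le), if_neg (fun h => hle h.1)]
      ring
  rw [Finset.sum_congr rfl h2, Finset.sum_add_distrib]
  congr 1
  · rw [Finset.sum_ite_eq']
    split_ifs with hμ
    · rfl
    · rw [mem_below] at hμ
      rw [skewSchur_of_not_le _ hμ, mul_zero]
  · rw [← Finset.sum_filter]
    apply Finset.sum_subset
    · intro κ hκ
      rw [Finset.mem_filter] at hκ
      exact mem_downs.2 hκ.2
    · intro κ hκ hn
      rw [mem_downs] at hκ
      rw [Finset.mem_filter, mem_below, not_and'] at hn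
      exact skewSchur_of_not_le _ (hn hκ)

end Pieri

/-! ### The alphabets `q^{ν+ρ}` -/

section Rho

variable {K : Type*} [Field K]

/-- The power sums of the virtual alphabet `t - t⁻¹`. -/
def alpha (t : K) (k : ℕ) : K := t ^ k - (t⁻¹) ^ k

theorem alpha_inv (t : K) (k : ℕ) : alpha t⁻¹ k = -alpha t k := by
  simp [alpha]

theorem alpha_one (t : K) : alpha t 1 = t - t⁻¹ := by simp [alpha]

theorem rhoPowerSum_eq_sum (t : K) {ν : YoungDiagram} {n : ℕ} (h : ν.colLen 0 ≤ n) (k : ℕ) :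
    rhoPowerSum t ν k = ∑ i ∈ Finset.range n,
      ((t ^ (2 * (ν.rowLen i : ℤ) - 2 * (i : ℤ) - 1)) ^ k - (t ^ (-2 * (i : ℤ) - 1)) ^ k)
    + 1 / alpha t k := by
  rw [rhoPowerSum, alpha]
  congr 1
  apply Finset.sum_subset (Finset.range_mono h)
  intro i _ hi
  rw [Finset.mem_range, not_lt] at hi
  simp [rowLen_eq_zero hi]

theorem rhoPowerSum_bot (t : K) (k : ℕ) : rhoPowerSum t ⊥ k = 1 / alpha t k := by
  rw [rhoPowerSum_eq_sum t (n := 0) (by rw [colLen_bot])]; simp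

/-- A new box of content c replaces the letter q^{c-1/2} by q^{c+1/2}, and q^c is t to the
difference of the κ. -/
theorem rhoPowerSum_covers {t : K} (ht : t ≠ 0) {μ ν : YoungDiagram} (h : Covers μ ν) (k : ℕ) :
    rhoPowerSum t ν k = rhoPowerSum t μ k + (t ^ (kappa ν - kappa μ)) ^ k * alpha t k := by
  obtain ⟨r, hr, hi⟩ := h.exists_row
  rw [kappa_sub_of_covers h hr hi, rhoPowerSum_eq_sum t le_rfl, rhoPowerSum_eq_sum t (colLen_mono h.1 0)]
  have hrn : r ∈ Finset.range (ν.colLen 0) := by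
    rw [Finset.mem_range]
    by_contra hh
    have := rowLen_eq_zero (not_lt.1 hh)
    omega
  rw [← Finset.add_sum_erase _ _ hrn, ← Finset.add_sum_erase _ (fun i =>
    (t ^ (2 * (μ.rowLen i : ℤ) - 2 * (i : ℤ) - 1)) ^ k - (t ^ (-2 * (i : ℤ) - 1)) ^ k) hrn]
  have h1 : ∑ i ∈ (Finset.range (ν.colLen 0)).erase r,
      ((t ^ (2 * (ν.rowLen i : ℤ) - 2 * (i : ℤ) - 1)) ^ k - (t ^ (-2 * (i : ℤ) - 1)) ^ k) =
      ∑ i ∈ (Finset.range (ν.colLen 0)).erase r,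
      ((t ^ (2 * (μ.rowLen i : ℤ) - 2 * (i : ℤ) - 1)) ^ k - (t ^ (-2 * (i : ℤ) - 1)) ^ k) :=
    Finset.sum_congr rfl fun i hi' => by rw [hi i (Finset.ne_of_mem_erase hi')]
  rw [h1, hr, alpha]
  have e1 : t ^ (2 * ((μ.rowLen r + 1 : ℕ) : ℤ) - 2 * (r : ℤ) - 1) =
      t ^ (2 * ((μ.rowLen r : ℤ) - r)) * t := by
    rw [← zpow_add_one₀ ht]; congr 1; push_cast; ring
  have e2 : t ^ (2 * (μ.rowLen r : ℤ) - 2 * (r : ℤ) - 1) =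
      t ^ (2 * ((μ.rowLen r : ℤ) - r)) * t⁻¹ := by
    rw [← zpow_sub_one₀ ht]; congr 1; ring
  rw [e1, e2, mul_pow, mul_pow]
  ring

/-- Box by box: inverting t and transposing both invert the factor q^c, while inverting t also
changes the sign of `alpha`. -/
theorem rhoPowerSum_inv {t : K} (ht : t ≠ 0) (ν : YoungDiagram) (k : ℕ) :
    rhoPowerSum t⁻¹ ν k = -rhoPowerSum t ν.transpose k := by
  induction ν using covers_induction with
  | h0 => rw [transpose_bot, rhoPowerSum_bot, rhoPowerSum_bot, alpha_inv, div_neg]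
  | h μ ν h ih =>
    rw [rhoPowerSum_covers (inv_ne_zero ht) h, rhoPowerSum_covers ht h.transpose, ih, alpha_inv,
      kappa_transpose, kappa_transpose, inv_zpow']
    rw [show -kappa ν - -kappa μ = -(kappa ν - kappa μ) by ring]
    ring

/-- The normalized first power sum `(t - t⁻¹) p_1(q^{ν+ρ})`. -/
noncomputable def eigen (t : K) (ν : YoungDiagram) : K := (t - t⁻¹) * rhoPowerSum t ν 1

theorem eigen_bot {t : K} (ht : t - t⁻¹ ≠ 0) : eigen t ⊥ = 1 := by
  rw [eigen, rhoPowerSum_bot, alpha_one, mul_one_div_cancel ht]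

theorem eigen_inv {t : K} (ht : t ≠ 0) (ν : YoungDiagram) :
    eigen t⁻¹ ν = eigen t ν.transpose := by
  rw [eigen, eigen, rhoPowerSum_inv ht, inv_inv]
  ring

/-- The generating function is (1 - t⁻¹u)/(1 - tu). -/
theorem completeH_alpha [Algebra ℚ K] (t : K) (n : ℕ) :
    completeH (alpha t) (n + 1) = t ^ n * (t - t⁻¹) := by
  have h1 := mk_completeH_add (alpha t) (fun k => (t⁻¹) ^ k)
  have h2 : (fun k => alpha t k + (t⁻¹) ^ k) = fun k => t ^ k := by
    funext k; simp [alpha]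
  rw [h2] at h1
  have h3 : PowerSeries.mk (completeH fun k => (t⁻¹) ^ k) *
        (1 - PowerSeries.C t⁻¹ * PowerSeries.X) = 1 := by
    have := mk_completeH_listAlphabet_mul [t⁻¹]
    have h4 : listAlphabet [t⁻¹] = fun k => (t⁻¹) ^ k := by funext k; simp [listAlphabet]
    simpa [h4] using this
  have h5 : PowerSeries.mk (completeH (alpha t)) = PowerSeries.mk (completeH fun k => t ^ k) *
      (1 - PowerSeries.C t⁻¹ * PowerSeries.X) := by
    rw [h1, mul_assoc, h3, mul_one]
  have h6 := congrArg (PowerSeries.coeff (n + 1)) h5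
  rw [mul_sub, mul_one, map_sub, mul_left_comm, PowerSeries.coeff_C_mul,
    PowerSeries.coeff_succ_mul_X, PowerSeries.coeff_mk, PowerSeries.coeff_mk, PowerSeries.coeff_mk,
    completeH_pow, completeH_pow] at h6
  rw [h6]; ring

end Rho

/-! ### The diagonalizing matrix -/

section VertexMatrix

variable {K : Type*} [Field K] [Algebra ℚ K]

/-- Matrix elements of the vertex operator with the alphabet `t - t⁻¹` between `ν` and `η`. -/
noncomputable def vmat (t : K) (ν η : YoungDiagram) : K :=
  ∑ κ ∈ below ν, skewSchur (alpha t) ν κ * skewSchur (alpha t) η κ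

theorem sum_below_eq_inf (p p' : ℕ → K) (a b : YoungDiagram) :
    ∑ κ ∈ below a, skewSchur p a κ * skewSchur p' b κ =
      ∑ κ ∈ below (a ⊓ b), skewSchur p a κ * skewSchur p' b κ := by
  symm
  apply Finset.sum_subset
  · intro τ hτ
    rw [mem_below] at hτ ⊢
    exact hτ.trans inf_le_left
  · intro τ h2 h3
    rw [mem_below] at h2 h3
    rw [skewSchur_of_not_le p' (fun hb => h3 (le_inf h2 hb)), mul_zero]

theorem sum_below_comm (p p' : ℕ → K) (a b : YoungDiagram) :
    ∑ κ ∈ below a, skewSchur p a κ * skewSchur p' b κ =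
      ∑ κ ∈ below b, skewSchur p' b κ * skewSchur p a κ := by
  rw [sum_below_eq_inf, sum_below_eq_inf p' p b a, inf_comm]
  exact Finset.sum_congr rfl fun _ _ => mul_comm _ _

theorem vmat_comm (t : K) (ν η : YoungDiagram) : vmat t ν η = vmat t η ν :=
  sum_below_comm _ _ _ _

/-- A scalar matrix plus a matrix of rank one, which makes all needed values of `vmat` computable.
In the induction, lowering both L and M by one peels off the term k = 0. -/
theorem sum_completeHInt_alpha {t : K} (ht : t ≠ 0) (L M N : ℕ) (hN : L < N) :
    ∑ k ∈ Finset.range N, completeHInt (alpha t) ((L : ℤ) - k) *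
      completeHInt (alpha t) ((M : ℤ) - k) =
    (if L = M then (t⁻¹) ^ 2 else 0) + (1 - (t⁻¹) ^ 2) * t ^ L * t ^ M := by
  have htt : t⁻¹ * t = 1 := inv_mul_cancel₀ ht
  induction L generalizing M N with
  | zero =>
    rw [Finset.sum_eq_single 0]
    · simp only [Nat.cast_zero, sub_zero, completeHInt_zero, one_mul, pow_zero, mul_one]
      cases M with
      | zero => rw [if_pos rfl, Nat.cast_zero, completeHInt_zero]; ring
      | succ M =>
        rw [if_neg (by omega), completeHInt_natCast, completeH_alpha, pow_succ]
        linear_combination (t ^ M * t⁻¹) * htt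
    · intro k _ hk
      rw [completeHInt_of_neg _ (by omega), zero_mul]
    · intro h
      exact absurd (Finset.mem_range.2 hN) h
  | succ L ih =>
    obtain ⟨N, rfl⟩ : ∃ N', N = N' + 1 := ⟨N - 1, by omega⟩
    rw [Finset.sum_range_succ']
    simp only [Nat.cast_zero, sub_zero]
    cases M with
    | zero =>
      rw [Finset.sum_eq_zero, Nat.cast_zero, completeHInt_zero, completeHInt_natCast,
        completeH_alpha, if_neg (by omega), pow_succ]
      · linear_combination (t ^ L * t⁻¹) * htt
      · intro k _
        rw [completeHInt_of_neg _ (n := ((0 : ℕ) : ℤ) - ((k + 1 : ℕ) : ℤ)) (by push_cast; omega),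
          mul_zero]
    | succ M =>
      have h1 := ih M N (by omega)
      have e1 : ∀ k : ℕ, ((L + 1 : ℕ) : ℤ) - ((k + 1 : ℕ) : ℤ) = (L : ℤ) - k := by
        intro k; push_cast; ring
      have e2 : ∀ k : ℕ, ((M + 1 : ℕ) : ℤ) - ((k + 1 : ℕ) : ℤ) = (M : ℤ) - k := by
        intro k; push_cast; ring
      simp only [e1, e2]
      rw [h1, completeHInt_natCast, completeHInt_natCast, completeH_alpha, completeH_alpha]
      have e3 : (L + 1 = M + 1) = (L = M) := by simp
      simp only [e3]
      rw [pow_succ t L, pow_succ t M]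
      linear_combination (t ^ L * t ^ M) * (t⁻¹ * t - 1) * htt

theorem vmat_eq_det {t : K} (ht : t ≠ 0) {ν η : YoungDiagram} {n : ℕ} (hν : ν.colLen 0 ≤ n)
    (hη : η.colLen 0 ≤ n) : vmat t ν η = Matrix.det (Matrix.of fun i j : Fin n =>
      (if beta n ν i = beta n η j then (t⁻¹) ^ 2 else 0) +
        (1 - (t⁻¹) ^ 2) * t ^ beta n ν i * t ^ beta n η j) := by
  obtain ⟨N, hN⟩ : ∃ N, ∀ i, beta n ν i < N := by
    refine ⟨ν.rowLen 0 + n, fun i => ?_⟩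
    have := ν.rowLen_anti 0 i (Nat.zero_le _)
    have := i.2
    simp only [beta]; omega
  rw [vmat, sum_skewSchur_mul_skewSchur_inner _ _ _ _ n N hν hη hN]
  congr 2
  ext i j
  exact sum_completeHInt_alpha ht _ _ _ (hN i)

/-- The rank-one determinant formula gives q^{-n}(1 + (q - 1) ∑ q^{β_i}). This is the normalized
power sum, because the letters of the empty partition telescope to 1 - q^{-n}. -/
theorem vmat_self {t : K} (ht : t ≠ 0) (ht1 : t - t⁻¹ ≠ 0) (ν : YoungDiagram) :
    vmat t ν ν = eigen t ν := by
  set n := ν.colLen 0 with hn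
  have htt : t⁻¹ * t = 1 := inv_mul_cancel₀ ht
  rw [vmat_eq_det ht (n := n) le_rfl le_rfl]
  have h1 : (Matrix.of fun i j : Fin n =>
      (if beta n ν i = beta n ν j then (t⁻¹) ^ 2 else 0) +
        (1 - (t⁻¹) ^ 2) * t ^ beta n ν i * t ^ beta n ν j) =
      (t⁻¹) ^ 2 • (1 + Matrix.replicateCol Unit (fun i => (t ^ 2 - 1) * t ^ beta n ν i) *
        Matrix.replicateRow Unit (fun i => t ^ beta n ν i)) := by
    ext i j
    simp only [Matrix.of_apply, (beta_injective n ν).eq_iff, Matrix.smul_apply, Matrix.add_apply,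
      Matrix.one_apply, Matrix.mul_apply, Matrix.replicateCol_apply, Matrix.replicateRow_apply,
      Finset.univ_unique, Finset.sum_singleton, smul_eq_mul]
    have : (1 - (t⁻¹) ^ 2) = (t⁻¹) ^ 2 * (t ^ 2 - 1) := by
      linear_combination (- t⁻¹ * t - 1) * htt
    rw [this]
    split_ifs <;> ring
  rw [h1, Matrix.det_smul, Matrix.det_one_add_replicateCol_mul_replicateRow, Fintype.card_fin]
  rw [eigen, rhoPowerSum_eq_sum t (n := n) le_rfl, alpha_one, mul_add (t - t⁻¹),
    mul_one_div_cancel ht1]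
  simp only [pow_one, dotProduct]
  have h2 : ∀ m : ℕ, (t - t⁻¹) * ∑ i ∈ Finset.range m, t ^ (-2 * (i : ℤ) - 1) =
      1 - ((t⁻¹) ^ 2) ^ m := by
    intro m
    induction m with
    | zero => simp
    | succ m ih =>
      rw [Finset.sum_range_succ, mul_add, ih]
      have : t ^ (-2 * (m : ℤ) - 1) = ((t⁻¹) ^ 2) ^ m * t⁻¹ := by
        rw [← pow_mul, zpow_sub_one₀ ht, inv_pow, ← zpow_natCast, ← zpow_neg]
        congr 2
      rw [this, pow_succ]
      linear_combination (((t⁻¹) ^ 2) ^ m) * htt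
  rw [Finset.sum_sub_distrib, mul_sub, h2, mul_add, Finset.mul_sum, Finset.mul_sum, Finset.sum_range]
  have h3 : ∀ i : Fin n, ((t⁻¹) ^ 2) ^ n * (t ^ beta n ν i * ((t ^ 2 - 1) * t ^ beta n ν i)) =
      (t - t⁻¹) * t ^ (2 * (ν.rowLen i : ℤ) - 2 * ((i : ℕ) : ℤ) - 1) := by
    intro i
    have e1 : t ^ (2 * (ν.rowLen i : ℤ) - 2 * ((i : ℕ) : ℤ) - 1) =
        ((t⁻¹) ^ 2) ^ n * (t ^ beta n ν i * (t * t ^ beta n ν i)) := by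
      rw [← pow_mul, inv_pow, ← zpow_natCast, ← zpow_natCast, ← zpow_neg, ← zpow_one_add₀ ht,
        ← zpow_add₀ ht, ← zpow_add₀ ht]
      congr 1
      have := i.2
      simp only [beta]
      push_cast
      omega
    rw [e1]
    linear_combination (((t⁻¹) ^ 2) ^ n * t ^ beta n ν i * t ^ beta n ν i) * htt
  rw [Finset.sum_congr rfl (fun i _ => h3 i)]
  ring

theorem det_eq_zero_of_smul_row {K : Type*} [Field K] {n : ℕ} (P : Matrix (Fin n) (Fin n) K) {i i' : Fin n}
    (hne : i ≠ i') (s : K) (h : ∀ j, P i' j = s * P i j) : P.det = 0 := by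
  have h1 : P = P.updateRow i' (s • P i) := by
    ext a b
    by_cases ha : a = i'
    · subst ha; simp [h]
    · rw [Matrix.updateRow_ne ha]
  rw [h1, Matrix.det_updateRow_smul, Matrix.det_updateRow_eq_zero hne, mul_zero]

/-- Two strictly decreasing sequences that differ in at most one entry and whose sums differ by at
most one. -/
theorem eq_or_le_of_at_most_one {n : ℕ} {L M : Fin n → ℕ} (hL : StrictAnti L) (hM : StrictAnti M)
    (h : ∀ i i', i ≠ i' → L i ∈ Set.range M ∨ L i' ∈ Set.range M) {d : ℕ} (hd : d ≤ 1)
    (hsum : ∑ i, M i = ∑ i, L i + d) : ∀ i, L i ≤ M i := by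
  classical
  by_cases hall : ∀ i, L i ∈ Set.range M
  · have h1 : Finset.univ.image L = Finset.univ.image M := by
      apply Finset.eq_of_subset_of_card_le
      · intro x hx
        simp only [Finset.mem_image, Finset.mem_univ, true_and] at hx ⊢
        obtain ⟨i, rfl⟩ := hx
        exact hall i
      · rw [Finset.card_image_of_injective _ hL.injective,
          Finset.card_image_of_injective _ hM.injective]
    have h2 : Set.range L = Set.range M := by
      have := congrArg (fun s : Finset ℕ => (s : Set ℕ)) h1
      simpa using this
    have h3 := (hL.range_inj hM).1 h2
    intro i; rw [h3]
  · push Not at hall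
    obtain ⟨r, hr⟩ := hall
    have hmem : ∀ i, i ≠ r → L i ∈ Set.range M := fun i hi => (h i r hi).resolve_right hr
    set S := (Finset.univ.erase r).image L with hS
    set T := Finset.univ.image M with hT
    have hST : S ⊆ T := by
      intro x hx
      simp only [hS, hT, Finset.mem_image, Finset.mem_erase, Finset.mem_univ, and_true,
        true_and] at hx ⊢
      obtain ⟨i, hi, rfl⟩ := hx
      exact hmem i hi
    have hcS : S.card = n - 1 := by
      rw [hS, Finset.card_image_of_injective _ hL.injective]; simp
    have hcT : T.card = n := by
      rw [hT, Finset.card_image_of_injective _ hM.injective]; simp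
    have hn : 0 < n := r.pos
    have hc1 : (T \ S).card = 1 := by
      rw [Finset.card_sdiff_of_subset hST]; omega
    obtain ⟨m, hm⟩ := Finset.card_eq_one.1 hc1
    have hsT : ∑ x ∈ T, x = ∑ i, M i := by
      rw [hT, Finset.sum_image (fun _ _ _ _ h => hM.injective h)]
    have hsS : ∑ x ∈ S, x + L r = ∑ i, L i := by
      rw [hS, Finset.sum_image (fun _ _ _ _ h => hL.injective h), Finset.sum_erase_add _ _
        (Finset.mem_univ r)]
    have hsd := Finset.sum_sdiff (f := fun x => x) hST
    rw [hm, Finset.sum_singleton] at hsd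
    have hmT : m ∈ T \ S := by rw [hm]; exact Finset.mem_singleton_self m
    rw [Finset.mem_sdiff] at hmT
    have hne : m ≠ L r := by
      rintro rfl
      have := hmT.1
      simp only [hT, Finset.mem_image, Finset.mem_univ, true_and] at this
      exact hr this
    -- Here m is the one value of M that replaces L r. The sums differ by d ≤ 1 and m ≠ L r, so m
    -- exceeds L r by one.
    have hml : m = L r + 1 := by omega
    have hTS : T = insert m S := by
      rw [← Finset.sdiff_union_of_subset hST, hm]; rfl
    set L' : Fin n → ℕ := Function.update L r m with hL'
    have hnotin : ∀ i, i ≠ r → L i ≠ m := by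
      intro i hi he
      apply hmT.2
      rw [← he, hS]
      exact Finset.mem_image_of_mem _ (Finset.mem_erase.2 ⟨hi, Finset.mem_univ _⟩)
    have hanti : StrictAnti L' := by
      intro i j hij
      simp only [hL', Function.update_apply]
      have h0 := hL hij
      by_cases hi : i = r
      · subst hi
        rw [if_pos rfl, if_neg hij.ne']; omega
      · rw [if_neg hi]
        by_cases hj : j = r
        · subst hj
          rw [if_pos rfl]
          have := hnotin i hi
          omega
        · rw [if_neg hj]; exact h0
    have hrange : Set.range L' = Set.range M := by
      have h1 : Finset.univ.image L' = T := by
        rw [hTS]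
        ext x
        simp only [Finset.mem_image, Finset.mem_univ, true_and, Finset.mem_insert, hS,
          Finset.mem_erase, and_true]
        constructor
        · rintro ⟨i, rfl⟩
          by_cases hi : i = r
          · left; simp [hL', hi]
          · right; exact ⟨i, hi, by simp [hL', Function.update_of_ne hi]⟩
        · rintro (rfl | ⟨i, hi, rfl⟩)
          · exact ⟨r, by simp [hL']⟩
          · exact ⟨i, by simp [hL', Function.update_of_ne hi]⟩
      have := congrArg (fun s : Finset ℕ => (s : Set ℕ)) h1
      simpa [hT] using this
    have h3 := (hanti.range_inj hM).1 hrange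
    intro i
    rw [← h3]
    simp only [hL', Function.update_apply]
    split_ifs with hi
    · subst hi; omega
    · exact le_rfl

/-- If two values of β(ν) are missing from β(η), the corresponding rows lose their diagonal part and
are proportional. If at most one is missing, the sizes force ν ≤ η. Hence degree 0 is diagonal and
degree ±1 sees only single boxes. -/
theorem vmat_eq_zero {t : K} (ht : t ≠ 0) {ν η : YoungDiagram} {d : ℕ} (hd : d ≤ 1)
    (hc : η.card = ν.card + d) (hle : ¬ ν ≤ η) : vmat t ν η = 0 := by
  set n := max (ν.colLen 0) (η.colLen 0) with hn
  have hν : ν.colLen 0 ≤ n := le_max_left _ _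
  have hη : η.colLen 0 ≤ n := le_max_right _ _
  rw [vmat_eq_det ht hν hη]
  by_cases h : ∀ i i', i ≠ i' →
      beta n ν i ∈ Set.range (beta n η) ∨ beta n ν i' ∈ Set.range (beta n η)
  · exfalso
    apply hle
    have h1 := eq_or_le_of_at_most_one (beta_strictAnti n ν) (beta_strictAnti n η) h hd
      (by rw [sum_beta hν, sum_beta hη, hc]; ring)
    rw [le_iff_rowLen]
    intro i
    by_cases hi : i < n
    · have := h1 ⟨i, hi⟩
      simp only [beta] at this
      omega
    · rw [rowLen_eq_zero (by omega)]; exact Nat.zero_le _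
  · push Not at h
    obtain ⟨i, i', hne, h1, h2⟩ := h
    refine det_eq_zero_of_smul_row _ hne (t ^ beta n ν i' * (t ^ beta n ν i)⁻¹) fun j => ?_
    simp only [Matrix.of_apply]
    rw [if_neg (fun he => h2 ⟨j, he.symm⟩), if_neg (fun he => h1 ⟨j, he.symm⟩)]
    have : t ^ beta n ν i ≠ 0 := pow_ne_zero _ ht
    field_simp
    ring

theorem vmat_of_card_eq {t : K} (ht : t ≠ 0) {ν η : YoungDiagram} (hc : η.card = ν.card)
    (hne : ν ≠ η) : vmat t ν η = 0 :=
  vmat_eq_zero ht (d := 0) (by omega) (by omega) fun h => hne (eq_of_le_of_card h (by omega))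

theorem vmat_of_covers {t : K} (ht : t ≠ 0) {ν η : YoungDiagram} (h : Covers ν η) :
    vmat t ν η = (t - t⁻¹) * t ^ (kappa η - kappa ν) := by
  obtain ⟨r, hr, hi⟩ := h.exists_row
  rw [kappa_sub_of_covers h hr hi]
  set n := η.colLen 0 with hn
  have hν : ν.colLen 0 ≤ n := colLen_mono h.1 0
  have hrn : r < n := by
    by_contra hh
    have := rowLen_eq_zero (μ := η) (i := r) (by omega)
    omega
  have hb : ∀ i : Fin n, i ≠ ⟨r, hrn⟩ → beta n η i = beta n ν i := by
    intro i hir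
    simp only [beta]
    rw [hi i (fun h => hir (Fin.ext h))]
  have hbr : beta n η ⟨r, hrn⟩ = beta n ν ⟨r, hrn⟩ + 1 := by
    simp only [beta]; omega
  rw [vmat_eq_det ht (n := n) hν le_rfl]
  set c := 1 - (t⁻¹) ^ 2 with hc
  set v : Fin n → K := fun j => c * t ^ beta n ν ⟨r, hrn⟩ * t ^ beta n η j with hv
  have hdelta : ∀ i j : Fin n, (beta n ν i = beta n η j) ↔ (i = j ∧ i ≠ ⟨r, hrn⟩) := by
    intro i j
    by_cases hir : i = ⟨r, hrn⟩
    · subst hir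
      simp only [ne_eq, not_true_eq_false, and_false, iff_false]
      intro he
      by_cases hj : j = ⟨r, hrn⟩
      · subst hj; omega
      · rw [hb j hj] at he
        exact hj (beta_injective n ν he).symm
    · rw [← hb i hir, (beta_injective n η).eq_iff]
      simp [hir]
  -- Row r has no diagonal part, so its multiples clear the rank-one part from all other rows. What
  -- remains is a scalar matrix with one row replaced.
  have h1 := Matrix.det_eq_of_forall_row_eq_smul_add_const
    (A := Matrix.of fun i j : Fin n => (if beta n ν i = beta n η j then (t⁻¹) ^ 2 else 0) +
        c * t ^ beta n ν i * t ^ beta n η j)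
    (B := ((t⁻¹) ^ 2 • (1 : Matrix (Fin n) (Fin n) K)).updateRow ⟨r, hrn⟩ v)
    (fun i => if i = ⟨r, hrn⟩ then 0 else t ^ beta n ν i * (t ^ beta n ν ⟨r, hrn⟩)⁻¹)
    ⟨r, hrn⟩ (by simp) (by
      intro i j
      have hne : t ^ beta n ν ⟨r, hrn⟩ ≠ 0 := pow_ne_zero _ ht
      simp only [Matrix.of_apply, hdelta, Matrix.updateRow_self]
      by_cases hir : i = ⟨r, hrn⟩
      · subst hir
        simp [hv]
      · rw [Matrix.updateRow_ne hir, if_neg hir]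
        simp only [hir, ne_eq, not_false_eq_true, and_true, Matrix.smul_apply, Matrix.one_apply,
          smul_eq_mul, mul_ite, mul_one, mul_zero, hv]
        congr 1
        field_simp)
  rw [h1, ← Matrix.cramer_transpose_apply, Matrix.transpose_smul, Matrix.transpose_one,
    Matrix.cramer_smul, Matrix.cramer_one]
  simp only [Fintype.card_fin, LinearMap.smul_apply, Module.End.one_apply, Pi.smul_apply,
    smul_eq_mul, hv, hbr]
  have htt : t⁻¹ * t = 1 := inv_mul_cancel₀ ht
  have e1 : t ^ (2 * ((ν.rowLen r : ℤ) - r)) =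
      ((t⁻¹) ^ 2) ^ (n - 1) * (t ^ beta n ν ⟨r, hrn⟩ * t ^ beta n ν ⟨r, hrn⟩) := by
    rw [← pow_mul, inv_pow, ← zpow_natCast, ← zpow_natCast, ← zpow_neg, ← zpow_add₀ ht,
      ← zpow_add₀ ht]
    congr 1
    simp only [beta]
    push_cast
    omega
  rw [e1, hc, pow_succ]
  linear_combination (-((t⁻¹) ^ 2) ^ (n - 1) * t ^ beta n ν ⟨r, hrn⟩ *
    t ^ beta n ν ⟨r, hrn⟩ * t⁻¹) * htt

/-- Moving a skewing past the vertex operator. -/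
theorem sum_skewSchur_mul_vmat (t : K) (Y : ℕ → K) (ν c : YoungDiagram) (m : ℕ) :
    ∑ η ∈ parts m, skewSchur Y η ν * vmat t η c =
      ∑ σ ∈ below c, completeHInt (fun k => Y k * alpha t k)
        ((m : ℤ) + σ.card - ν.card - c.card) * (vmat t ν σ * skewSchur Y c σ) := by
  have h1 : ∀ η, vmat t η c = ∑ κ ∈ below c, skewSchur (alpha t) c κ * skewSchur (alpha t) η κ :=
    fun η => vmat_comm t η c
  calc ∑ η ∈ parts m, skewSchur Y η ν * vmat t η c
      = ∑ κ ∈ below c, skewSchur (alpha t) c κ *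
          ∑ η ∈ parts m, skewSchur Y η ν * skewSchur (alpha t) η κ := by
        simp only [h1, Finset.mul_sum]
        rw [Finset.sum_comm]
        refine Finset.sum_congr rfl fun κ _ => Finset.sum_congr rfl fun η _ => ?_
        ring
    _ = ∑ κ ∈ below c, skewSchur (alpha t) c κ *
          ∑ τ ∈ below ν, completeHInt (fun k => Y k * alpha t k)
            ((m : ℤ) - ν.card - κ.card + τ.card) *
              (skewSchur Y κ τ * skewSchur (alpha t) ν τ) := by
        refine Finset.sum_congr rfl fun κ _ => ?_
        rw [skewCauchy Y (alpha t) m ν κ]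
    _ = ∑ τ ∈ below ν, skewSchur (alpha t) ν τ *
          ∑ κ ∈ below c, completeHInt (fun k => Y k * alpha t k)
            ((m : ℤ) - ν.card - ((κ.card - τ.card : ℕ) : ℤ)) *
              (skewSchur (alpha t) c κ * skewSchur Y κ τ) := by
        simp only [Finset.mul_sum]
        rw [Finset.sum_comm]
        refine Finset.sum_congr rfl fun τ _ => Finset.sum_congr rfl fun κ _ => ?_
        by_cases hle : τ ≤ κ
        · have := card_mono hle
          rw [show (m : ℤ) - ν.card - ((κ.card - τ.card : ℕ) : ℤ) =
            (m : ℤ) - ν.card - κ.card + τ.card by omega]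
          ring
        · rw [skewSchur_of_not_le Y hle]; ring
    _ = ∑ τ ∈ below ν, skewSchur (alpha t) ν τ *
          ∑ σ ∈ below c, completeHInt (fun k => Y k * alpha t k)
            ((m : ℤ) - ν.card - ((c.card - σ.card : ℕ) : ℤ)) *
              (skewSchur Y c σ * skewSchur (alpha t) σ τ) := by
        refine Finset.sum_congr rfl fun τ _ => ?_
        -- The weight depends only on the degree skewed by Y, so the two skewings may be
        -- interchanged.
        rw [sum_skewSchur_mul_comm (alpha t) Y (fun d => completeHInt (fun k => Y k * alpha t k)
            ((m : ℤ) - ν.card - (d : ℤ))) c τ]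
    _ = _ := by
        simp only [Finset.mul_sum, vmat, Finset.sum_mul]
        rw [Finset.sum_comm]
        refine Finset.sum_congr rfl fun σ hσ => Finset.sum_congr rfl fun τ _ => ?_
        have := card_mono (mem_below.1 hσ)
        rw [show (m : ℤ) - ν.card - ((c.card - σ.card : ℕ) : ℤ) =
            (m : ℤ) + σ.card - ν.card - c.card by omega]
        ring

end VertexMatrix

end TopVertex

namespace TopVertex

/-! ### Partial fractions -/

section PartialFractions

variable {K : Type*} [Field K]

/-- Lagrange interpolation: both sides have degree at most n and agree at the n + 1 points 1/z_i. -/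
theorem sum_mul_prod_erase_eq {n : ℕ} (z : Fin (n + 1) → K) (w : Fin n → K)
    (hz : Function.Injective z) (hz0 : ∀ i, z i ≠ 0) :
    ∑ r, Polynomial.C ((∏ j, (z r - w j)) / ∏ j ∈ Finset.univ.erase r, (z r - z j)) *
      ∏ j ∈ Finset.univ.erase r, (1 - Polynomial.C (z j) * Polynomial.X) =
    ∏ j, (1 - Polynomial.C (w j) * Polynomial.X) := by
  have hdeg1 : ∀ a : K, (1 - Polynomial.C a * Polynomial.X).natDegree ≤ 1 := by
    intro a
    refine (Polynomial.natDegree_sub_le _ _).trans ?_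
    rw [Polynomial.natDegree_one]
    exact max_le (by omega) ((Polynomial.natDegree_C_mul_le _ _).trans Polynomial.natDegree_X_le)
  have hprod : ∀ {ι : Type} (s : Finset ι) (f : ι → K), s.card ≤ n →
      (∏ j ∈ s, (1 - Polynomial.C (f j) * Polynomial.X)).degree < ((n + 1 : ℕ) : WithBot ℕ) := by
    intro ι s f hs
    refine lt_of_le_of_lt Polynomial.degree_le_natDegree ?_
    have h1 := Polynomial.natDegree_prod_le s (fun j => 1 - Polynomial.C (f j) * Polynomial.X)
    have h2 : ∑ j ∈ s, (1 - Polynomial.C (f j) * Polynomial.X).natDegree ≤ ∑ j ∈ s, 1 :=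
      Finset.sum_le_sum fun j _ => hdeg1 _
    rw [Finset.sum_const, smul_eq_mul, mul_one] at h2
    exact_mod_cast lt_of_le_of_lt (h1.trans (h2.trans hs)) (Nat.lt_succ_self n)
  have hinv : Set.InjOn (fun i => (z i)⁻¹) ((Finset.univ : Finset (Fin (n + 1))) : Set _) :=
    fun i _ j _ h => hz (inv_injective h)
  apply Polynomial.eq_of_degrees_lt_of_eval_index_eq Finset.univ hinv
  · rw [Finset.card_univ, Fintype.card_fin]
    refine lt_of_le_of_lt (Polynomial.degree_sum_le _ _) ?_
    rw [Finset.sup_lt_iff (by exact_mod_cast WithBot.bot_lt_coe _)]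
    intro r _
    rw [← Polynomial.smul_eq_C_mul]
    refine lt_of_le_of_lt (Polynomial.degree_smul_le _ _) (hprod _ _ ?_)
    rw [Finset.card_erase_of_mem (Finset.mem_univ _), Finset.card_univ, Fintype.card_fin]; omega
  · rw [Finset.card_univ, Fintype.card_fin]
    exact hprod _ _ (by simp)
  · intro i _
    rw [Polynomial.eval_finsetSum, Finset.sum_eq_single i]
    · rw [Polynomial.eval_mul, Polynomial.eval_C, Polynomial.eval_prod, Polynomial.eval_prod]
      simp only [Polynomial.eval_sub, Polynomial.eval_one, Polynomial.eval_mul, Polynomial.eval_C,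
        Polynomial.eval_X]
      have h1 : ∀ a : K, 1 - a * (z i)⁻¹ = (z i)⁻¹ * (z i - a) := by
        intro a
        rw [mul_sub, inv_mul_cancel₀ (hz0 i)]; ring
      simp only [h1]
      rw [Finset.prod_mul_distrib, Finset.prod_mul_distrib, Finset.prod_const, Finset.prod_const,
        Finset.card_erase_of_mem (Finset.mem_univ _), Finset.card_univ, Finset.card_univ,
        Fintype.card_fin, Fintype.card_fin, Nat.add_sub_cancel]
      have h2 : ∏ j ∈ Finset.univ.erase i, (z i - z j) ≠ 0 := by
        rw [Finset.prod_ne_zero_iff]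
        intro j hj h
        exact Finset.ne_of_mem_erase hj (hz (sub_eq_zero.1 h).symm)
      field_simp
    · intro r _ hr
      rw [Polynomial.eval_mul, Polynomial.eval_prod]
      refine mul_eq_zero_of_right _ (Finset.prod_eq_zero
        (Finset.mem_erase.2 ⟨hr.symm, Finset.mem_univ i⟩) ?_)
      simp [mul_inv_cancel₀ (hz0 i)]
    · simp

/-- The complete homogeneous functions of a difference of two finite alphabets. -/
theorem completeH_sub_eq_sum [Algebra ℚ K] {n : ℕ} (z : Fin (n + 1) → K) (w : Fin n → K)
    (hz : Function.Injective z) (hz0 : ∀ i, z i ≠ 0) (p : ℕ → K)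
    (hp : ∀ k, 1 ≤ k → p k + ∑ j, w j ^ k = ∑ j, z j ^ k) (m : ℕ) :
    completeH p m =
      ∑ r, (∏ j, (z r - w j)) / (∏ j ∈ Finset.univ.erase r, (z r - z j)) * z r ^ m := by
  have hlist : ∀ {l : ℕ} (f : Fin l → K) (k : ℕ), listAlphabet (List.ofFn f) k = ∑ j, f j ^ k := by
    intro l f k
    rw [listAlphabet, List.map_ofFn, List.sum_ofFn]; rfl
  have hlistp : ∀ {l : ℕ} (f : Fin l → K), ((List.ofFn f).map
      (fun x => 1 - PowerSeries.C x * PowerSeries.X)).prod =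
      ∏ j, (1 - PowerSeries.C (f j) * PowerSeries.X) := by
    intro l f
    rw [List.map_ofFn, List.prod_ofFn]; rfl
  have hw1 := mk_completeH_listAlphabet_mul (List.ofFn w)
  have hz1 := mk_completeH_listAlphabet_mul (List.ofFn z)
  rw [hlistp] at hw1 hz1
  have hadd := mk_completeH_add p (listAlphabet (List.ofFn w))
  have hcongr : PowerSeries.mk (completeH fun k => p k + listAlphabet (List.ofFn w) k) =
      PowerSeries.mk (completeH (listAlphabet (List.ofFn z))) := by
    ext l
    rw [PowerSeries.coeff_mk, PowerSeries.coeff_mk]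
    refine completeH_congr (fun k hk => ?_) l
    rw [hlist, hlist, hp k hk]
  rw [hcongr] at hadd
  set Hz := PowerSeries.mk (completeH (listAlphabet (List.ofFn z)))
  set Hw := PowerSeries.mk (completeH (listAlphabet (List.ofFn w)))
  set Pz := ∏ j, (1 - PowerSeries.C (z j) * PowerSeries.X)
  set Pw := ∏ j, (1 - PowerSeries.C (w j) * PowerSeries.X)
  set ρ : Fin (n + 1) → K := fun r =>
    (∏ j, (z r - w j)) / (∏ j ∈ Finset.univ.erase r, (z r - z j)) with hρ
  have h1 : PowerSeries.mk (completeH p) = Hz * Pw := by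
    rw [hadd]; linear_combination (-PowerSeries.mk (completeH p)) * hw1
  have hpoly : ∑ r, PowerSeries.C (ρ r) *
      ∏ j ∈ Finset.univ.erase r, (1 - PowerSeries.C (z j) * PowerSeries.X) = Pw := by
    have := congrArg (Polynomial.coeToPowerSeries.ringHom (R := K))
      (sum_mul_prod_erase_eq z w hz hz0)
    rw [map_sum, map_prod] at this
    simp only [map_mul, map_prod, map_sub, map_one, Polynomial.coeToPowerSeries.ringHom_apply,
      Polynomial.coe_C, Polynomial.coe_X] at this
    exact this
  have hgeom : ∀ a : K, PowerSeries.mk (fun n => a ^ n) *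
      (1 - PowerSeries.C a * PowerSeries.X) = 1 := by
    intro a
    have := mk_completeH_listAlphabet_mul [a]
    have h4 : completeH (listAlphabet [a]) = fun n => a ^ n := by
      funext n
      rw [show listAlphabet [a] = fun k => a ^ k by funext k; simp [listAlphabet], completeH_pow]
    simpa [h4] using this
  have h2 : Hz * Pw = ∑ r, PowerSeries.C (ρ r) * PowerSeries.mk (fun n => z r ^ n) := by
    rw [← hpoly, Finset.mul_sum]
    refine Finset.sum_congr rfl fun r _ => ?_
    have h3 : Pz = (1 - PowerSeries.C (z r) * PowerSeries.X) *
        ∏ j ∈ Finset.univ.erase r, (1 - PowerSeries.C (z j) * PowerSeries.X) :=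
      (Finset.mul_prod_erase _ _ (Finset.mem_univ r)).symm
    rw [h3] at hz1
    linear_combination (PowerSeries.C (ρ r) * PowerSeries.mk (fun n => z r ^ n)) * hz1 -
      (PowerSeries.C (ρ r) * Hz * ∏ j ∈ Finset.univ.erase r,
        (1 - PowerSeries.C (z j) * PowerSeries.X)) * hgeom (z r)
  have h5 := congrArg (PowerSeries.coeff m) (h1.trans h2)
  rw [PowerSeries.coeff_mk, map_sum] at h5
  rw [h5]
  refine Finset.sum_congr rfl fun r _ => ?_
  rw [PowerSeries.coeff_C_mul, PowerSeries.coeff_mk]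

/-- Only the differences that involve the index r change, and the signs cancel in each quotient. -/
theorem det_vandermonde_update {n : ℕ} (v : Fin n → K) (hv : Function.Injective v) (r : Fin n)
    (a : K) : (Matrix.vandermonde (Function.update v r a)).det =
      (Matrix.vandermonde v).det * ∏ j ∈ Finset.univ.erase r, ((a - v j) / (v r - v j)) := by
  rw [Matrix.det_vandermonde, Matrix.det_vandermonde]
  set w : Fin n → K := fun j => (a - v j) / (v r - v j) with hw
  have hterm : ∀ i, ∀ j ∈ Finset.Ioi i, Function.update v r a j - Function.update v r a i =
      (v j - v i) * ((if j = r then w i else 1) * (if i = r then w j else 1)) := by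
    intro i j hij
    have hlt := Finset.mem_Ioi.1 hij
    have hne : v j - v i ≠ 0 := fun h => hlt.ne' (hv (sub_eq_zero.1 h))
    by_cases hj : j = r
    · subst hj
      rw [Function.update_self, Function.update_of_ne hlt.ne, if_pos rfl, if_neg hlt.ne, mul_one,
        hw, mul_div_cancel₀ _ hne]
    · by_cases hi : i = r
      · subst hi
        have hne' : v i - v j ≠ 0 := fun h => hne (by rw [← neg_sub, h, neg_zero])
        rw [Function.update_self, Function.update_of_ne hj, if_pos rfl, if_neg hj, one_mul, hw]
        simp only
        field_simp
        ring
      · rw [Function.update_of_ne hj, Function.update_of_ne hi, if_neg hj, if_neg hi]; ring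
  rw [Finset.prod_congr rfl (fun i _ => Finset.prod_congr rfl (hterm i))]
  simp only [Finset.prod_mul_distrib]
  congr 1
  have h1 : ∏ i, ∏ j ∈ Finset.Ioi i, (if j = r then w i else 1) = ∏ i ∈ Finset.Iio r, w i := by
    simp only [Finset.prod_ite_eq', Finset.mem_Ioi]
    rw [← Finset.prod_filter]
    congr 1
    ext i; simp
  have h2 : ∏ i, ∏ j ∈ Finset.Ioi i, (if i = r then w j else 1) = ∏ j ∈ Finset.Ioi r, w j := by
    rw [Finset.prod_eq_single r]
    · simp
    · intro i _ hi; simp [hi]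
    · simp
  rw [h1, h2, ← Finset.prod_union]
  · refine Finset.prod_congr ?_ fun _ _ => rfl
    ext i
    simp only [Finset.mem_union, Finset.mem_Iio, Finset.mem_Ioi, Finset.mem_erase,
      Finset.mem_univ, and_true]
    exact lt_or_lt_iff_ne
  · rw [Finset.disjoint_left]
    intro i h3 h4
    exact lt_asymm (Finset.mem_Iio.1 h3) (Finset.mem_Ioi.1 h4)

end PartialFractions

/-! ### The principal specialization -/

section Principal

variable {K : Type*} [Field K]

/-- The parameter `t = q^{1/2}` is not a root of unity and separates partitions by contents. -/
structure GenericParam (t : K) : Prop where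
  ne_zero : t ≠ 0
  pow_ne_one : ∀ k : ℕ, 0 < k → t ^ k ≠ 1
  eigen_ne_one : ∀ b : YoungDiagram, b ≠ ⊥ → eigen t b ≠ 1

theorem GenericParam.zpow_ne_one {t : K} (ht : GenericParam t) {k : ℤ} (hk : k ≠ 0) :
    t ^ k ≠ 1 := by
  rcases Int.eq_nat_or_neg k with ⟨m, rfl | rfl⟩
  · rw [zpow_natCast]
    exact ht.pow_ne_one m (by omega)
  · rw [zpow_neg, zpow_natCast, ne_eq, inv_eq_one]
    exact ht.pow_ne_one m (by omega)

theorem GenericParam.zpow_injective {t : K} (ht : GenericParam t) {a b : ℤ} (h : t ^ a = t ^ b) :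
    a = b := by
  by_contra hne
  apply ht.zpow_ne_one (sub_ne_zero.2 hne)
  rw [zpow_sub₀ ht.ne_zero, h, div_self (zpow_ne_zero _ ht.ne_zero)]

theorem GenericParam.alpha_ne_zero {t : K} (ht : GenericParam t) {k : ℕ} (hk : 1 ≤ k) :
    alpha t k ≠ 0 := by
  intro h
  rw [alpha, sub_eq_zero, inv_pow, ← zpow_natCast, ← zpow_neg] at h
  have := ht.zpow_injective h
  omega

theorem GenericParam.sub_inv_ne_zero {t : K} (ht : GenericParam t) : t - t⁻¹ ≠ 0 := by
  have := ht.alpha_ne_zero le_rfl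
  rwa [alpha_one] at this

variable [Algebra ℚ K]

/-- `h_m(q^ρ) (1 - q^{-m}) = q^{-1/2} h_{m-1}(q^ρ)`. -/
theorem completeHInt_rho {t : K} (ht : GenericParam t) (m : ℤ) :
    completeHInt (rhoPowerSum t ⊥) m * (1 - t ^ (-2 * m)) =
      t⁻¹ * completeHInt (rhoPowerSum t ⊥) (m - 1) := by
  set p := rhoPowerSum t ⊥ with hp
  rcases lt_trichotomy m 0 with hm | rfl | hm
  · rw [completeHInt_of_neg _ hm, completeHInt_of_neg _ (by omega)]; ring
  · rw [completeHInt_of_neg _ (show (0 : ℤ) - 1 < 0 by omega)]; simp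
  obtain ⟨m, rfl⟩ : ∃ k : ℕ, m = ((k + 1 : ℕ) : ℤ) := ⟨(m - 1).toNat, by omega⟩
  rw [show ((m + 1 : ℕ) : ℤ) - 1 = (m : ℤ) by push_cast; ring, completeHInt_natCast,
    completeHInt_natCast]
  have h1 := mk_completeH_add (fun k => ((t⁻¹) ^ 2) ^ k * p k) (fun k => (t⁻¹) ^ k)
  -- The functional equation: the alphabet q^ρ is q⁻¹ q^ρ together with the letter q^{-1/2}.
  have h2 : PowerSeries.mk (completeH fun k => ((t⁻¹) ^ 2) ^ k * p k + (t⁻¹) ^ k) =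
      PowerSeries.mk (completeH p) := by
    ext l
    rw [PowerSeries.coeff_mk, PowerSeries.coeff_mk]
    refine completeH_congr (fun k hk => ?_) l
    have ha := ht.alpha_ne_zero hk
    rw [hp, rhoPowerSum_bot]
    rw [alpha] at ha ⊢
    have htk : (t⁻¹) ^ k * t ^ k = 1 := by
      rw [← mul_pow, inv_mul_cancel₀ ht.ne_zero, one_pow]
    rw [← pow_mul, mul_comm 2 k, pow_mul]
    generalize (t⁻¹) ^ k = x at *
    generalize t ^ k = y at *
    rw [eq_div_iff ha, add_mul, mul_assoc, one_div, inv_mul_cancel₀ ha]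
    linear_combination htk
  have h3 := mk_completeH_listAlphabet_mul [t⁻¹]
  rw [show listAlphabet [t⁻¹] = fun k => (t⁻¹) ^ k by funext k; simp [listAlphabet]] at h3
  simp only [List.map_cons, List.map_nil, List.prod_cons, List.prod_nil, mul_one] at h3
  rw [h2] at h1
  have h4 : PowerSeries.mk (completeH p) * (1 - PowerSeries.C t⁻¹ * PowerSeries.X) =
      PowerSeries.mk (completeH fun k => ((t⁻¹) ^ 2) ^ k * p k) := by
    rw [h1, mul_assoc, h3, mul_one]
  have h5 := congrArg (PowerSeries.coeff (m + 1)) h4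
  rw [mul_sub, mul_one, map_sub, mul_left_comm, PowerSeries.coeff_C_mul,
    PowerSeries.coeff_succ_mul_X, PowerSeries.coeff_mk, PowerSeries.coeff_mk,
    PowerSeries.coeff_mk, completeH_scale] at h5
  have h6 : t ^ (-2 * ((m + 1 : ℕ) : ℤ)) = ((t⁻¹) ^ 2) ^ (m + 1) := by
    rw [← pow_mul, inv_pow, ← zpow_natCast, ← zpow_neg]
    congr 1
  rw [h6]
  linear_combination h5

/-- Iterating `completeHInt_rho` makes h_{m-d} equal to h_m times a polynomial of degree at most d
in q^{-m}. The Jacobi–Trudi matrix for q^ρ is thus diagonal times Vandermonde times a constant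
matrix, up to column order. -/
theorem completeHInt_rho_sub {t : K} (ht : GenericParam t) (m : ℤ) (d : ℕ) :
    completeHInt (rhoPowerSum t ⊥) (m - d) = completeHInt (rhoPowerSum t ⊥) m *
      (∏ l ∈ Finset.range d, (Polynomial.C t - Polynomial.C (t * t ^ (2 * l)) *
        Polynomial.X)).eval (t ^ (-2 * m)) := by
  have htt : t * t⁻¹ = 1 := mul_inv_cancel₀ ht.ne_zero
  induction d with
  | zero => simp
  | succ d ih =>
    have h1 := completeHInt_rho ht (m - d)
    rw [show m - ((d + 1 : ℕ) : ℤ) = m - d - 1 by push_cast; ring, Finset.prod_range_succ,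
      Polynomial.eval_mul, ← mul_assoc, ← ih]
    simp only [Polynomial.eval_sub, Polynomial.eval_mul, Polynomial.eval_C, Polynomial.eval_X]
    have h2 : t ^ (-2 * (m - (d : ℤ))) = t ^ (2 * d) * t ^ (-2 * m) := by
      rw [← zpow_natCast, ← zpow_add₀ ht.ne_zero]; congr 1; push_cast; ring
    rw [h2] at h1
    linear_combination (-t) * h1 - completeHInt (rhoPowerSum t ⊥) (m - d - 1) * htt

/-- The constant c depends only on n, not on b; it collects the sign of the column reversal and the
coefficient determinant. Only comparisons of two partitions with the same n are used, so its value
is irrelevant. -/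
theorem exists_schur_rho_eq {t : K} (ht : GenericParam t) (n : ℕ) :
    ∃ c : K, ∀ b : YoungDiagram, b.colLen 0 ≤ n → schur (rhoPowerSum t ⊥) b =
      c * ((∏ i, completeH (rhoPowerSum t ⊥) (beta n b i)) *
        (Matrix.vandermonde fun i => t ^ (-2 * (beta n b i : ℤ))).det) := by
  set P : Fin n → Polynomial K := fun j => ∏ l ∈ Finset.range j,
    (Polynomial.C t - Polynomial.C (t * t ^ (2 * l)) * Polynomial.X) with hP
  have hdeg : ∀ j, (P j).natDegree ≤ j := by
    intro j
    refine (Polynomial.natDegree_prod_le _ _).trans ?_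
    calc _ ≤ ∑ l ∈ Finset.range (j : ℕ), (1 : ℕ) := by
          refine Finset.sum_le_sum fun l _ => ?_
          refine (Polynomial.natDegree_sub_le _ _).trans ?_
          rw [Polynomial.natDegree_C]
          exact max_le (by omega)
            ((Polynomial.natDegree_C_mul_le _ _).trans Polynomial.natDegree_X_le)
      _ = (j : ℕ) := by simp
  refine ⟨((Equiv.Perm.sign (Fin.revPerm : Equiv.Perm (Fin n)) : ℤ) : K) *
    (Matrix.of fun i j : Fin n => (P j).coeff i).det, fun b hb => ?_⟩
  rw [schur, skewSchur_eq_det _ hb (by rw [colLen_bot]; omega)]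
  have h1 : (Matrix.of fun i j : Fin n => completeHInt (rhoPowerSum t ⊥)
      ((beta n b i : ℤ) - (beta n ⊥ j : ℤ))) =
      Matrix.of fun i j => completeH (rhoPowerSum t ⊥) (beta n b i) *
        ((Matrix.of fun i j : Fin n => (P j).eval (t ^ (-2 * (beta n b i : ℤ)))).submatrix id
          Fin.revPerm) i j := by
    ext i j
    simp only [Matrix.of_apply, Matrix.submatrix_apply, id, Fin.revPerm_apply]
    rw [completeHInt_rho_sub ht, completeHInt_natCast]
    congr 2
    have hj : beta n ⊥ j = (Fin.rev j : ℕ) := by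
      simp only [beta, rowLen_bot, Fin.val_rev]; omega
    rw [hP, hj]
  rw [h1, Matrix.det_mul_column, Matrix.det_permute',
    Matrix.eval_matrixOfPolynomials_eq_vandermonde_mul_matrixOfPolynomials _ P hdeg,
    Matrix.det_mul]
  ring

end Principal

end TopVertex

namespace TopVertex

/-! ### Content-weighted sums of s_b(q^ρ) over added boxes. -/

section UpRecursion

/-- Rows that cannot be lengthened stay in the sum with g r = 0, so that the index set matches that
of a partial fraction expansion. -/
theorem sum_ups_eq_sum_rows {M : Type*} [AddCommMonoid M] (b : YoungDiagram)
    (G : YoungDiagram → M) (g : Fin (b.colLen 0 + 1) → M)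
    (hG : ∀ b' (r : Fin (b.colLen 0 + 1)), Covers b b' → b'.rowLen r = b.rowLen r + 1 →
      (∀ i, i ≠ (r : ℕ) → b'.rowLen i = b.rowLen i) → G b' = g r)
    (hg : ∀ r : Fin (b.colLen 0 + 1), ∀ s : ℕ, (r : ℕ) = s + 1 → b.rowLen s = b.rowLen r →
      g r = 0) :
    ∑ b' ∈ ups b, G b' = ∑ r, g r := by
  have hrow : ∀ b' ∈ ups b, ∃ r : Fin (b.colLen 0 + 1), b'.rowLen r = b.rowLen r + 1 ∧
      ∀ i, i ≠ (r : ℕ) → b'.rowLen i = b.rowLen i := by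
    intro b' hb'
    obtain ⟨r, hr, hi⟩ := (mem_ups.1 hb').exists_row
    refine ⟨⟨r, ?_⟩, hr, hi⟩
    by_contra hlt
    have h1 := hi (b.colLen 0) (by omega)
    have h2 := b'.rowLen_anti (b.colLen 0) r (by omega)
    rw [rowLen_eq_zero le_rfl] at h1
    omega
  choose! row hr hi using hrow
  refine Finset.sum_of_injOn row ?_ (fun _ _ => Finset.mem_coe.2 (Finset.mem_univ _)) ?_
    (fun b' hb' => hG b' _ (mem_ups.1 hb') (hr b' hb') (hi b' hb'))
  · intro x hx y hy hxy
    refine ext_rowLen fun i => ?_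
    by_cases h : i = row x
    · rw [h, hr x hx, hxy, hr y hy]
    · rw [hi x hx i h, hi y hy i (hxy ▸ h)]
  · intro r _ hnot
    by_contra hgr
    have hadd : ∀ s : ℕ, (r : ℕ) = s + 1 → b.rowLen r < b.rowLen s := by
      intro s hs
      refine lt_of_le_of_ne (b.rowLen_anti s r (by omega)) fun h => hgr (hg r s hs h.symm)
    set f : ℕ → ℕ := fun i => if i = r then b.rowLen r + 1 else b.rowLen i with hf
    have hanti : Antitone f := by
      refine antitone_nat_of_succ_le fun i => ?_
      have h1 := b.rowLen_anti i (i + 1) (by omega)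
      simp only [hf]
      split_ifs with h2 h3 h3
      · omega
      · have := hadd i h2.symm; omega
      · subst h3; omega
      · exact h1
    have hzero : f (b.colLen 0 + 1) = 0 := by
      simp only [hf]
      rw [if_neg (by have := r.2; omega), rowLen_eq_zero (by omega)]
    set b' := ofRows f hanti _ hzero with hb'
    have hb'r : ∀ i, b'.rowLen i = f i := fun i => rowLen_ofRows _ _ _ _ i
    have hcov : Covers b b' := by
      constructor
      · rw [le_iff_rowLen]
        intro i
        rw [hb'r]; simp only [hf]; split_ifs with h
        · rw [h]; omega
        · exact le_rfl
      · rw [card_eq_sum_rowLen b' (colLen_ofRows_le _ _ _ _),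
          card_eq_sum_rowLen b (n := b.colLen 0 + 1) (by omega),
          ← Finset.add_sum_erase _ _ (Finset.mem_range.2 r.2),
          ← Finset.add_sum_erase _ _ (Finset.mem_range.2 r.2), hb'r]
        have : ∑ i ∈ (Finset.range (b.colLen 0 + 1)).erase r, b'.rowLen i =
            ∑ i ∈ (Finset.range (b.colLen 0 + 1)).erase r, b.rowLen i := by
          refine Finset.sum_congr rfl fun i hi => ?_
          rw [hb'r]; simp only [hf]; rw [if_neg (Finset.ne_of_mem_erase hi)]
        rw [this]; simp only [hf, if_true]; omega
    apply hnot
    refine ⟨b', Finset.mem_coe.2 (mem_ups.2 hcov), ?_⟩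
    by_contra hne
    have h1 := hi b' (mem_ups.2 hcov) r (fun h => hne (Fin.ext h.symm))
    rw [hb'r] at h1; simp only [hf, if_true] at h1; omega

variable {K : Type*} [Field K]

/-- The contents `q^{b_r - r}` of the boxes that might be added to the rows of `b`. -/
def rowContent (t : K) (b : YoungDiagram) (r : ℕ) : K := t ^ (2 * ((b.rowLen r : ℤ) - r))

theorem rowContent_inv (t : K) (b : YoungDiagram) (r : ℕ) :
    rowContent t⁻¹ b r = (rowContent t b r)⁻¹ := by
  rw [rowContent, rowContent, inv_zpow]

theorem rowContent_ne_zero {t : K} (ht : t ≠ 0) (b : YoungDiagram) (r : ℕ) :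
    rowContent t b r ≠ 0 := zpow_ne_zero _ ht

/-- The product alphabet is a difference of finite ones: the letters z_j = q^{b_j - j} for the rows
0, …, l(b), minus q⁻¹ z_j for the nonempty rows. The infinite tail telescopes. -/
theorem rho_mul_alpha_add {t : K} (ht : t ≠ 0) (b : YoungDiagram) {k : ℕ} (ha : alpha t k ≠ 0) :
    rhoPowerSum t b k * alpha t k +
      ∑ j : Fin (b.colLen 0), ((t⁻¹) ^ 2 * rowContent t b j) ^ k =
      ∑ j : Fin (b.colLen 0 + 1), rowContent t b j ^ k := by
  set n := b.colLen 0 with hn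
  have hterm : ∀ i : ℕ, ((t ^ (2 * (b.rowLen i : ℤ) - 2 * (i : ℤ) - 1)) ^ k -
      (t ^ (-2 * (i : ℤ) - 1)) ^ k) * alpha t k = (rowContent t b i ^ k -
        ((t⁻¹) ^ 2 * rowContent t b i) ^ k) -
        ((t ^ (-2 * (i : ℤ))) ^ k - (t ^ (-2 * ((i + 1 : ℕ) : ℤ))) ^ k) := by
    intro i
    have e1 : rowContent t b i = t ^ (2 * (b.rowLen i : ℤ) - 2 * (i : ℤ) - 1) * t := by
      rw [rowContent, ← zpow_add_one₀ ht]; congr 1; ring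
    have e2 : (t⁻¹) ^ 2 * rowContent t b i =
        t ^ (2 * (b.rowLen i : ℤ) - 2 * (i : ℤ) - 1) * t⁻¹ := by
      rw [e1, pow_two]; linear_combination (t ^ (2 * (b.rowLen i : ℤ) - 2 * (i : ℤ) - 1) * t⁻¹) *
        (inv_mul_cancel₀ ht)
    have e3 : t ^ (-2 * (i : ℤ)) = t ^ (-2 * (i : ℤ) - 1) * t := by
      rw [← zpow_add_one₀ ht]; congr 1; ring
    have e4 : t ^ (-2 * ((i + 1 : ℕ) : ℤ)) = t ^ (-2 * (i : ℤ) - 1) * t⁻¹ := by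
      rw [← zpow_sub_one₀ ht]; congr 1; push_cast; ring
    rw [e2, e1, e3, e4, alpha, mul_pow, mul_pow, mul_pow, mul_pow]; ring
  rw [rhoPowerSum_eq_sum t (n := n + 1) (by omega), add_mul, Finset.sum_mul, one_div,
    inv_mul_cancel₀ ha, Finset.sum_congr rfl fun i _ => hterm i, Finset.sum_sub_distrib,
    Finset.sum_sub_distrib, Finset.sum_range_sub', Finset.sum_range_succ
      (fun i => ((t⁻¹) ^ 2 * rowContent t b i) ^ k), Finset.sum_range, Finset.sum_range]
  have e5 : (t⁻¹) ^ 2 * rowContent t b n = t ^ (-2 * ((n + 1 : ℕ) : ℤ)) := by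
    rw [rowContent, rowLen_eq_zero le_rfl, inv_pow, ← zpow_natCast, ← zpow_neg, ← zpow_add₀ ht]
    congr 1; push_cast; ring
  rw [e5]
  simp only [Nat.cast_zero, mul_zero, zpow_zero, one_pow]
  ring

theorem rowContent_injective {t : K} (ht : GenericParam t) (b : YoungDiagram)
    {i j : ℕ} (h : rowContent t b i = rowContent t b j) : i = j := by
  have h1 := ht.zpow_injective h
  rcases lt_trichotomy i j with hij | hij | hij
  · have := b.rowLen_anti i j hij.le; omega
  · exact hij
  · have := b.rowLen_anti j i hij.le; omega

/-- The residues of `∏ (1 - w_j X) / ∏ (1 - z_j X)` for the alphabet `q^{b+ρ} (q^{1/2} - q^{-1/2})`. -/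
noncomputable def rowResidue (t : K) (b : YoungDiagram) (r : Fin (b.colLen 0 + 1)) : K :=
  (∏ j : Fin (b.colLen 0), (rowContent t b r - (t⁻¹) ^ 2 * rowContent t b j)) /
    ∏ j ∈ Finset.univ.erase r, (rowContent t b r - rowContent t b j)

theorem GenericParam.inv {t : K} (ht : GenericParam t) : GenericParam t⁻¹ := by
  refine ⟨inv_ne_zero ht.ne_zero, fun k hk => ?_, fun b hb => ?_⟩
  · rw [inv_pow, ne_eq, inv_eq_one]; exact ht.pow_ne_one k hk
  · rw [eigen_inv ht.ne_zero]
    refine ht.eigen_ne_one _ fun h => hb ?_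
    rw [← b.transpose_transpose, h, transpose_bot]

theorem completeH_rho_mul_alpha [Algebra ℚ K] {t : K} (ht : GenericParam t) (b : YoungDiagram)
    (m : ℕ) : completeH (fun k => rhoPowerSum t b k * alpha t k) m =
      ∑ r : Fin (b.colLen 0 + 1), rowResidue t b r * rowContent t b r ^ m := by
  refine completeH_sub_eq_sum (fun r : Fin (b.colLen 0 + 1) => rowContent t b r)
    (fun j : Fin (b.colLen 0) => (t⁻¹) ^ 2 * rowContent t b j)
    (fun i j h => Fin.ext (rowContent_injective ht b h))
    (fun i => rowContent_ne_zero ht.ne_zero b i) _ (fun k hk => ?_) m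
  exact rho_mul_alpha_add ht.ne_zero b (ht.alpha_ne_zero hk)

/-- Extracting -(z_r z_j)⁻¹ from every factor leaves the original residue. The extracted products
differ by z_r⁻¹, because the last letter is z_n = q^{-n}. -/
theorem rowResidue_inv {t : K} (ht : GenericParam t) (b : YoungDiagram)
    (r : Fin (b.colLen 0 + 1)) :
    rowResidue t⁻¹ b r = rowResidue t b r * (rowContent t b r)⁻¹ := by
  rw [rowResidue, rowResidue]
  generalize hn : b.colLen 0 = n at r ⊢
  have hz : ∀ i, rowContent t b i ≠ 0 := rowContent_ne_zero ht.ne_zero b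
  set z := rowContent t b with hzdef
  have ht0 := ht.ne_zero
  have hnum : ∏ j : Fin n, ((z r)⁻¹ - t ^ 2 * (z j)⁻¹) =
      (∏ j : Fin n, (z r - (t⁻¹) ^ 2 * z j)) * ∏ j : Fin n, (-(t ^ 2 * (z r)⁻¹ * (z j)⁻¹)) := by
    rw [← Finset.prod_mul_distrib]
    refine Finset.prod_congr rfl fun j _ => ?_
    have := hz r; have := hz j
    field_simp
    ring
  have hden : ∏ j ∈ Finset.univ.erase r, ((z r)⁻¹ - (z j)⁻¹) =
      (∏ j ∈ Finset.univ.erase r, (z r - z j)) *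
        ∏ j ∈ Finset.univ.erase r, (-((z r)⁻¹ * (z j)⁻¹)) := by
    rw [← Finset.prod_mul_distrib]
    refine Finset.prod_congr rfl fun j _ => ?_
    have := hz r; have := hz j
    field_simp
    ring
  have hlast : z n = (t⁻¹) ^ (2 * n) := by
    rw [hzdef, rowContent, rowLen_eq_zero hn.le, inv_pow, ← zpow_natCast, ← zpow_neg]
    congr 1; push_cast; ring
  have hc : (∏ j : Fin n, (-(t ^ 2 * (z r)⁻¹ * (z j)⁻¹))) =
      (∏ j ∈ Finset.univ.erase r, (-((z r)⁻¹ * (z j)⁻¹))) * (z r)⁻¹ := by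
    have h1 := Finset.mul_prod_erase Finset.univ
      (fun j : Fin (n + 1) => (-((z r)⁻¹ * (z j)⁻¹))) (Finset.mem_univ r)
    rw [Fin.prod_univ_castSucc] at h1
    simp only [Fin.val_castSucc, Fin.val_last] at h1
    have h2 : (∏ j : Fin n, (-(t ^ 2 * (z r)⁻¹ * (z j)⁻¹))) =
        (t ^ 2) ^ n * ∏ j : Fin n, (-((z r)⁻¹ * (z j)⁻¹)) := by
      rw [show (t ^ 2) ^ n = ∏ _j : Fin n, t ^ 2 by simp, ← Finset.prod_mul_distrib]
      exact Finset.prod_congr rfl fun j _ => by ring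
    have h3 : (z n)⁻¹ = (t ^ 2) ^ n := by rw [hlast, inv_pow, inv_inv, pow_mul]
    rw [h3] at h1
    have hr := hz r
    have h4 : (z r)⁻¹ * z r = 1 := inv_mul_cancel₀ hr
    rw [h2]
    linear_combination (z r) * h1 + (-(t ^ 2) ^ n * (∏ j : Fin n, (-((z r)⁻¹ * (z j)⁻¹))) +
      (∏ j ∈ Finset.univ.erase r, (-((z r)⁻¹ * (z j)⁻¹))) * (z r)⁻¹) * h4
  have hne : ∏ j ∈ Finset.univ.erase r, (-((z r)⁻¹ * (z j)⁻¹)) ≠ 0 := by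
    rw [Finset.prod_ne_zero_iff]
    exact fun j _ => neg_ne_zero.2 (mul_ne_zero (inv_ne_zero (hz r)) (inv_ne_zero (hz j)))
  simp only [rowContent_inv, inv_inv]
  rw [← hzdef, hnum, hden, hc, mul_comm (∏ j ∈ Finset.univ.erase r, (-((z r)⁻¹ * (z j)⁻¹))),
    ← mul_assoc, mul_div_mul_right _ _ hne]
  ring

/-- Moments with j ≥ 0 come from the expansion for t, those with j < 0 from the one for t⁻¹. Exactly
one index on the right is nonnegative. -/
theorem sum_rowResidue_mul_zpow [Algebra ℚ K] {t : K} (ht : GenericParam t) (b : YoungDiagram)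
    (j : ℤ) : ∑ r : Fin (b.colLen 0 + 1), rowResidue t b r * rowContent t b r ^ j =
      completeHInt (fun k => rhoPowerSum t b k * alpha t k) j +
      completeHInt (fun k => rhoPowerSum t b.transpose k * alpha t k) (-1 - j) := by
  rcases le_or_gt 0 j with hj | hj
  · obtain ⟨m, rfl⟩ := Int.eq_ofNat_of_zero_le hj
    rw [completeHInt_of_neg _ (show -1 - (m : ℤ) < 0 by omega), add_zero, completeHInt_natCast,
      completeH_rho_mul_alpha ht]
    simp only [zpow_natCast]
  · obtain ⟨m, hm⟩ := Int.eq_ofNat_of_zero_le (show 0 ≤ -1 - j by omega)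
    obtain rfl : j = -1 - (m : ℤ) := by omega
    rw [completeHInt_of_neg _ hj, zero_add, show -1 - (-1 - (m : ℤ)) = m by ring,
      completeHInt_natCast]
    have h1 : (fun k => rhoPowerSum t b.transpose k * alpha t k) =
        fun k => rhoPowerSum t⁻¹ b k * alpha t⁻¹ k := by
      funext k; rw [rhoPowerSum_inv ht.ne_zero, alpha_inv]; ring
    rw [h1, completeH_rho_mul_alpha ht.inv]
    refine Finset.sum_congr rfl fun r _ => ?_
    rw [rowResidue_inv ht, rowContent_inv, inv_pow, ← zpow_natCast, ← zpow_neg,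
      show -1 - (m : ℤ) = -1 + -(m : ℤ) by ring, zpow_add₀ (rowContent_ne_zero ht.ne_zero b r),
      zpow_neg_one]
    ring

/-- In `exists_schur_rho_eq` the longer row r changes a single node x_r to q⁻¹ x_r, and the
resulting ratio of Vandermonde determinants is the residue. -/
theorem schur_rho_of_add_row [Algebra ℚ K] {t : K} (ht : GenericParam t) {b b' : YoungDiagram}
    (r : Fin (b.colLen 0 + 1)) (hr : b'.rowLen r = b.rowLen r + 1)
    (hi : ∀ i, i ≠ (r : ℕ) → b'.rowLen i = b.rowLen i) :
    schur (rhoPowerSum t ⊥) b' * (t - t⁻¹) = schur (rhoPowerSum t ⊥) b * rowResidue t b r := by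
  rw [rowResidue]
  generalize hn : b.colLen 0 = n at r hr hi ⊢
  obtain ⟨c, hc⟩ := exists_schur_rho_eq ht (n + 1)
  have hb' : b'.colLen 0 ≤ n + 1 := by
    rw [← rowLen_eq_zero_iff, hi _ (by have := r.2; omega), rowLen_eq_zero (by omega)]
  have ht0 := ht.ne_zero
  rw [hc b' hb', hc b (by omega)]
  set L := beta (n + 1) b with hL
  have hL' : beta (n + 1) b' = Function.update L r (L r + 1) := by
    funext i
    by_cases h1 : i = r
    · subst h1; rw [Function.update_self, hL]; simp only [beta]; rw [hr]; omega
    · rw [Function.update_of_ne h1, hL]; simp only [beta]; rw [hi i fun h2 => h1 (Fin.ext h2)]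
  set x : Fin (n + 1) → K := fun i => t ^ (-2 * (L i : ℤ)) with hx
  have hxinj : Function.Injective x := by
    intro i j hij
    have := ht.zpow_injective hij
    exact beta_injective _ b (by simp only [← hL]; omega)
  have hx' : (fun i => t ^ (-2 * (beta (n + 1) b' i : ℤ))) =
      Function.update x r ((t⁻¹) ^ 2 * x r) := by
    funext i
    rw [hL']
    by_cases h1 : i = r
    · subst h1; rw [Function.update_self, Function.update_self, hx, inv_pow, ← zpow_natCast,
        ← zpow_neg, ← zpow_add₀ ht0]
      congr 1; push_cast; ring
    · rw [Function.update_of_ne h1, Function.update_of_ne h1]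
  rw [hx', det_vandermonde_update x hxinj, hL']
  set H := completeH (rhoPowerSum t ⊥) with hH
  have hprod : ∏ i, H (Function.update L r (L r + 1) i) =
      H (L r + 1) * ∏ i ∈ Finset.univ.erase r, H (L i) := by
    rw [← Finset.mul_prod_erase _ _ (Finset.mem_univ r), Function.update_self]
    congr 1
    exact Finset.prod_congr rfl fun i hi => by rw [Function.update_of_ne (Finset.ne_of_mem_erase hi)]
  have hstep : H (L r + 1) * (1 - (t⁻¹) ^ 2 * x r) = t⁻¹ * H (L r) := by
    have := completeHInt_rho ht ((L r + 1 : ℕ) : ℤ)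
    rw [completeHInt_natCast, show ((L r + 1 : ℕ) : ℤ) - 1 = (L r : ℤ) by push_cast; ring,
      completeHInt_natCast] at this
    rw [← this, hx, inv_pow, ← zpow_natCast, ← zpow_neg, ← zpow_add₀ ht0]
    congr 3; push_cast; ring
  set z := rowContent t b with hz
  have hz0 : ∀ i, z i ≠ 0 := rowContent_ne_zero ht0 b
  -- Up to a common factor the Vandermonde nodes are the reciprocals of the z_i.
  have hxz : ∀ i, x i = (t⁻¹) ^ (2 * n) * (z i)⁻¹ := by
    intro i
    rw [hx, hz, rowContent, inv_pow, ← zpow_natCast, ← zpow_neg, ← zpow_neg, ← zpow_add₀ ht0]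
    have := i.2
    simp only [hL, beta]; push_cast; rw [Nat.cast_sub (by omega)]; congr 1; ring
  have hratio : ∏ j ∈ Finset.univ.erase r, (((t⁻¹) ^ 2 * x r - x j) / (x r - x j)) =
      (∏ j ∈ Finset.univ.erase r, (z r - (t⁻¹) ^ 2 * z j)) /
        ∏ j ∈ Finset.univ.erase r, (z r - z j) := by
    rw [← Finset.prod_div_distrib]
    refine Finset.prod_congr rfl fun j hj => ?_
    have h1 : z r - z j ≠ 0 := fun h1 =>
      Finset.ne_of_mem_erase hj (Fin.ext (rowContent_injective ht b (sub_eq_zero.1 h1)).symm)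
    have h2 : x r - x j ≠ 0 := fun h2 =>
      Finset.ne_of_mem_erase hj (hxinj (sub_eq_zero.1 h2)).symm
    rw [div_eq_div_iff h2 h1, hxz, hxz]
    have := hz0 r; have := hz0 j
    field_simp
    ring
  have hfull : (z r - (t⁻¹) ^ 2 * z r) * ∏ j ∈ Finset.univ.erase r, (z r - (t⁻¹) ^ 2 * z j) =
      (∏ j : Fin n, (z r - (t⁻¹) ^ 2 * z j)) * (z r - (t⁻¹) ^ 2 * z n) := by
    rw [Finset.mul_prod_erase Finset.univ (fun j : Fin (n + 1) => z r - (t⁻¹) ^ 2 * z j)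
      (Finset.mem_univ r), Fin.prod_univ_castSucc]
    simp only [Fin.val_castSucc, Fin.val_last]
  have hlast : z n = (t⁻¹) ^ (2 * n) := by
    rw [hz, rowContent, rowLen_eq_zero hn.le, inv_pow, ← zpow_natCast, ← zpow_neg]
    congr 1; push_cast; ring
  have hxr : z r * (1 - (t⁻¹) ^ 2 * x r) = z r - (t⁻¹) ^ 2 * z n := by
    rw [hxz, hlast, mul_sub, mul_one]
    linear_combination (-(t⁻¹) ^ 2 * (t⁻¹) ^ (2 * n)) * mul_inv_cancel₀ (hz0 r)
  have hne : (1 - (t⁻¹) ^ 2 * x r) ≠ 0 := by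
    intro h0
    rw [hx, inv_pow, ← zpow_natCast, ← zpow_neg, ← zpow_add₀ ht0] at h0
    exact ht.zpow_ne_one (by push_cast; omega) (sub_eq_zero.1 h0).symm
  rw [hprod, hratio, ← Finset.mul_prod_erase Finset.univ (fun i => H (L i))
    (Finset.mem_univ r)]
  set E := ∏ i ∈ Finset.univ.erase r, H (L i)
  set D := ∏ j ∈ Finset.univ.erase r, (z r - z j)
  set V := (Matrix.vandermonde x).det
  set A := ∏ j ∈ Finset.univ.erase r, (z r - (t⁻¹) ^ 2 * z j)
  set B := ∏ j : Fin n, (z r - (t⁻¹) ^ 2 * z j)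
  have hBA : (1 - (t⁻¹) ^ 2) * A = B * (1 - (t⁻¹) ^ 2 * x r) := by
    apply mul_left_cancel₀ (hz0 r)
    linear_combination hfull - B * hxr
  have htt : t - t⁻¹ = t * (1 - (t⁻¹) ^ 2) := by field_simp
  have key : H (L r + 1) * A * (t - t⁻¹) = H (L r) * B := by
    apply mul_right_cancel₀ hne
    rw [htt]
    linear_combination A * t * (1 - (t⁻¹) ^ 2) * hstep + H (L r) * t * t⁻¹ * hBA +
      H (L r) * B * (1 - (t⁻¹) ^ 2 * x r) * mul_inv_cancel₀ ht0
  rw [mul_div_assoc', mul_div_assoc']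
  linear_combination (c * E * V / D) * key

/-- The Pieri-type sums of the principally specialized Schur functions, weighted by contents. -/
theorem sum_ups_schur_rho_mul_zpow [Algebra ℚ K] {t : K} (ht : GenericParam t) (b : YoungDiagram)
    (j : ℤ) : (t - t⁻¹) * ∑ b' ∈ ups b, schur (rhoPowerSum t ⊥) b' *
        (t ^ (kappa b' - kappa b)) ^ j =
      schur (rhoPowerSum t ⊥) b *
        (completeHInt (fun k => rhoPowerSum t b k * alpha t k) j +
        completeHInt (fun k => rhoPowerSum t b.transpose k * alpha t k) (-1 - j)) := by
  rw [← sum_rowResidue_mul_zpow ht, Finset.mul_sum, Finset.mul_sum]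
  apply sum_ups_eq_sum_rows
  · intro b' r h hr hi
    rw [kappa_sub_of_covers h hr hi, rowContent]
    linear_combination (t ^ (2 * ((b.rowLen r : ℤ) - r))) ^ j * schur_rho_of_add_row ht r hr hi
  · intro r s hs hbs
    -- If the row s = r - 1 is as long as row r, the residue contains the zero factor z_r - q⁻¹ z_s.
    have : rowResidue t b r = 0 := by
      rw [rowResidue, Finset.prod_eq_zero (Finset.mem_univ (⟨s, by omega⟩ : Fin (b.colLen 0))),
        zero_div]
      rw [sub_eq_zero, rowContent, rowContent, inv_pow, ← zpow_natCast, ← zpow_neg,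
        ← zpow_add₀ ht.ne_zero, hbs]
      congr 1; simp only [hs]; push_cast; ring
    rw [this]; ring

end UpRecursion

end TopVertex

/-! ### Recursions for skew Schur functions of q^ρ. -/

namespace TopVertex

theorem eigen_inv_param {K : Type*} [Field K] {t : K} (ht : t ≠ 0) (ν : YoungDiagram) :
    eigen t⁻¹ ν = (t - t⁻¹) * rhoPowerSum t ν.transpose 1 := by
  rw [eigen_inv ht, eigen]

/-- The alphabets q^ρ and `alpha` are inverse to each other, so their Cauchy factor is that of the
single letter 1. -/
theorem rho_bot_mul_alpha {K : Type*} [Field K] {t : K} (ht : GenericParam t) {k : ℕ} (hk : 1 ≤ k) :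
    rhoPowerSum t ⊥ k * alpha t k = 1 := by
  rw [rhoPowerSum_bot, one_div_mul_cancel (ht.alpha_ne_zero hk)]

section Recursions

variable {K : Type*} [Field K] [Algebra ℚ K]

/-- Together with `sum_ite_vmat_succ` and `sum_ite_vmat_pred`, this evaluates the parts of degree 0
and ±1 in sums produced by `sum_skewSchur_mul_vmat`. -/
theorem sum_ite_vmat_self {t : K} (ht : t ≠ 0) (ht1 : t - t⁻¹ ≠ 0) (S : Finset YoungDiagram)
    (f : YoungDiagram → K) (ν : YoungDiagram) (h : ν ∉ S → f ν = 0) :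
    ∑ σ ∈ S, (if σ.card = ν.card then vmat t ν σ * f σ else 0) = eigen t ν * f ν := by
  rw [Finset.sum_eq_single ν]
  · rw [if_pos rfl, vmat_self ht ht1]
  · intro σ _ hne
    split_ifs with hc
    · rw [vmat_of_card_eq ht hc hne.symm, zero_mul]
    · rfl
  · intro hν
    rw [if_pos rfl, h hν, mul_zero]

theorem sum_ite_vmat_succ {t : K} (ht : t ≠ 0) (S : Finset YoungDiagram)
    (f : YoungDiagram → K) (ν : YoungDiagram) (h : ∀ σ ∈ ups ν, σ ∉ S → f σ = 0) :
    ∑ σ ∈ S, (if σ.card = ν.card + 1 then vmat t ν σ * f σ else 0) =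
      (t - t⁻¹) * ∑ σ ∈ ups ν, t ^ (kappa σ - kappa ν) * f σ := by
  classical
  rw [Finset.mul_sum]
  symm
  refine Finset.sum_congr_of_eq_on_inter ?_ ?_ ?_
  · intro σ hσ hS; rw [h σ hσ hS]; ring
  · intro σ _ hσ
    split_ifs with hc
    · rw [vmat_eq_zero ht le_rfl hc fun hle => hσ (mem_ups.2 ⟨hle, hc⟩), zero_mul]
    · rfl
  · intro σ hσ _
    rw [mem_ups] at hσ
    rw [if_pos hσ.2, vmat_of_covers ht hσ, mul_assoc]

theorem sum_ite_vmat_pred {t : K} (ht : t ≠ 0) (S : Finset YoungDiagram)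
    (f : YoungDiagram → K) (ν : YoungDiagram) (h : ∀ σ ∈ downs ν, σ ∉ S → f σ = 0) :
    ∑ σ ∈ S, (if σ.card + 1 = ν.card then vmat t ν σ * f σ else 0) =
      (t - t⁻¹) * ∑ σ ∈ downs ν, t ^ (kappa ν - kappa σ) * f σ := by
  classical
  rw [Finset.mul_sum]
  symm
  refine Finset.sum_congr_of_eq_on_inter ?_ ?_ ?_
  · intro σ hσ hS; rw [h σ hσ hS]; ring
  · intro σ _ hσ
    split_ifs with hc
    · rw [vmat_comm, vmat_eq_zero ht le_rfl hc.symm fun hle => hσ (mem_downs.2 ⟨hle, hc.symm⟩),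
        zero_mul]
    · rfl
  · intro σ hσ _
    rw [mem_downs] at hσ
    rw [if_pos hσ.2.symm, vmat_comm, vmat_of_covers ht hσ, mul_assoc]

theorem sum_parts_mul_vmat_self {t : K} (ht : t ≠ 0) (ht1 : t - t⁻¹ ≠ 0)
    (f : YoungDiagram → K) (c : YoungDiagram) :
    ∑ η ∈ parts c.card, f η * vmat t η c = eigen t c * f c := by
  rw [← sum_ite_vmat_self ht ht1 (parts c.card) f c fun h => absurd (mem_parts.2 rfl) h]
  refine Finset.sum_congr rfl fun η hη => ?_
  rw [if_pos (mem_parts.1 hη), vmat_comm, mul_comm]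

theorem sum_parts_mul_vmat_succ {t : K} (ht : t ≠ 0) (f : YoungDiagram → K) (c : YoungDiagram) :
    ∑ η ∈ parts (c.card + 1), f η * vmat t η c =
      (t - t⁻¹) * ∑ η ∈ ups c, t ^ (kappa η - kappa c) * f η := by
  rw [← sum_ite_vmat_succ ht (parts (c.card + 1)) f c
    fun σ hσ h => absurd (mem_parts.2 (mem_ups.1 hσ).2) h]
  refine Finset.sum_congr rfl fun η hη => ?_
  rw [if_pos (mem_parts.1 hη), vmat_comm, mul_comm]

theorem sum_parts_mul_vmat_pred {t : K} (ht : t ≠ 0) (f : YoungDiagram → K) (c : YoungDiagram)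
    {m : ℕ} (hm : m + 1 = c.card) :
    ∑ η ∈ parts m, f η * vmat t η c =
      (t - t⁻¹) * ∑ η ∈ downs c, t ^ (kappa c - kappa η) * f η := by
  rw [← sum_ite_vmat_pred ht (parts m) f c
    fun σ hσ h => absurd (mem_parts.2 (by have := (mem_downs.1 hσ).2; omega)) h]
  refine Finset.sum_congr rfl fun η hη => ?_
  rw [if_pos (by rw [mem_parts.1 hη]; exact hm), vmat_comm, mul_comm]

theorem completeHInt_congr {p p' : ℕ → K} (h : ∀ k, 1 ≤ k → p k = p' k) (n : ℤ) :
    completeHInt p n = completeHInt p' n := by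
  rw [completeHInt, completeHInt]
  split_ifs
  · exact completeH_congr h _
  · rfl

theorem completeHInt_one (n : ℤ) :
    completeHInt (fun _ => (1 : K)) n = if 0 ≤ n then 1 else 0 := by
  rw [completeHInt, completeH_congr (p' := fun k => (1 : K) ^ k) (by simp), completeH_pow, one_pow]

theorem completeHInt_neg_one (n : ℤ) :
    completeHInt (fun _ => (-1 : K)) n = (if n = 0 then 1 else 0) - if n = 1 then 1 else 0 := by
  have h1 := mk_completeH_add (fun _ => (-1 : K)) (fun k => (1 : K) ^ k)
  have h2 : (fun k => -1 + (1 : K) ^ k) = fun _ => 0 := by funext k; simp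
  have h3 := mk_completeH_listAlphabet_mul [(1 : K)]
  rw [show listAlphabet [(1 : K)] = fun k => 1 ^ k by funext k; simp [listAlphabet]] at h3
  simp only [List.map_cons, List.map_nil, List.prod_cons, List.prod_nil, mul_one, map_one,
    one_mul] at h3
  have h0 : PowerSeries.mk (completeH fun _ => (0 : K)) = 1 := by
    ext n; rw [PowerSeries.coeff_mk, completeH_zero_alphabet, PowerSeries.coeff_one]
  rw [h2, h0] at h1
  have h4 : PowerSeries.mk (completeH fun _ => (-1 : K)) = 1 - PowerSeries.X := by
    linear_combination (1 - PowerSeries.X) * (-h1) - PowerSeries.mk (completeH fun _ => (-1 : K)) * h3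
  rcases lt_or_ge n 0 with hn | hn
  · rw [completeHInt_of_neg _ hn, if_neg hn.ne, if_neg (by omega), sub_zero]
  · obtain ⟨m, rfl⟩ := Int.eq_ofNat_of_zero_le hn
    have h5 := congrArg (PowerSeries.coeff m) h4
    rw [PowerSeries.coeff_mk, map_sub, PowerSeries.coeff_one, PowerSeries.coeff_X] at h5
    rw [completeHInt_natCast, h5]
    simp

/-- Recursion in the outer partition for skew Schur functions of `q^ρ`. -/
theorem eigen_sub_mul_skewSchur_rho {t : K} (ht : GenericParam t) (a μ : YoungDiagram) :
    (eigen t a - eigen t μ) * skewSchur (rhoPowerSum t ⊥) a μ =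
      (t - t⁻¹) * ∑ a' ∈ downs a, t ^ (kappa a - kappa a') * skewSchur (rhoPowerSum t ⊥) a' μ := by
  have ht0 := ht.ne_zero
  have ht1 := ht.sub_inv_ne_zero
  set Y := rhoPowerSum t ⊥ with hY
  have hh : ∀ m, completeHInt (fun k => Y k * alpha t k) m = if 0 ≤ m then (1 : K) else 0 := by
    intro m
    rw [completeHInt_congr (fun k hk => rho_bot_mul_alpha ht hk), completeHInt_one]
  have h1 := sum_skewSchur_mul_vmat t Y μ a a.card
  rw [sum_parts_mul_vmat_self ht0 ht1 (fun η => skewSchur Y η μ)] at h1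
  have hself := sum_ite_vmat_self ht0 ht1 (below a) (fun σ => skewSchur Y a σ) μ
    (fun h => skewSchur_of_not_le _ fun h' => h (mem_below.2 h'))
  by_cases hbot : a = ⊥
  · subst hbot
    rw [downs_bot, Finset.sum_empty, mul_zero]
    by_cases hμ : μ = ⊥
    · rw [hμ, sub_self, zero_mul]
    · rw [skewSchur_of_not_le _ fun h => hμ (le_bot_iff.1 h), mul_zero]
  obtain ⟨m, hm⟩ : ∃ m, m + 1 = a.card :=
    ⟨a.card - 1, by have := mt (card_eq_zero_iff a).1 hbot; omega⟩
  have h2 := sum_skewSchur_mul_vmat t Y μ a m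
  rw [sum_parts_mul_vmat_pred ht0 (fun η => skewSchur Y η μ) a hm] at h2
  -- All Cauchy factors h_m with m ≥ 0 are 1, so the sums in degrees |a| and |a| - 1 differ only in
  -- the terms with |σ| = |μ|.
  rw [sub_mul, ← hself, h1, h2, sub_eq_iff_eq_add, ← Finset.sum_add_distrib]
  refine Finset.sum_congr rfl fun σ _ => ?_
  rw [hh, hh]
  split_ifs <;> first | omega | ring

/-- Recursion in the inner partition for skew Schur functions of `q^ρ`. -/
theorem rho_sub_mul_skewSchur_rho {t : K} (ht : GenericParam t) (a μ : YoungDiagram) :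
    (rhoPowerSum t a.transpose 1 - rhoPowerSum t μ.transpose 1) * skewSchur (rhoPowerSum t ⊥) a μ =
      ∑ μ' ∈ ups μ, t ^ (kappa μ - kappa μ') * skewSchur (rhoPowerSum t ⊥) a μ' := by
  have ht0 := ht.inv.ne_zero
  have ht1 := ht.inv.sub_inv_ne_zero
  set Y := rhoPowerSum t ⊥ with hY
  -- With t⁻¹ the Cauchy factor is 1 - u, which leaves only |σ| = |μ| and |σ| = |μ| + 1.
  have hh : ∀ m, completeHInt (fun k => Y k * alpha t⁻¹ k) m =
      (if m = 0 then (1 : K) else 0) - if m = 1 then 1 else 0 := by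
    intro m
    rw [completeHInt_congr (p' := fun _ => -1) (fun k hk => by
      rw [alpha_inv, mul_neg, rho_bot_mul_alpha ht hk]), completeHInt_neg_one]
  have h1 := sum_skewSchur_mul_vmat t⁻¹ Y μ a a.card
  rw [sum_parts_mul_vmat_self ht0 ht1 (fun η => skewSchur Y η μ)] at h1
  have hself := sum_ite_vmat_self ht0 ht1 (below a) (fun σ => skewSchur Y a σ) μ
    (fun h => skewSchur_of_not_le _ fun h' => h (mem_below.2 h'))
  have hsucc := sum_ite_vmat_succ ht0 (below a) (fun σ => skewSchur Y a σ) μ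
    (fun σ _ h => skewSchur_of_not_le _ fun h' => h (mem_below.2 h'))
  have h2 : eigen t⁻¹ a * skewSchur Y a μ = eigen t⁻¹ μ * skewSchur Y a μ -
      (t⁻¹ - t⁻¹⁻¹) * ∑ σ ∈ ups μ, t⁻¹ ^ (kappa σ - kappa μ) * skewSchur Y a σ := by
    rw [← hself, ← hsucc, h1, ← Finset.sum_sub_distrib]
    refine Finset.sum_congr rfl fun σ _ => ?_
    rw [hh]
    split_ifs <;> first | omega | ring
  rw [eigen_inv_param ht.ne_zero, eigen_inv_param ht.ne_zero, inv_inv] at h2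
  simp only [inv_zpow', neg_sub] at h2
  apply mul_left_cancel₀ ht.sub_inv_ne_zero
  linear_combination h2

theorem kappa_of_covers_bot {τ : YoungDiagram} (h : Covers ⊥ τ) : kappa τ = 0 := by
  obtain ⟨r, hr, hi⟩ := h.exists_row
  have h1 := kappa_sub_of_covers h hr hi
  rw [rowLen_bot] at hr h1
  have h2 : r = 0 := by
    by_contra h0
    have h3 := hi 0 (Ne.symm h0)
    have h4 := τ.rowLen_anti 0 r (Nat.zero_le _)
    rw [rowLen_bot] at h3
    omega
  rw [kappa_bot, h2] at h1
  simpa using h1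

/-- `s_b(q^ρ) = q^{κ(b)/2} s_{bᵗ}(q^ρ)`. -/
theorem schur_rho_transpose {t : K} (ht : GenericParam t) (b : YoungDiagram) :
    schur (rhoPowerSum t ⊥) b = t ^ kappa b * schur (rhoPowerSum t ⊥) b.transpose := by
  have ht0 := ht.ne_zero
  induction hn : b.card using Nat.strong_induction_on generalizing b with
  | _ n ih =>
    by_cases hb : b = ⊥
    · rw [hb, transpose_bot, kappa_bot, zpow_zero, one_mul]
    -- The inner recursion for b and the outer recursion for bᵗ express the two sides through
    -- smaller partitions with the same nonzero factor.
    have h1 := rho_sub_mul_skewSchur_rho ht b ⊥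
    have h2 : ∑ μ' ∈ ups ⊥, t ^ (kappa ⊥ - kappa μ') * skewSchur (rhoPowerSum t ⊥) b μ' =
        ∑ b' ∈ downs b, skewSchur (rhoPowerSum t ⊥) b' ⊥ := by
      rw [sum_downs_skewSchur]
      refine Finset.sum_congr rfl fun μ hμ => ?_
      rw [kappa_of_covers_bot (mem_ups.1 hμ), kappa_bot, sub_zero, zpow_zero, one_mul]
    have h3 := eigen_sub_mul_skewSchur_rho ht b.transpose ⊥
    rw [sum_downs_transpose] at h3
    have h4 : t ^ kappa b * ∑ b' ∈ downs b, t ^ (kappa b.transpose - kappa b'.transpose) *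
        skewSchur (rhoPowerSum t ⊥) b'.transpose ⊥ =
        ∑ b' ∈ downs b, skewSchur (rhoPowerSum t ⊥) b' ⊥ := by
      rw [Finset.mul_sum]
      refine Finset.sum_congr rfl fun b' hb' => ?_
      have := ih b'.card (by have := (mem_downs.1 hb').2; omega) b' rfl
      rw [schur, schur] at this
      rw [this, kappa_transpose, kappa_transpose, ← mul_assoc, ← zpow_add₀ ht0]
      congr 2; ring
    rw [h2, ← h4, transpose_bot] at h1
    have hne : eigen t b.transpose - 1 ≠ 0 := by
      refine sub_ne_zero.2 (ht.eigen_ne_one _ fun h => hb ?_)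
      rw [← b.transpose_transpose, h, transpose_bot]
    rw [eigen_bot ht.sub_inv_ne_zero] at h3
    apply mul_left_cancel₀ hne
    rw [schur, schur]
    have h5 : eigen t b.transpose - 1 = (t - t⁻¹) *
        (rhoPowerSum t b.transpose 1 - rhoPowerSum t ⊥ 1) := by
      rw [← eigen_bot ht.sub_inv_ne_zero, eigen, eigen]; ring
    have h6 : (eigen t b.transpose - 1) * skewSchur (rhoPowerSum t ⊥) b ⊥ =
        (t - t⁻¹) * (t ^ kappa b * ∑ b' ∈ downs b, t ^ (kappa b.transpose - kappa b'.transpose) *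
        skewSchur (rhoPowerSum t ⊥) b'.transpose ⊥) := by
      rw [h5, ← h1]; ring
    rw [h6]
    linear_combination (-t ^ kappa b) * h3

/-- The content-weighted branching rule for skew Schur functions of `q^ρ`. -/
theorem sum_ups_skewSchur_rho {t : K} (ht : GenericParam t) (d ν : YoungDiagram) :
    ∑ d' ∈ ups d, t ^ (kappa d - kappa d') * skewSchur (rhoPowerSum t ⊥) d' ν =
      rhoPowerSum t ν.transpose 1 * skewSchur (rhoPowerSum t ⊥) d ν +
        ∑ σ ∈ downs ν, t ^ (kappa σ - kappa ν) * skewSchur (rhoPowerSum t ⊥) d σ := by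
  have ht0 := ht.inv.ne_zero
  have ht1 := ht.inv.sub_inv_ne_zero
  set Y := rhoPowerSum t ⊥ with hY
  have hh : ∀ m, completeHInt (fun k => Y k * alpha t⁻¹ k) m =
      (if m = 0 then (1 : K) else 0) - if m = 1 then 1 else 0 := by
    intro m
    rw [completeHInt_congr (p' := fun _ => -1) (fun k hk => by
      rw [alpha_inv, mul_neg, rho_bot_mul_alpha ht hk]), completeHInt_neg_one]
  have h1 := sum_skewSchur_mul_vmat t⁻¹ Y ν d (d.card + 1)
  rw [sum_parts_mul_vmat_succ ht0 (fun η => skewSchur Y η ν)] at h1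
  have hself := sum_ite_vmat_self ht0 ht1 (below d) (fun σ => skewSchur Y d σ) ν
    (fun h => skewSchur_of_not_le _ fun h' => h (mem_below.2 h'))
  have hpred := sum_ite_vmat_pred ht0 (below d) (fun σ => skewSchur Y d σ) ν
    (fun σ _ h => skewSchur_of_not_le _ fun h' => h (mem_below.2 h'))
  have h2 : (t⁻¹ - t⁻¹⁻¹) * ∑ d' ∈ ups d, t⁻¹ ^ (kappa d' - kappa d) * skewSchur Y d' ν =
      (t⁻¹ - t⁻¹⁻¹) * ∑ σ ∈ downs ν, t⁻¹ ^ (kappa ν - kappa σ) * skewSchur Y d σ -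
        eigen t⁻¹ ν * skewSchur Y d ν := by
    rw [← hself, ← hpred, h1, ← Finset.sum_sub_distrib]
    refine Finset.sum_congr rfl fun σ _ => ?_
    rw [hh]
    push_cast
    split_ifs <;> first | omega | ring
  rw [eigen_inv_param ht.ne_zero, inv_inv] at h2
  simp only [inv_zpow', neg_sub] at h2
  apply mul_left_cancel₀ ht.sub_inv_ne_zero
  linear_combination -h2

end Recursions

end TopVertex

/-! ### Uniqueness of solutions of box recursions. -/

namespace TopVertex

/-- If all moments at distinct nodes vanish, so does the pairing with any polynomial; one that
vanishes at all nodes but one isolates each coefficient. -/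
theorem eq_zero_of_forall_sum_mul_pow {K : Type*} [Field K] {ι : Type*} (s : Finset ι) (f x : ι → K)
    (hf : Set.InjOn f s) (h : ∀ k : ℕ, ∑ i ∈ s, f i ^ k * x i = 0) : ∀ i ∈ s, x i = 0 := by
  classical
  intro i hi
  have hP : ∀ P : Polynomial K, ∑ j ∈ s, P.eval (f j) * x j = 0 := by
    intro P
    simp only [Polynomial.eval_eq_sum_range, Finset.sum_mul]
    rw [Finset.sum_comm]
    refine Finset.sum_eq_zero fun k _ => ?_
    rw [← mul_zero (P.coeff k), ← h k, Finset.mul_sum]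
    exact Finset.sum_congr rfl fun j _ => by ring
  have h1 := hP (∏ j ∈ s.erase i, (Polynomial.X - Polynomial.C (f j)))
  rw [Finset.sum_eq_single i] at h1
  · rcases mul_eq_zero.1 h1 with h2 | h2
    · rw [Polynomial.eval_prod, Finset.prod_eq_zero_iff] at h2
      obtain ⟨j, hj, h3⟩ := h2
      rw [Polynomial.eval_sub, Polynomial.eval_X, Polynomial.eval_C, sub_eq_zero] at h3
      exact absurd (hf hi (Finset.mem_of_mem_erase hj) h3).symm (Finset.ne_of_mem_erase hj)
    · exact h2
  · intro j hj hne
    rw [Polynomial.eval_prod, Finset.prod_eq_zero (Finset.mem_erase.2 ⟨hne, hj⟩) (by simp),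
      zero_mul]
  · exact fun h2 => absurd hi h2

/-- Boxes added to different rows have different contents, and q^c is injective in c for generic t.
-/
theorem injOn_rho_ups {K : Type*} [Field K] {t : K} (ht : GenericParam t) (b : YoungDiagram) :
    Set.InjOn (fun b' : YoungDiagram => rhoPowerSum t b'.transpose 1) (ups b : Set YoungDiagram) := by
  intro x hx y hy hxy
  simp only [Finset.mem_coe, mem_ups] at hx hy
  simp only at hxy
  rw [rhoPowerSum_covers ht.ne_zero hx.transpose, rhoPowerSum_covers ht.ne_zero hy.transpose,
    pow_one, pow_one, alpha_one] at hxy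
  have h1 := ht.zpow_injective (mul_right_cancel₀ ht.sub_inv_ne_zero (add_left_cancel hxy))
  simp only [kappa_transpose] at h1
  obtain ⟨r, hr, hri⟩ := hx.exists_row
  obtain ⟨s, hs, hsi⟩ := hy.exists_row
  have h2 := kappa_sub_of_covers hx hr hri
  have h3 := kappa_sub_of_covers hy hs hsi
  have h4 : r = s := by
    refine rowContent_injective ht b (t := t) ?_
    rw [rowContent, rowContent, ← h2, ← h3]; congr 1; omega
  subst h4
  refine ext_rowLen fun i => ?_
  by_cases h5 : i = r
  · rw [h5, hr, hs]
  · rw [hri i h5, hsi i h5]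

/-- A family on pairs of partitions is determined by its values at `a = ∅` and two recursions. -/
theorem eq_zero_of_recursions_two {K : Type*} [Field K] {t : K} (ht : GenericParam t) (D : YoungDiagram → YoungDiagram → K)
    (g : K) (w : YoungDiagram → YoungDiagram → K) (h0 : ∀ c, D ⊥ c = 0)
    (h1 : ∀ a c, ∑ c' ∈ ups c, D a c' = rhoPowerSum t a.transpose 1 * D a c)
    (h2 : ∀ a c, ∑ a' ∈ ups a, D a' c = g * D a c + ∑ c' ∈ downs c, w c c' * D a c') :
    ∀ a c, D a c = 0 := by
  intro a
  induction a using covers_induction with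
  | h0 => exact h0
  | h a b hab ih =>
    -- The recursion `h2` and the induction hypothesis give moment 0; each use of `h1` trades one
    -- power of the eigenvalue for a sum over c.
    have h3 : ∀ k : ℕ, ∀ c, ∑ a' ∈ ups a, rhoPowerSum t a'.transpose 1 ^ k * D a' c = 0 := by
      intro k
      induction k with
      | zero =>
        intro c
        simp only [pow_zero, one_mul]
        rw [h2, ih, Finset.sum_eq_zero fun c' _ => by rw [ih, mul_zero]]; ring
      | succ k ihk =>
        intro c
        have : ∀ a', rhoPowerSum t a'.transpose 1 ^ (k + 1) * D a' c =
            ∑ c' ∈ ups c, rhoPowerSum t a'.transpose 1 ^ k * D a' c' := by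
          intro a'
          rw [← Finset.mul_sum, h1]; ring
        simp only [this]
        rw [Finset.sum_comm]
        exact Finset.sum_eq_zero fun c' _ => ihk c'
    intro c
    exact eq_zero_of_forall_sum_mul_pow (ups a) (fun a' => rhoPowerSum t a'.transpose 1)
      (fun a' => D a' c) (injOn_rho_ups ht a) (fun k => h3 k c) b (mem_ups.2 hab)

/-- A family on triples of partitions is determined by its values at `b = ∅` and two recursions. -/
theorem eq_zero_of_recursions_three {K : Type*} [Field K] {t : K} (ht : GenericParam t)
    (X : YoungDiagram → YoungDiagram → YoungDiagram → K)
    (g : YoungDiagram → K) (w : YoungDiagram → YoungDiagram → K) (h0 : ∀ a c, X a ⊥ c = 0)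
    (h1 : ∀ a b c, ∑ a' ∈ ups a, X a' b c = rhoPowerSum t b.transpose 1 * X a b c +
      ∑ c' ∈ downs c, w c c' * X a b c')
    (h2 : ∀ a b c, ∑ b' ∈ ups b, t ^ (kappa b - kappa b') * X a b' c = g a * X a b c +
      ∑ c' ∈ downs c, X a b c') :
    ∀ b a c, X a b c = 0 := by
  intro b
  induction hn : b.card generalizing b with
  | zero => rw [(card_eq_zero_iff b).1 hn]; exact h0
  | succ n ih =>
    intro a c
    -- The inner induction on |c| removes the terms with smaller c' from `h1`, which then acts as an
    -- eigenvalue equation.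
    induction hm : c.card using Nat.strong_induction_on generalizing a b c with
    | _ m ihc =>
      obtain ⟨β, hβ⟩ := exists_covers (ν := b) (by rintro rfl; rw [card_bot] at hn; omega)
      have hβn : β.card = n := by have := hβ.2; omega
      have h3 : ∀ k : ℕ, ∀ a, ∑ b' ∈ ups β, rhoPowerSum t b'.transpose 1 ^ k *
          (t ^ (kappa β - kappa b') * X a b' c) = 0 := by
        intro k
        induction k with
        | zero =>
          intro a
          simp only [pow_zero, one_mul]
          rw [h2, ih β hβn, Finset.sum_eq_zero fun c' _ => ih β hβn a c']; ring
        | succ k ihk =>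
          intro a
          have : ∀ b' ∈ ups β, rhoPowerSum t b'.transpose 1 ^ (k + 1) *
              (t ^ (kappa β - kappa b') * X a b' c) = ∑ a' ∈ ups a,
              rhoPowerSum t b'.transpose 1 ^ k * (t ^ (kappa β - kappa b') * X a' b' c) := by
            intro b' hb'
            rw [← Finset.mul_sum, ← Finset.mul_sum, h1, Finset.sum_eq_zero]
            · ring
            · intro c' hc'
              rw [ihc c'.card (by have := (mem_downs.1 hc').2; omega) b'
                (by have := (mem_ups.1 hb').2; omega) a c' rfl, mul_zero]
          rw [Finset.sum_congr rfl this, Finset.sum_comm]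
          exact Finset.sum_eq_zero fun a' _ => ihk a'
      have h4 := eq_zero_of_forall_sum_mul_pow (ups β) (fun b' => rhoPowerSum t b'.transpose 1)
        (fun b' => t ^ (kappa β - kappa b') * X a b' c) (injOn_rho_ups ht β) (fun k => h3 k a) b
        (mem_ups.2 hβ)
      exact (mul_eq_zero.1 h4).resolve_left (zpow_ne_zero _ ht.ne_zero)

/-! ### Box recursions for the vertex and its cyclic symmetry. -/

section Vertex

variable {K : Type*} [Field K] [Algebra ℚ K]

/-- `∑_μ s_{a/μ}(x) s_{d/μ}(y)`. -/
noncomputable def pairing (x y : ℕ → K) (a d : YoungDiagram) : K :=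
  ∑ μ ∈ below a, skewSchur x a μ * skewSchur y d μ

theorem pairing_comm (x y : ℕ → K) (a d : YoungDiagram) : pairing x y a d = pairing y x d a :=
  sum_below_comm _ _ _ _

theorem pairing_eq_sum (x y : ℕ → K) (a d : YoungDiagram) {S : Finset YoungDiagram}
    (hS : below a ⊆ S) : pairing x y a d = ∑ μ ∈ S, skewSchur x a μ * skewSchur y d μ := by
  refine Finset.sum_subset hS fun μ _ hμ => ?_
  rw [skewSchur_of_not_le _ fun h => hμ (mem_below.2 h), zero_mul]

theorem below_mono {a b : YoungDiagram} (h : a ≤ b) : below a ⊆ below b := fun _ hμ =>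
  mem_below.2 ((mem_below.1 hμ).trans h)

/-- A box added to a either contributes the factor x_1 or passes to the common inner partition;
there `sum_downs_skewSchur` turns it into a box removed from d. -/
theorem sum_ups_pairing (x y : ℕ → K) (a d : YoungDiagram) :
    ∑ a' ∈ ups a, pairing x y a' d =
      x 1 * pairing x y a d + ∑ d' ∈ downs d, pairing x y a d' := by
  simp only [pairing_comm x y]
  simp only [pairing]
  rw [Finset.sum_comm, Finset.sum_congr rfl fun μ _ => (Finset.mul_sum _ _ _).symm,
    Finset.sum_congr rfl fun μ _ => by rw [sum_ups_skewSchur, mul_add], Finset.sum_add_distrib,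
    Finset.mul_sum]
  congr 1
  · exact Finset.sum_congr rfl fun μ _ => by ring
  · have h1 : ∀ d' ∈ downs d, ∑ μ ∈ below d', skewSchur y d' μ * skewSchur x a μ =
        ∑ μ ∈ below d, skewSchur y d' μ * skewSchur x a μ := fun d' hd' =>
      pairing_eq_sum y x d' a (below_mono (mem_downs.1 hd').1)
    rw [Finset.sum_congr rfl h1, Finset.sum_comm]
    simp only [← Finset.sum_mul]
    simp only [sum_downs_skewSchur, Finset.mul_sum, Finset.sum_mul]
    rw [Finset.sum_sigma', Finset.sum_sigma']
    refine Finset.sum_bij_ne_zero (fun p _ _ => ⟨p.2, p.1⟩) ?_ ?_ ?_ ?_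
    · rintro ⟨μ, μ'⟩ h _
      simp only [Finset.mem_sigma, mem_below, mem_downs, mem_ups] at h ⊢
      exact ⟨h.2.1.trans h.1, h.2⟩
    · rintro ⟨μ, μ'⟩ _ _ ⟨ν, ν'⟩ _ _ h
      simp only [Sigma.mk.injEq, heq_eq_eq] at h ⊢
      exact ⟨h.2, h.1⟩
    · rintro ⟨μ, μ'⟩ h hne
      simp only [Finset.mem_sigma, mem_below, mem_ups] at h
      refine ⟨⟨μ', μ⟩, ?_, hne, rfl⟩
      simp only [Finset.mem_sigma, mem_below, mem_downs]
      refine ⟨?_, h.2⟩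
      by_contra hle
      exact hne (by rw [skewSchur_of_not_le _ hle, zero_mul])
    · rintro ⟨μ, μ'⟩ _ _
      rfl

/-- `∑_μ s_{a/μ}(q^{bᵗ+ρ}) s_{d/μ}(q^{b+ρ})`. -/
noncomputable def legSum (t : K) (b a d : YoungDiagram) : K :=
  pairing (rhoPowerSum t b.transpose) (rhoPowerSum t b) a d

/-- The new box adjoins `alpha` scaled by z to q^{b+ρ} and by z⁻¹ to q^{bᵗ+ρ}. Splitting these off
leaves `vmat` between the inner partitions, and z counts the difference in degree. -/
theorem legSum_covers {t : K} (ht : t ≠ 0) {b b' : YoungDiagram} (h : Covers b b')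
    (a d : YoungDiagram) : legSum t b' a d = ∑ ν ∈ below a, ∑ η ∈ below d,
      skewSchur (rhoPowerSum t b.transpose) a ν * skewSchur (rhoPowerSum t b) d η *
        vmat t ν η * (t ^ (kappa b' - kappa b)) ^ ((η.card : ℤ) - ν.card) := by
  set z := t ^ (kappa b' - kappa b) with hz
  have hz0 : z ≠ 0 := zpow_ne_zero _ ht
  have h1 : rhoPowerSum t b'.transpose = fun k => rhoPowerSum t b.transpose k +
      (z⁻¹) ^ k * alpha t k := by
    funext k
    rw [rhoPowerSum_covers ht h.transpose, kappa_transpose, kappa_transpose, hz, ← zpow_neg]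
    congr 4; ring
  have h2 : rhoPowerSum t b' = fun k => rhoPowerSum t b k + z ^ k * alpha t k := by
    funext k; rw [rhoPowerSum_covers ht h]
  rw [legSum, pairing_eq_sum _ _ a d (subset_refl _), h1, h2]
  simp only [skewSchur_add, skewSchur_scale, Finset.sum_mul_sum]
  rw [Finset.sum_comm]
  refine Finset.sum_congr rfl fun ν hν => ?_
  rw [Finset.sum_comm]
  refine Finset.sum_congr rfl fun η _ => ?_
  have h3 : vmat t ν η = ∑ κ ∈ below a, skewSchur (alpha t) ν κ * skewSchur (alpha t) η κ :=
    pairing_eq_sum _ _ ν η (below_mono (mem_below.1 hν))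
  rw [h3, Finset.mul_sum, Finset.sum_mul]
  refine Finset.sum_congr rfl fun κ _ => ?_
  by_cases hκ : κ ≤ ν ∧ κ ≤ η
  · have e1 := card_mono hκ.1
    have e2 := card_mono hκ.2
    have h4 : z ^ ((η.card : ℤ) - ν.card) = (z⁻¹) ^ (ν.card - κ.card) * z ^ (η.card - κ.card) := by
      rw [inv_pow, ← zpow_natCast, ← zpow_natCast, ← zpow_neg, ← zpow_add₀ hz0]
      congr 1; omega
    rw [h4]; ring
  · rcases not_and_or.1 hκ with h5 | h5 <;> rw [skewSchur_of_not_le _ h5] <;> ring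

/-- Summing the powers of z by `sum_ups_schur_rho_mul_zpow` yields two Cauchy factors. By
`sum_skewSchur_mul_vmat`, the first collapses in degree |d| to the eigenvalue of d, the second in
degree |a| - 1 to the removal of a box from a. -/
theorem sum_ups_schur_mul_legSum {t : K} (ht : GenericParam t) (b a d : YoungDiagram) :
    ∑ b' ∈ ups b, schur (rhoPowerSum t ⊥) b' * legSum t b' a d =
      schur (rhoPowerSum t ⊥) b * (rhoPowerSum t d 1 * legSum t b a d +
        ∑ a' ∈ downs a, t ^ (kappa a - kappa a') * legSum t b a' d) := by
  have ht0 := ht.ne_zero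
  have ht1 := ht.sub_inv_ne_zero
  set Y := rhoPowerSum t b with hY
  set Y' := rhoPowerSum t b.transpose with hY'
  apply mul_left_cancel₀ ht1
  have h1 : (t - t⁻¹) * ∑ b' ∈ ups b, schur (rhoPowerSum t ⊥) b' * legSum t b' a d =
      ∑ ν ∈ below a, ∑ η ∈ below d, skewSchur Y' a ν * skewSchur Y d η * vmat t ν η *
        (schur (rhoPowerSum t ⊥) b *
          (completeHInt (fun k => Y k * alpha t k) ((η.card : ℤ) - ν.card) +
          completeHInt (fun k => Y' k * alpha t k) (-1 - ((η.card : ℤ) - ν.card)))) := by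
    rw [Finset.sum_congr rfl fun b' hb' => by rw [legSum_covers ht0 (mem_ups.1 hb')]]
    simp only [Finset.mul_sum]
    rw [Finset.sum_comm]
    refine Finset.sum_congr rfl fun ν _ => ?_
    rw [Finset.sum_comm]
    refine Finset.sum_congr rfl fun η _ => ?_
    rw [← sum_ups_schur_rho_mul_zpow ht, Finset.mul_sum, Finset.mul_sum]
    refine Finset.sum_congr rfl fun b' _ => ?_
    ring
  have h2 : ∑ ν ∈ below a, ∑ η ∈ below d, skewSchur Y' a ν * skewSchur Y d η * vmat t ν η *
      completeHInt (fun k => Y k * alpha t k) ((η.card : ℤ) - ν.card) =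
      eigen t d * legSum t b a d := by
    rw [legSum, pairing, Finset.mul_sum]
    refine Finset.sum_congr rfl fun ν _ => ?_
    have h3 := sum_skewSchur_mul_vmat t Y ν d d.card
    rw [sum_parts_mul_vmat_self ht0 ht1 (fun η => skewSchur Y η ν)] at h3
    rw [mul_left_comm, h3, Finset.mul_sum]
    refine Finset.sum_congr rfl fun η _ => ?_
    rw [show (d.card : ℤ) + η.card - ν.card - d.card = η.card - ν.card by ring]
    ring
  have h4 : ∑ ν ∈ below a, ∑ η ∈ below d, skewSchur Y' a ν * skewSchur Y d η * vmat t ν η *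
      completeHInt (fun k => Y' k * alpha t k) (-1 - ((η.card : ℤ) - ν.card)) =
      (t - t⁻¹) * ∑ a' ∈ downs a, t ^ (kappa a - kappa a') * legSum t b a' d := by
    have h5 : ∀ a', legSum t b a' d = ∑ η ∈ below d, skewSchur Y d η * skewSchur Y' a' η :=
      fun a' => pairing_comm _ _ _ _
    simp only [h5, Finset.mul_sum]
    rw [Finset.sum_comm, Finset.sum_comm (s := downs a)]
    refine Finset.sum_congr rfl fun η _ => ?_
    have h6 : (t - t⁻¹) * ∑ a' ∈ downs a, t ^ (kappa a - kappa a') * skewSchur Y' a' η =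
        ∑ ν ∈ below a, skewSchur Y' a ν * vmat t ν η *
          completeHInt (fun k => Y' k * alpha t k) (-1 - ((η.card : ℤ) - ν.card)) := by
      by_cases ha : a = ⊥
      · subst ha
        rw [downs_bot, Finset.sum_empty, mul_zero]
        refine (Finset.sum_eq_zero fun ν hν => ?_).symm
        rw [le_bot_iff.1 (mem_below.1 hν), card_bot, completeHInt_of_neg _ (by push_cast; omega),
          mul_zero]
      · obtain ⟨m, hm⟩ : ∃ m, m + 1 = a.card :=
          ⟨a.card - 1, by have := mt (card_eq_zero_iff a).1 ha; omega⟩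
        rw [← sum_parts_mul_vmat_pred ht0 (fun ν => skewSchur Y' ν η) a hm,
          sum_skewSchur_mul_vmat]
        refine Finset.sum_congr rfl fun ν _ => ?_
        rw [vmat_comm, show (m : ℤ) + ν.card - η.card - a.card = -1 - ((η.card : ℤ) - ν.card) by
          rw [← hm]; push_cast; ring]
        ring
    calc _ = skewSchur Y d η * ∑ ν ∈ below a, skewSchur Y' a ν * vmat t ν η *
          completeHInt (fun k => Y' k * alpha t k) (-1 - ((η.card : ℤ) - ν.card)) := by
          rw [Finset.mul_sum]; exact Finset.sum_congr rfl fun ν _ => by ring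
      _ = _ := by
          rw [← h6, Finset.mul_sum, Finset.mul_sum]
          exact Finset.sum_congr rfl fun ν _ => by ring
  rw [h1]
  have h7 : ∑ ν ∈ below a, ∑ η ∈ below d, skewSchur Y' a ν * skewSchur Y d η * vmat t ν η *
        (schur (rhoPowerSum t ⊥) b *
          (completeHInt (fun k => Y k * alpha t k) ((η.card : ℤ) - ν.card) +
          completeHInt (fun k => Y' k * alpha t k) (-1 - ((η.card : ℤ) - ν.card)))) =
      schur (rhoPowerSum t ⊥) b * (eigen t d * legSum t b a d +
        (t - t⁻¹) * ∑ a' ∈ downs a, t ^ (kappa a - kappa a') * legSum t b a' d) := by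
    rw [← h2, ← h4, ← Finset.sum_add_distrib, Finset.mul_sum]
    refine Finset.sum_congr rfl fun ν _ => ?_
    rw [← Finset.sum_add_distrib, Finset.mul_sum]
    exact Finset.sum_congr rfl fun η _ => by ring
  rw [h7, eigen]
  ring

/-- The topological vertex over an arbitrary field, with `t = q^{1/2}`. -/
noncomputable def genVertex (t : K) (a b c : YoungDiagram) : K :=
  t ^ kappa c * schur (rhoPowerSum t ⊥) b * legSum t b a c.transpose

theorem legSum_transpose (t : K) (b a d : YoungDiagram) :
    legSum t b.transpose a d = legSum t b d a := by
  rw [legSum, legSum, YoungDiagram.transpose_transpose, pairing_comm]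

/-- This symmetry converts each box recursion into a weighted one for the reversed legs. -/
theorem genVertex_transpose {t : K} (ht : GenericParam t) (a b c : YoungDiagram) :
    genVertex t a b c = t ^ (kappa a + kappa b + kappa c) *
      genVertex t c.transpose b.transpose a.transpose := by
  have ht0 := ht.ne_zero
  rw [genVertex, genVertex, legSum_transpose, YoungDiagram.transpose_transpose,
    schur_rho_transpose ht b, kappa_transpose, zpow_add₀ ht0, zpow_add₀ ht0, zpow_neg]
  have := zpow_ne_zero (kappa a) ht0
  field_simp

theorem sum_ups_genVertex_left {t : K} (ht : t ≠ 0) (a b c : YoungDiagram) :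
    ∑ a' ∈ ups a, genVertex t a' b c = rhoPowerSum t b.transpose 1 * genVertex t a b c +
      ∑ c' ∈ downs c, t ^ (kappa c - kappa c') * genVertex t a b c' := by
  simp only [genVertex]
  rw [← Finset.mul_sum]
  have h1 := sum_ups_pairing (rhoPowerSum t b.transpose) (rhoPowerSum t b) a c.transpose
  rw [sum_downs_transpose] at h1
  have h2 : ∑ a' ∈ ups a, legSum t b a' c.transpose =
    rhoPowerSum t b.transpose 1 * legSum t b a c.transpose +
      ∑ c' ∈ downs c, legSum t b a c'.transpose := h1
  rw [h2, mul_add, Finset.mul_sum]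
  congr 1
  · ring
  · refine Finset.sum_congr rfl fun c' _ => ?_
    rw [zpow_sub₀ ht]
    have := zpow_ne_zero (kappa c') ht
    field_simp

theorem sum_ups_genVertex_middle {t : K} (ht : GenericParam t) (a b c : YoungDiagram) :
    ∑ b' ∈ ups b, genVertex t a b' c = rhoPowerSum t c.transpose 1 * genVertex t a b c +
      ∑ a' ∈ downs a, t ^ (kappa a - kappa a') * genVertex t a' b c := by
  simp only [genVertex, mul_assoc]
  rw [← Finset.mul_sum, sum_ups_schur_mul_legSum ht, mul_add, mul_add, Finset.mul_sum,
    Finset.mul_sum]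
  congr 1
  · ring
  · exact Finset.sum_congr rfl fun a' _ => by ring

theorem sum_ups_genVertex_middle_weighted {t : K} (ht : GenericParam t) (a b c : YoungDiagram) :
    ∑ b' ∈ ups b, t ^ (kappa b - kappa b') * genVertex t a b' c =
      rhoPowerSum t a 1 * genVertex t a b c + ∑ c' ∈ downs c, genVertex t a b c' := by
  have ht0 := ht.ne_zero
  have h := sum_ups_genVertex_middle ht c.transpose b.transpose a.transpose
  rw [sum_ups_transpose, sum_downs_transpose, YoungDiagram.transpose_transpose] at h
  simp only [genVertex_transpose ht a]
  have h1 : ∀ b', t ^ (kappa b - kappa b') * (t ^ (kappa a + kappa b' + kappa c) *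
      genVertex t c.transpose b'.transpose a.transpose) =
      t ^ (kappa a + kappa b + kappa c) * genVertex t c.transpose b'.transpose a.transpose := by
    intro b'
    rw [← mul_assoc, ← zpow_add₀ ht0]; congr 2; ring
  have h2 : ∀ c', t ^ (kappa a + kappa b + kappa c') *
      genVertex t c'.transpose b.transpose a.transpose = t ^ (kappa a + kappa b + kappa c) *
      (t ^ (kappa c.transpose - kappa c'.transpose) *
        genVertex t c'.transpose b.transpose a.transpose) := by
    intro c'
    rw [← mul_assoc, ← zpow_add₀ ht0, kappa_transpose, kappa_transpose]; congr 2; ring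
  simp only [h1, h2]
  rw [← Finset.mul_sum, ← Finset.mul_sum, h, sub_self, zpow_zero]
  ring

theorem sum_ups_genVertex_right_weighted {t : K} (ht : GenericParam t) (a b c : YoungDiagram) :
    ∑ c' ∈ ups c, t ^ (kappa c - kappa c') * genVertex t a b c' =
      rhoPowerSum t b 1 * genVertex t a b c + ∑ a' ∈ downs a, genVertex t a' b c := by
  have ht0 := ht.ne_zero
  have h := sum_ups_genVertex_left ht0 c.transpose b.transpose a.transpose
  rw [sum_ups_transpose, sum_downs_transpose, YoungDiagram.transpose_transpose] at h
  simp only [genVertex_transpose ht _ b]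
  have h1 : ∀ c', t ^ (kappa c - kappa c') * (t ^ (kappa a + kappa b + kappa c') *
      genVertex t c'.transpose b.transpose a.transpose) =
      t ^ (kappa a + kappa b + kappa c) * genVertex t c'.transpose b.transpose a.transpose := by
    intro c'
    rw [← mul_assoc, ← zpow_add₀ ht0]; congr 2; ring
  have h2 : ∀ a', t ^ (kappa a' + kappa b + kappa c) *
      genVertex t c.transpose b.transpose a'.transpose = t ^ (kappa a + kappa b + kappa c) *
      (t ^ (kappa a.transpose - kappa a'.transpose) *
        genVertex t c.transpose b.transpose a'.transpose) := by
    intro a'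
    rw [← mul_assoc, ← zpow_add₀ ht0, kappa_transpose, kappa_transpose]; congr 2; ring
  simp only [h1, h2]
  rw [← Finset.mul_sum, ← Finset.mul_sum, h, sub_self, zpow_zero]
  ring

theorem schur_bot (p : ℕ → K) : schur p ⊥ = 1 := skewSchur_self p ⊥

theorem below_bot : below ⊥ = {⊥} := by
  ext μ; rw [mem_below, le_bot_iff, Finset.mem_singleton]

theorem pairing_bot_left (x y : ℕ → K) (d : YoungDiagram) : pairing x y ⊥ d = schur y d := by
  rw [pairing, below_bot, Finset.sum_singleton, skewSchur_self, one_mul, schur]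

theorem pairing_bot_right (x y : ℕ → K) (a : YoungDiagram) : pairing x y a ⊥ = schur x a := by
  rw [pairing_comm, pairing_bot_left]

/-- `sum_ups_skewSchur_rho` moves the new box of cᵗ to the inner partition. Exchanging the order of
the two inner shapes brings in the recursion `rho_sub_mul_skewSchur_rho` for a, and the eigenvalues
of the inner shape cancel. -/
theorem sum_ups_genVertex_bot_right {t : K} (ht : GenericParam t) (a c : YoungDiagram) :
    ∑ c' ∈ ups c, genVertex t a ⊥ c' = rhoPowerSum t a.transpose 1 * genVertex t a ⊥ c := by
  have ht0 := ht.ne_zero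
  set Y := rhoPowerSum t ⊥ with hY
  have hleg : ∀ d, legSum t ⊥ a d = ∑ ν ∈ below a, skewSchur Y a ν * skewSchur Y d ν := by
    intro d; rw [legSum, pairing, transpose_bot]
  simp only [genVertex, ← hY, schur_bot, mul_one, hleg]
  have h1 : ∑ c' ∈ ups c, t ^ kappa c' *
      ∑ ν ∈ below a, skewSchur Y a ν * skewSchur Y c'.transpose ν = t ^ kappa c *
      ∑ ν ∈ below a, skewSchur Y a ν * ∑ d' ∈ ups c.transpose,
        t ^ (kappa c.transpose - kappa d') * skewSchur Y d' ν := by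
    simp only [Finset.mul_sum, sum_ups_transpose]
    rw [Finset.sum_comm]
    refine Finset.sum_congr rfl fun ν _ => Finset.sum_congr rfl fun c' _ => ?_
    have : t ^ kappa c' = t ^ kappa c * t ^ (kappa c.transpose - kappa c'.transpose) := by
      rw [← zpow_add₀ ht0, kappa_transpose, kappa_transpose]; congr 1; ring
    rw [this]; ring
  rw [h1, mul_left_comm]
  congr 1
  simp only [hY, sum_ups_skewSchur_rho ht]
  rw [← hY]
  have h2 : ∑ ν ∈ below a, skewSchur Y a ν *
      ∑ σ ∈ downs ν, t ^ (kappa σ - kappa ν) * skewSchur Y c.transpose σ =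
      ∑ σ ∈ below a, skewSchur Y c.transpose σ *
        ∑ ν ∈ ups σ, t ^ (kappa σ - kappa ν) * skewSchur Y a ν := by
    simp only [Finset.mul_sum]
    rw [Finset.sum_sigma', Finset.sum_sigma']
    refine Finset.sum_bij_ne_zero (fun p _ _ => ⟨p.2, p.1⟩) ?_ ?_ ?_ ?_
    · rintro ⟨μ, μ'⟩ h _
      simp only [Finset.mem_sigma, mem_below, mem_downs, mem_ups] at h ⊢
      exact ⟨h.2.1.trans h.1, h.2⟩
    · rintro ⟨μ, μ'⟩ _ _ ⟨ν, ν'⟩ _ _ h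
      simp only [Sigma.mk.injEq, heq_eq_eq] at h ⊢
      exact ⟨h.2, h.1⟩
    · rintro ⟨μ, μ'⟩ h hne
      simp only [Finset.mem_sigma, mem_below, mem_ups] at h
      have hle : μ' ≤ a := by
        by_contra hle
        exact hne (by rw [skewSchur_of_not_le Y hle, mul_zero, mul_zero])
      refine ⟨⟨μ', μ⟩, ?_, ?_, rfl⟩
      · simp only [Finset.mem_sigma, mem_below, mem_downs]
        exact ⟨hle, h.2⟩
      · intro h0; apply hne; rw [← h0]; ring
    · rintro ⟨μ, μ'⟩ _ _
      ring
  simp only [mul_add]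
  rw [Finset.sum_add_distrib, h2, ← Finset.sum_add_distrib, Finset.mul_sum]
  refine Finset.sum_congr rfl fun ν _ => ?_
  rw [← rho_sub_mul_skewSchur_rho ht a ν]
  ring

/-- The start of the induction for `genVertex_cyclic`. At a = ∅ it is the conjugation rule for
s_c(q^ρ). -/
theorem genVertex_bot_middle {t : K} (ht : GenericParam t) (a c : YoungDiagram) :
    genVertex t a ⊥ c = genVertex t c a ⊥ := by
  rw [← sub_eq_zero]
  refine eq_zero_of_recursions_two ht (fun a c => genVertex t a ⊥ c - genVertex t c a ⊥)
    (rhoPowerSum t ⊥ 1) (fun c c' => t ^ (kappa c - kappa c')) ?_ ?_ ?_ a c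
  · intro c
    simp only [genVertex, legSum, pairing_bot_left, schur_bot, transpose_bot, pairing_bot_right,
      kappa_bot, zpow_zero, one_mul, mul_one]
    rw [← schur_rho_transpose ht, sub_self]
  · intro a c
    rw [Finset.sum_sub_distrib, sum_ups_genVertex_bot_right ht, sum_ups_genVertex_left ht.ne_zero,
      downs_bot, Finset.sum_empty]
    ring
  · intro a c
    rw [Finset.sum_sub_distrib, sum_ups_genVertex_left ht.ne_zero, sum_ups_genVertex_middle ht,
      transpose_bot]
    simp only [mul_sub, Finset.sum_sub_distrib]
    ring

/-- The cyclic symmetry of the topological vertex. -/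
theorem genVertex_cyclic {t : K} (ht : GenericParam t) (a b c : YoungDiagram) :
    genVertex t a b c = genVertex t c a b := by
  rw [← sub_eq_zero]
  refine eq_zero_of_recursions_three ht (fun a b c => genVertex t a b c - genVertex t c a b)
    (fun a => rhoPowerSum t a 1) (fun c c' => t ^ (kappa c - kappa c')) ?_ ?_ ?_ b a c
  · intro a c
    rw [genVertex_bot_middle ht, sub_self]
  · intro a b c
    rw [Finset.sum_sub_distrib, sum_ups_genVertex_left ht.ne_zero, sum_ups_genVertex_middle ht]
    simp only [mul_sub, Finset.sum_sub_distrib]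
    ring
  · intro a b c
    simp only [mul_sub, Finset.sum_sub_distrib]
    rw [sum_ups_genVertex_middle_weighted ht, sum_ups_genVertex_right_weighted ht]
    ring

end Vertex

end TopVertex

namespace TopVertex

/-! ### The gluing formula. -/

section Cauchy

variable {K : Type*} [Field K] [Algebra ℚ K]

/-- In `skewSchur_transpose`, one sign of (-1)^{k+1} negates the alphabet and the others scale it by
-1. -/
theorem skewSchur_neg_transpose (p : ℕ → K) (l m : YoungDiagram) :
    skewSchur p l.transpose m.transpose =
      (-1) ^ (l.card - m.card) * skewSchur (fun k => -p k) l m := by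
  rw [skewSchur_transpose, ← skewSchur_scale]
  refine skewSchur_congr_powerSum (fun k _ => ?_) _ _
  ring

theorem skewSchur_add_X_mul (p p' : ℕ → K) (l m : YoungDiagram) :
    skewSchur (fun k => PowerSeries.C (p k) + PowerSeries.X ^ k * PowerSeries.C (p' k)) l m =
      ∑ ν ∈ below l, PowerSeries.C (skewSchur p l ν * skewSchur p' ν m) *
        PowerSeries.X ^ (ν.card - m.card) := by
  rw [skewSchur_add (fun k => PowerSeries.C (p k))
    (fun k => PowerSeries.X ^ k * PowerSeries.C (p' k))]
  refine Finset.sum_congr rfl fun ν _ => ?_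
  rw [skewSchur_scale PowerSeries.X (fun k => PowerSeries.C (p' k)), ← map_skewSchur,
    ← map_skewSchur, map_mul]
  ring

theorem coeff_mk_mul_X_pow (p : ℕ → K) (n e : ℕ) :
    PowerSeries.coeff n (PowerSeries.mk (completeH p) * PowerSeries.X ^ e) =
      completeHInt p ((n : ℤ) - e) := by
  rw [PowerSeries.coeff_mul_X_pow']
  split_ifs with h
  · rw [PowerSeries.coeff_mk, ← Nat.cast_sub h, completeHInt_natCast]
  · rw [completeHInt_of_neg _ (by omega)]

/-- The gluing formula: a dual skew Cauchy identity with two outer partitions. -/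
theorem mk_sum_pairing_mul_pairing (x y x' y' : ℕ → K) (u v : YoungDiagram) :
    PowerSeries.mk (fun n => ∑ μ ∈ parts n, (-1) ^ n * pairing x y u μ *
      pairing x' y' v μ.transpose) =
    PowerSeries.mk (completeH fun k => -(y k * y' k)) * ∑ τ ∈ below u,
      (-PowerSeries.X) ^ τ.card *
      skewSchur (fun k => PowerSeries.C (x' k) + PowerSeries.X ^ k * PowerSeries.C (-y k))
        v τ.transpose *
      skewSchur (fun k => PowerSeries.C (x k) + PowerSeries.X ^ k * PowerSeries.C (-y' k)) u τ := by
  classical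
  ext n
  set h := fun k => -(y k * y' k) with hh
  have hL : PowerSeries.coeff n (PowerSeries.mk (fun n => ∑ μ ∈ parts n, (-1) ^ n *
      pairing x y u μ * pairing x' y' v μ.transpose)) = ∑ η ∈ below u, ∑ ξ ∈ below v,
      ∑ τ ∈ below u, (-1) ^ τ.card * (completeHInt h ((n : ℤ) - η.card - ξ.card + τ.card) *
        (skewSchur x u η * skewSchur x' v ξ * (skewSchur (fun k => -y k) ξ τ.transpose *
          skewSchur (fun k => -y' k) η τ))) := by
    rw [PowerSeries.coeff_mk]
    -- Conjugating the factor with μᵗ replaces y' by -y' and turns the sign (-1)^n into (-1)^{|ξ|},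
    -- so the sum over μ becomes an ordinary skew Cauchy sum.
    have h1 : ∀ μ ∈ parts n, (-1) ^ n * pairing x y u μ * pairing x' y' v μ.transpose =
        ∑ η ∈ below u, ∑ ξ ∈ below v, skewSchur x u η * skewSchur x' v ξ * ((-1) ^ ξ.card *
          (skewSchur y μ η * skewSchur (fun k => -y' k) μ ξ.transpose)) := by
      intro μ hμ
      rw [pairing, pairing, mul_assoc, Finset.sum_mul_sum, Finset.mul_sum]
      refine Finset.sum_congr rfl fun η _ => ?_
      rw [Finset.mul_sum]
      refine Finset.sum_congr rfl fun ξ _ => ?_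
      have h2 := skewSchur_neg_transpose y' μ ξ.transpose
      rw [YoungDiagram.transpose_transpose, card_transpose, mem_parts.1 hμ] at h2
      rw [h2]
      by_cases hle : ξ.transpose ≤ μ
      · have hc := card_mono hle
        rw [card_transpose, mem_parts.1 hμ] at hc
        have h3 : (-1 : K) ^ n * (-1) ^ (n - ξ.card) = (-1) ^ ξ.card := by
          rw [← pow_add, show n + (n - ξ.card) = 2 * (n - ξ.card) + ξ.card by omega, pow_add,
            pow_mul, neg_one_sq, one_pow, one_mul]
        rw [← h3]; ring
      · rw [skewSchur_of_not_le _ hle]; ring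
    rw [Finset.sum_congr rfl h1, Finset.sum_comm]
    refine Finset.sum_congr rfl fun η hη => ?_
    rw [Finset.sum_comm]
    refine Finset.sum_congr rfl fun ξ _ => ?_
    rw [← Finset.mul_sum, ← Finset.mul_sum, skewCauchy]
    -- Conjugating back turns the sign into (-1)^{|τ|} and the alphabet y into -y.
    have h4 : ∀ τ, (-1 : K) ^ ξ.card * skewSchur y ξ.transpose τ =
        (-1) ^ τ.card * skewSchur (fun k => -y k) ξ τ.transpose := by
      intro τ
      have h2 := skewSchur_neg_transpose y ξ τ.transpose
      rw [YoungDiagram.transpose_transpose, card_transpose] at h2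
      rw [h2]
      by_cases hle : τ.transpose ≤ ξ
      · have hc := card_mono hle
        rw [card_transpose] at hc
        rw [← mul_assoc, ← pow_add, show ξ.card + (ξ.card - τ.card) =
          2 * (ξ.card - τ.card) + τ.card by omega, pow_add, pow_mul, neg_one_sq, one_pow, one_mul]
      · rw [skewSchur_of_not_le _ hle]; ring
    have hcongr : ∀ m, completeHInt (fun k => y k * -y' k) m = completeHInt h m := fun m =>
      completeHInt_congr (fun k _ => by rw [hh]; ring) m
    rw [Finset.mul_sum, Finset.mul_sum]
    refine Finset.sum_subset_zero_on_sdiff (below_mono (mem_below.1 hη)) ?_ ?_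
    · intro τ hτ
      rw [Finset.mem_sdiff, mem_below, mem_below] at hτ
      rw [skewSchur_of_not_le (fun k => -y' k) hτ.2]; ring
    · intro τ _
      rw [hcongr, card_transpose]
      linear_combination (completeHInt h ((n : ℤ) - η.card - ξ.card + τ.card) * skewSchur x u η *
        skewSchur x' v ξ * skewSchur (fun k => -y' k) η τ) * h4 τ
  rw [hL]
  simp only [skewSchur_add_X_mul]
  rw [Finset.mul_sum, map_sum]
  -- The powers of X add up to |τ| + (|ξ| - |τ|) + (|η| - |τ|), which is the shift in the index of
  -- h.
  have hR : ∀ τ ∈ below u, PowerSeries.coeff n (PowerSeries.mk (completeH h) *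
      ((-PowerSeries.X) ^ τ.card *
      (∑ ξ ∈ below v, PowerSeries.C (skewSchur x' v ξ * skewSchur (fun k => -y k) ξ τ.transpose) *
        PowerSeries.X ^ (ξ.card - τ.transpose.card)) *
      ∑ η ∈ below u, PowerSeries.C (skewSchur x u η * skewSchur (fun k => -y' k) η τ) *
        PowerSeries.X ^ (η.card - τ.card))) = ∑ η ∈ below u, ∑ ξ ∈ below v,
      (-1) ^ τ.card * (completeHInt h ((n : ℤ) - η.card - ξ.card + τ.card) *
        (skewSchur x u η * skewSchur x' v ξ * (skewSchur (fun k => -y k) ξ τ.transpose *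
          skewSchur (fun k => -y' k) η τ))) := by
    intro τ _
    rw [mul_assoc ((-PowerSeries.X) ^ τ.card), Finset.sum_mul_sum, Finset.sum_comm,
      Finset.mul_sum, Finset.mul_sum, map_sum]
    refine Finset.sum_congr rfl fun η _ => ?_
    rw [Finset.mul_sum, Finset.mul_sum, map_sum]
    refine Finset.sum_congr rfl fun ξ _ => ?_
    by_cases hle : τ.transpose ≤ ξ ∧ τ ≤ η
    · have c1 := card_mono hle.1
      have c2 := card_mono hle.2
      rw [card_transpose] at c1
      rw [show PowerSeries.mk (completeH h) * ((-PowerSeries.X) ^ τ.card *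
        (PowerSeries.C (skewSchur x' v ξ * skewSchur (fun k => -y k) ξ τ.transpose) *
        PowerSeries.X ^ (ξ.card - τ.transpose.card) *
        (PowerSeries.C (skewSchur x u η * skewSchur (fun k => -y' k) η τ) *
        PowerSeries.X ^ (η.card - τ.card)))) =
        PowerSeries.C ((-1) ^ τ.card * (skewSchur x' v ξ * skewSchur (fun k => -y k) ξ τ.transpose) *
          (skewSchur x u η * skewSchur (fun k => -y' k) η τ)) *
        (PowerSeries.mk (completeH h) * PowerSeries.X ^ (τ.card + (ξ.card - τ.card) +
          (η.card - τ.card))) by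
          rw [card_transpose, neg_pow PowerSeries.X]
          simp only [map_mul, map_pow, map_neg, map_one, pow_add]
          ring, PowerSeries.coeff_C_mul, coeff_mk_mul_X_pow,
        show (n : ℤ) - ((τ.card + (ξ.card - τ.card) + (η.card - τ.card) : ℕ) : ℤ) =
          (n : ℤ) - η.card - ξ.card + τ.card by omega]
      ring
    · rcases not_and_or.1 hle with h5 | h5 <;> rw [skewSchur_of_not_le _ h5] <;> simp
  rw [Finset.sum_congr rfl hR, Finset.sum_comm (s := below u) (t := below u)]
  refine Finset.sum_congr rfl fun η _ => ?_
  rw [Finset.sum_comm]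

end Cauchy

end TopVertex

namespace TopVertex

/-! ### The exponents C_k: nonnegativity, total, and the conifold factor. -/

section Exponents

open LaurentPolynomial

theorem coeff_T (m k : ℤ) : (T m : LaurentPolynomial ℤ).coeff k = if m = k then 1 else 0 := by
  rw [T, AddMonoidAlgebra.coeff_single, Finsupp.single_apply]

/-- `∑_{i < n} q^{μ_i - i - 1}`. -/
noncomputable def rowPoly (μ : YoungDiagram) (n : ℕ) : LaurentPolynomial ℤ :=
  ∑ i ∈ Finset.range n, T ((μ.rowLen i : ℤ) - i - 1)

theorem fPoly_eq_sum (μ : YoungDiagram) {n : ℕ} (h : μ.colLen 0 ≤ n) :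
    fPoly μ = ∑ i ∈ Finset.range n, ∑ j ∈ Finset.range (μ.rowLen i), T ((j : ℤ) - (i : ℤ)) := by
  rw [fPoly]
  apply Finset.sum_subset (Finset.range_mono h)
  intro i _ hi
  rw [rowLen_eq_zero (by simpa using hi), Finset.range_zero, Finset.sum_empty]

theorem T_one_sub_one_mul_rowPoly_bot (n : ℕ) :
    (T 1 - 1) * rowPoly ⊥ n = 1 - T (-(n : ℤ)) := by
  rw [rowPoly, Finset.mul_sum]
  have h : ∀ i ∈ Finset.range n, (T 1 - 1) * (T (((⊥ : YoungDiagram).rowLen i : ℤ) - i - 1) :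
      LaurentPolynomial ℤ) = T (-(i : ℤ)) - T (-((i + 1 : ℕ) : ℤ)) := by
    intro i _
    rw [rowLen_bot, sub_mul, one_mul, ← T_add]
    congr 2 <;> push_cast <;> ring
  rw [Finset.sum_congr rfl h, Finset.sum_range_sub']
  simp

theorem T_one_mul_rowPoly (μ : YoungDiagram) {n : ℕ} (h : μ.colLen 0 ≤ n) :
    T 1 * rowPoly μ n = T 1 * rowPoly ⊥ n + (T 1 - 1) * fPoly μ := by
  rw [fPoly_eq_sum μ h, rowPoly, rowPoly, Finset.mul_sum, Finset.mul_sum, Finset.mul_sum,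
    ← Finset.sum_add_distrib]
  refine Finset.sum_congr rfl fun i _ => ?_
  rw [rowLen_bot]
  generalize μ.rowLen i = m
  induction m with
  | zero => rw [Finset.range_zero, Finset.sum_empty, mul_zero, add_zero]
  | succ m ih =>
    have h1 : T 1 * (T (((m + 1 : ℕ) : ℤ) - i - 1) : LaurentPolynomial ℤ) =
        T 1 * T ((m : ℤ) - i - 1) + (T 1 - 1) * T ((m : ℤ) - i) := by
      rw [sub_mul, one_mul, ← T_add, ← T_add, ← T_add]
      rw [show (1 : ℤ) + ((m : ℤ) - i - 1) = (m : ℤ) - i by ring,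
        show (1 : ℤ) + (((m + 1 : ℕ) : ℤ) - i - 1) = 1 + ((m : ℤ) - i) by push_cast; ring]
      ring
    rw [h1, ih, Finset.sum_range_succ, mul_add, add_assoc]

/-- Nonnegativity of the coefficients becomes a count: pairs of rows of (μ, ν) against pairs of rows
of (∅, ∅). The correction terms have nonnegative coefficients. -/
theorem fPair_eq (μ ν : YoungDiagram) {n m : ℕ} (hn : μ.colLen 0 ≤ n) (hm : ν.colLen 0 ≤ m) :
    fPair μ ν = T 1 * (rowPoly μ n * rowPoly ν m) - T 1 * (rowPoly ⊥ n * rowPoly ⊥ m) +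
      T (-(m : ℤ)) * fPoly μ + T (-(n : ℤ)) * fPoly ν := by
  have h1 := T_one_mul_rowPoly μ hn
  have h2 := T_one_mul_rowPoly ν hm
  have h3 := T_one_sub_one_mul_rowPoly_bot n
  have h4 := T_one_sub_one_mul_rowPoly_bot m
  have hT : (T 1 : LaurentPolynomial ℤ) * T (-1) = 1 := by rw [← T_add]; simp
  rw [fPair]
  set a := rowPoly μ n
  set b := rowPoly ν m
  set a0 := rowPoly ⊥ n
  set b0 := rowPoly ⊥ m
  set q := (T 1 : LaurentPolynomial ℤ)
  set q' := (T (-1) : LaurentPolynomial ℤ)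
  have h5 : q * (a * b) = q' * ((q * a0 + (q - 1) * fPoly μ) * (q * b0 + (q - 1) * fPoly ν)) := by
    rw [← h1, ← h2]; linear_combination (-q * a * b) * hT
  rw [h5]
  linear_combination (fPoly μ * fPoly ν * (2 - q) - q * a0 * b0 - (q - 1) * a0 * fPoly ν -
    (q - 1) * b0 * fPoly μ) * hT - fPoly ν * h3 - fPoly μ * h4

theorem coeff_T_mul_rowPoly_mul_rowPoly (μ ν : YoungDiagram) (n m : ℕ) (k : ℤ) :
    (T 1 * (rowPoly μ n * rowPoly ν m)).coeff k =
      (((Finset.range n ×ˢ Finset.range m).filter fun p =>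
        (μ.rowLen p.1 : ℤ) - p.1 + ((ν.rowLen p.2 : ℤ) - p.2) - 1 = k).card : ℤ) := by
  rw [rowPoly, rowPoly, Finset.sum_mul_sum, Finset.mul_sum, Finset.card_filter,
    Finset.sum_product, AddMonoidAlgebra.coeff_sum, Finsupp.finsetSum_apply]
  push_cast
  refine Finset.sum_congr rfl fun i _ => ?_
  rw [Finset.mul_sum, AddMonoidAlgebra.coeff_sum, Finsupp.finsetSum_apply]
  refine Finset.sum_congr rfl fun j _ => ?_
  rw [← T_add, ← T_add, coeff_T]
  congr 1
  apply propext
  constructor <;> intro h <;> linarith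

theorem coeff_T_mul_fPoly_nonneg (μ : YoungDiagram) (e k : ℤ) : 0 ≤ (T e * fPoly μ).coeff k := by
  rw [fPoly, Finset.mul_sum, AddMonoidAlgebra.coeff_sum, Finsupp.finsetSum_apply]
  refine Finset.sum_nonneg fun i _ => ?_
  rw [Finset.mul_sum, AddMonoidAlgebra.coeff_sum, Finsupp.finsetSum_apply]
  refine Finset.sum_nonneg fun j _ => ?_
  rw [← T_add, coeff_T]
  split_ifs <;> norm_num

/-- For `k < 0` there are at least as many pairs with `μ_i + ν_j - i - j = k` as for the empty
partitions. -/
theorem le_card_filter_rowLen (μ ν : YoungDiagram) (s N N' : ℕ)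
    (h1 : s + ν.rowLen 0 ≤ N) (h2 : s + μ.rowLen 0 ≤ N') :
    s + 1 ≤ ((Finset.range (N + 1) ×ˢ Finset.range (N' + 1)).filter fun p =>
        (μ.rowLen p.1 : ℤ) - p.1 + ((ν.rowLen p.2 : ℤ) - p.2) - 1 = -1 - (s : ℤ)).card := by
  -- Solutions correspond to I ∩ J. The sets have N + 1 and N' + 1 elements in an interval of N + N'
  -- - s + 1 integers, so at least s + 1 elements are common.
  set I := (Finset.range (N + 1)).image fun i => (μ.rowLen i : ℤ) - i with hI
  set J := (Finset.range (N' + 1)).image fun j => -(s : ℤ) - ((ν.rowLen j : ℤ) - j) with hJ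
  have hinj : ∀ (ξ : YoungDiagram) {i j : ℕ}, (ξ.rowLen i : ℤ) - i = (ξ.rowLen j : ℤ) - j →
      i = j := by
    intro ξ i j h
    rcases lt_trichotomy i j with h3 | h3 | h3
    · have := ξ.rowLen_anti i j h3.le; omega
    · exact h3
    · have := ξ.rowLen_anti j i h3.le; omega
  have hIc : I.card = N + 1 := by
    rw [hI, Finset.card_image_of_injective _ fun i j h => hinj μ h, Finset.card_range]
  have hJc : J.card = N' + 1 := by
    rw [hJ, Finset.card_image_of_injective _ fun i j h => hinj ν (by omega),
      Finset.card_range]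
  have hsub : I ∪ J ⊆ Finset.Icc (-(N : ℤ)) ((N' : ℤ) - s) := by
    intro x hx
    rw [Finset.mem_union, hI, hJ, Finset.mem_image, Finset.mem_image] at hx
    rw [Finset.mem_Icc]
    rcases hx with ⟨i, hi, rfl⟩ | ⟨j, hj, rfl⟩
    · have := Finset.mem_range.1 hi
      have := μ.rowLen_anti 0 i (Nat.zero_le _)
      omega
    · have := Finset.mem_range.1 hj
      have := ν.rowLen_anti 0 j (Nat.zero_le _)
      omega
  have hcard := Finset.card_le_card hsub
  rw [Int.card_Icc] at hcard
  have hui := Finset.card_union_add_card_inter I J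
  have hle : (I ∩ J).card ≤ ((Finset.range (N + 1) ×ˢ Finset.range (N' + 1)).filter fun p =>
        (μ.rowLen p.1 : ℤ) - p.1 + ((ν.rowLen p.2 : ℤ) - p.2) - 1 = -1 - (s : ℤ)).card := by
    refine Finset.card_le_card_of_surjOn (fun p => (μ.rowLen p.1 : ℤ) - p.1) ?_
    intro x hx
    rw [Finset.mem_coe, Finset.mem_inter, hI, hJ, Finset.mem_image, Finset.mem_image] at hx
    obtain ⟨⟨i, hi, rfl⟩, ⟨j, hj, hij⟩⟩ := hx
    refine ⟨(i, j), ?_, rfl⟩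
    rw [Finset.mem_coe, Finset.mem_filter, Finset.mem_product]
    exact ⟨⟨hi, hj⟩, by simp only; omega⟩
  omega

/-- The empty pair has no solution for k ≥ 0 and at most s + 1 for k = -1 - s, namely those with i +
j = s; `le_card_filter_rowLen` finds as many for (μ, ν). -/
theorem Ccoeff_nonneg (μ ν : YoungDiagram) (k : ℤ) : 0 ≤ Ccoeff μ ν k := by
  obtain ⟨s, hs⟩ : ∃ s : ℕ, 0 ≤ k ∨ k = -1 - (s : ℤ) := ⟨(-1 - k).toNat, by omega⟩
  set N := μ.colLen 0 + (s + ν.rowLen 0) with hN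
  set N' := ν.colLen 0 + (s + μ.rowLen 0) with hN'
  rw [Ccoeff, fPair_eq μ ν (n := N + 1) (m := N' + 1) (by omega) (by omega)]
  rw [AddMonoidAlgebra.coeff_add, AddMonoidAlgebra.coeff_add, AddMonoidAlgebra.coeff_sub,
    Finsupp.add_apply, Finsupp.add_apply, Finsupp.sub_apply]
  have h1 := coeff_T_mul_fPoly_nonneg μ (-((N' + 1 : ℕ) : ℤ)) k
  have h2 := coeff_T_mul_fPoly_nonneg ν (-((N + 1 : ℕ) : ℤ)) k
  have h3 : (T 1 * (rowPoly ⊥ (N + 1) * rowPoly ⊥ (N' + 1))).coeff k ≤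
      (T 1 * (rowPoly μ (N + 1) * rowPoly ν (N' + 1))).coeff k := by
    rw [coeff_T_mul_rowPoly_mul_rowPoly, coeff_T_mul_rowPoly_mul_rowPoly, Nat.cast_le]
    rcases hs with hs | rfl
    · rw [Finset.card_eq_zero.2]
      · exact Nat.zero_le _
      · rw [Finset.filter_eq_empty_iff]
        intro p _
        simp only [rowLen_bot]
        push_cast
        omega
    · refine le_trans ?_ (le_card_filter_rowLen μ ν s N N' (by omega) (by omega))
      rw [← Finset.card_range (s + 1)]
      refine Finset.card_le_card_of_injOn Prod.fst ?_ ?_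
      · intro p hp
        rw [Finset.mem_coe, Finset.mem_filter] at hp
        simp only [rowLen_bot] at hp
        rw [Finset.mem_coe, Finset.mem_range]
        have := hp.2
        push_cast at this
        omega
      · intro p hp p' hp' h
        rw [Finset.mem_coe, Finset.mem_filter] at hp hp'
        simp only [rowLen_bot] at hp hp'
        have e1 := hp.2
        have e2 := hp'.2
        rw [h] at e1
        exact Prod.ext h (by push_cast at e1 e2; omega)
  linarith

theorem eval₂_eq_sum {K : Type*} [CommRing K] (f : LaurentPolynomial ℤ) (u : Kˣ) :
    eval₂ (Int.castRingHom K) u f = ∑ k ∈ f.coeff.support, (f.coeff k : K) * ((u ^ k : Kˣ) : K) := by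
  conv_lhs => rw [← AddMonoidAlgebra.sum_coeff_single f]
  rw [Finsupp.sum, map_sum]
  refine Finset.sum_congr rfl fun k _ => ?_
  rw [single_eq_C_mul_T, eval₂_C_mul_T]
  simp

/-- Evaluation at q = 1, where q - 2 + q⁻¹ vanishes and f_μ becomes |μ|. -/
theorem sum_Ccoeff (μ ν : YoungDiagram) :
    ∑ k ∈ (fPair μ ν).coeff.support, Ccoeff μ ν k = μ.card + ν.card := by
  have h := eval₂_eq_sum (K := ℤ) (fPair μ ν) 1
  have hf : ∀ ξ : YoungDiagram, eval₂ (Int.castRingHom ℤ) 1 (fPoly ξ) = (ξ.card : ℤ) := by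
    intro ξ
    rw [fPoly, map_sum, card_eq_sum_rowLen ξ le_rfl]
    push_cast
    refine Finset.sum_congr rfl fun i _ => ?_
    rw [map_sum]
    simp
  simp only [one_zpow, Units.val_one, mul_one, Int.cast_id] at h
  simp only [Ccoeff]
  rw [← h, fPair]
  simp only [map_add, map_mul, map_sub, hf, eval₂_T, one_zpow, Units.val_one, map_ofNat]
  ring

variable {K : Type*} [Field K]

theorem rhoPowerSum_eq_eval {t : K} (ht : GenericParam t) (ν : YoungDiagram) {k : ℕ} (hk : 1 ≤ k) :
    rhoPowerSum t ν k = 1 / alpha t k + alpha t k * eval₂ (Int.castRingHom K)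
      (Units.mk0 ((t ^ 2) ^ k) (pow_ne_zero _ (pow_ne_zero _ ht.ne_zero))) (fPoly ν) := by
  have ht0 := ht.ne_zero
  have ha := ht.alpha_ne_zero hk
  set u : Kˣ := Units.mk0 ((t ^ 2) ^ k) (pow_ne_zero _ (pow_ne_zero _ ht.ne_zero)) with hu
  have h := congrArg (eval₂ (Int.castRingHom K) u) (sub_one_mul_fPoly ν)
  rw [map_mul, map_mul, map_sum] at h
  simp only [map_sub, map_one, eval₂_T, zpow_one] at h
  have hx : (u : K) = t ^ k * t ^ k := by rw [hu, Units.val_mk0]; ring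
  have hx0 : t ^ k ≠ 0 := pow_ne_zero _ ht0
  have hterm : ∀ i : ℕ, (u : K) * (((u ^ ((ν.rowLen i : ℤ) - ((i : ℤ) + 1)) : Kˣ) : K) -
      ((u ^ (-((i : ℤ) + 1)) : Kˣ) : K)) = t ^ k *
      ((t ^ (2 * (ν.rowLen i : ℤ) - 2 * (i : ℤ) - 1)) ^ k - (t ^ (-2 * (i : ℤ) - 1)) ^ k) := by
    intro i
    have hpow : ∀ e : ℤ, ((u ^ e : Kˣ) : K) = t ^ (2 * (k : ℤ) * e) := by
      intro e
      rw [Units.val_zpow_eq_zpow_val, hu, Units.val_mk0, ← pow_mul, ← zpow_natCast, ← zpow_mul]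
      push_cast; rfl
    have hexp : ∀ e : ℤ, t ^ k * t ^ k * t ^ (2 * (k : ℤ) * e) = t ^ k * (t ^ (2 * e + 1)) ^ k := by
      intro e
      rw [← zpow_natCast (t ^ (2 * e + 1)), ← zpow_natCast t, ← zpow_mul, ← zpow_add₀ ht0,
        ← zpow_add₀ ht0, ← zpow_add₀ ht0]
      congr 1; ring
    rw [hpow, hpow, hx, mul_sub (t ^ k * t ^ k), mul_sub (t ^ k), hexp, hexp]
    congr 4 <;> ring
  rw [Finset.mul_sum, Finset.sum_congr rfl fun i _ => hterm i, ← Finset.mul_sum, hx] at h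
  rw [rhoPowerSum]
  have h2 : alpha t k * t ^ k = t ^ k * t ^ k - 1 := by
    rw [alpha, sub_mul, inv_pow, inv_mul_cancel₀ hx0]
  have h3 : alpha t k = t ^ k - (t⁻¹) ^ k := rfl
  rw [← h3, add_comm]
  congr 1
  apply mul_left_cancel₀ hx0
  rw [← h, ← h2]; ring

/-- With [k] = `alpha t k`, the product (1/[k] + [k]f)(1/[k] + [k]g) equals 1/[k]² + f + g + [k]² f
g. Here [k]² = q^k - 2 + q^{-k}, and 1/[k]² is the conifold power sum. -/
theorem conifold_sub_eq {t : K} (ht : GenericParam t) (a b : YoungDiagram) {k : ℕ} (hk : 1 ≤ k) :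
    conifoldPowerSum (t ^ 2) k + -(rhoPowerSum t a k * rhoPowerSum t b k) =
      -∑ j ∈ (fPair a b).coeff.support, (Ccoeff a b j : K) * ((t ^ 2) ^ j) ^ k := by
  have ht0 := ht.ne_zero
  have ha := ht.alpha_ne_zero hk
  have hx0 : t ^ k ≠ 0 := pow_ne_zero _ ht0
  rw [rhoPowerSum_eq_eval ht a hk, rhoPowerSum_eq_eval ht b hk]
  set u : Kˣ := Units.mk0 ((t ^ 2) ^ k) (pow_ne_zero _ (pow_ne_zero _ ht.ne_zero)) with hu
  have h1 : ∑ j ∈ (fPair a b).coeff.support, (Ccoeff a b j : K) * ((t ^ 2) ^ j) ^ k =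
      eval₂ (Int.castRingHom K) u (fPair a b) := by
    rw [eval₂_eq_sum]
    refine Finset.sum_congr rfl fun j _ => ?_
    rw [Units.val_zpow_eq_zpow_val, hu, Units.val_mk0, Ccoeff, ← zpow_natCast, ← zpow_natCast,
      ← zpow_natCast, ← zpow_mul, ← zpow_mul, ← zpow_mul, ← zpow_mul]
    congr 2; ring
  rw [h1, fPair]
  simp only [map_add, map_mul, map_sub, eval₂_T, map_ofNat, zpow_one, zpow_neg_one,
    Units.val_inv_eq_inv_val]
  set f := eval₂ (Int.castRingHom K) u (fPoly a)
  set g := eval₂ (Int.castRingHom K) u (fPoly b)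
  have hx : (u : K) = t ^ k * t ^ k := by rw [hu, Units.val_mk0]; ring
  have h2 : alpha t k ^ 2 = (u : K) - 2 + (u : K)⁻¹ := by
    rw [hx, alpha, inv_pow]; field_simp; ring
  have h3 : conifoldPowerSum (t ^ 2) k = 1 / alpha t k ^ 2 := by
    have h4 : alpha t k * t ^ k = t ^ k * t ^ k - 1 := by
      rw [alpha, sub_mul, inv_pow, inv_mul_cancel₀ hx0]
    have h5 : (1 - (t ^ 2) ^ k) ^ 2 = alpha t k ^ 2 * (t ^ 2) ^ k := by
      rw [show (t ^ 2) ^ k = t ^ k * t ^ k by ring]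
      linear_combination (-(alpha t k * t ^ k) - (t ^ k * t ^ k - 1)) * h4
    have h6 : (t ^ 2) ^ k ≠ 0 := pow_ne_zero _ (pow_ne_zero _ ht0)
    rw [conifoldPowerSum, h5]
    field_simp
  rw [h3, ← h2]
  field_simp
  ring

variable [Algebra ℚ K]

theorem mk_completeH_neg_nat_mul_pow (x : K) (n : ℕ) :
    PowerSeries.mk (completeH fun k => -((n : K) * x ^ k)) =
      (1 - PowerSeries.X * PowerSeries.C x) ^ n := by
  have h0 : PowerSeries.mk (completeH fun _ => (0 : K)) = 1 := by
    ext n; rw [PowerSeries.coeff_mk, completeH_zero_alphabet, PowerSeries.coeff_one]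
  have h3 := mk_completeH_listAlphabet_mul [x]
  rw [show listAlphabet [x] = fun k => x ^ k by funext k; simp [listAlphabet]] at h3
  simp only [List.map_cons, List.map_nil, List.prod_cons, List.prod_nil, mul_one] at h3
  induction n with
  | zero => simp [h0]
  | succ n ih =>
    have h1 := mk_completeH_add (fun k => -(((n + 1 : ℕ) : K) * x ^ k)) (fun k => x ^ k)
    have h2 : (fun k => -(((n + 1 : ℕ) : K) * x ^ k) + x ^ k) = fun k => -((n : K) * x ^ k) := by
      funext k; push_cast; ring
    rw [h2, ih] at h1
    rw [pow_succ, h1]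
    linear_combination (-PowerSeries.mk (completeH fun k => -(((n + 1 : ℕ) : K) * x ^ k))) * h3

theorem mk_completeH_neg_sum {ι : Type*} (s : Finset ι) (c : ι → ℤ) (hc : ∀ i, 0 ≤ c i)
    (x : ι → K) : PowerSeries.mk (completeH fun k => -∑ i ∈ s, (c i : K) * x i ^ k) =
      ∏ i ∈ s, (1 - PowerSeries.X * PowerSeries.C (x i)) ^ (c i).toNat := by
  classical
  induction s using Finset.induction_on with
  | empty =>
    ext n
    simp only [Finset.sum_empty, neg_zero, Finset.prod_empty]
    rw [PowerSeries.coeff_mk, completeH_zero_alphabet, PowerSeries.coeff_one]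
  | insert i s hi ih =>
    rw [Finset.prod_insert hi, ← ih, ← mk_completeH_neg_nat_mul_pow, ← mk_completeH_add]
    congr 2
    funext k
    rw [Finset.sum_insert hi]
    have : ((c i).toNat : K) = (c i : K) := by
      conv_rhs => rw [← Int.toNat_of_nonneg (hc i)]
      rw [Int.cast_natCast]
    rw [this]
    ring

end Exponents

end TopVertex

namespace TopVertex

/-! ### Positivity at real t > 1. -/

section Positivity

variable {x : ℝ}

theorem rhoPowerSum_lt (hx : 1 < x) {μ a : YoungDiagram} (hle : μ ≤ a) (hne : μ ≠ a) :
    rhoPowerSum x μ 1 < rhoPowerSum x a 1 := by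
  have hrow := le_iff_rowLen.1 hle
  obtain ⟨i, hi⟩ : ∃ i, μ.rowLen i ≠ a.rowLen i := by
    by_contra! h
    exact hne (ext_rowLen h)
  rw [rhoPowerSum_eq_sum x (colLen_mono hle 0), rhoPowerSum_eq_sum x le_rfl]
  refine add_lt_add_left (Finset.sum_lt_sum (fun j _ => ?_) ⟨i, ?_, ?_⟩) _
  · simp only [pow_one]
    have := hrow j
    refine sub_le_sub_right (zpow_le_zpow_right₀ hx.le ?_) _
    omega
  · rw [Finset.mem_range]
    by_contra h
    have h1 := rowLen_eq_zero (not_lt.1 h)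
    have := hrow i
    omega
  · simp only [pow_one]
    have := hrow i
    refine sub_lt_sub_right (zpow_lt_zpow_right₀ hx ?_) _
    omega

theorem sub_inv_pos (hx : 1 < x) : 0 < x - x⁻¹ :=
  sub_pos.2 ((inv_lt_one_of_one_lt₀ hx).trans hx)

theorem eigen_lt (hx : 1 < x) {μ a : YoungDiagram} (hle : μ ≤ a) (hne : μ ≠ a) :
    eigen x μ < eigen x a :=
  mul_lt_mul_of_pos_left (rhoPowerSum_lt hx hle hne) (sub_inv_pos hx)

theorem genericParam_of_one_lt (hx : 1 < x) : GenericParam x := by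
  refine ⟨by positivity, fun k hk => (one_lt_pow₀ hx hk.ne').ne', fun b hb => ?_⟩
  rw [← eigen_bot (sub_inv_pos hx).ne']
  exact (eigen_lt hx bot_le hb.symm).ne'

/-- In `eigen_sub_mul_skewSchur_rho` the coefficients on the right are positive, and so is the
difference of eigenvalues when μ is strictly contained in a. -/
theorem skewSchur_rho_nonneg (hx : 1 < x) (a μ : YoungDiagram) :
    0 ≤ skewSchur (rhoPowerSum x ⊥) a μ := by
  induction hn : a.card using Nat.strong_induction_on generalizing a with
  | _ n ih =>
    by_cases hle : μ ≤ a
    swap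
    · rw [skewSchur_of_not_le _ hle]
    by_cases hne : μ = a
    · rw [hne, skewSchur_self]; exact zero_le_one
    have h := eigen_sub_mul_skewSchur_rho (genericParam_of_one_lt hx) a μ
    have h1 : 0 ≤ (x - x⁻¹) * ∑ a' ∈ downs a,
        x ^ (kappa a - kappa a') * skewSchur (rhoPowerSum x ⊥) a' μ := by
      refine mul_nonneg (sub_inv_pos hx).le (Finset.sum_nonneg fun a' ha' => mul_nonneg
        (zpow_nonneg (by linarith) _) (ih a'.card (by have := (mem_downs.1 ha').2; omega) a' rfl))
    rw [← h] at h1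
    exact nonneg_of_mul_nonneg_right h1 (sub_pos.2 (eigen_lt hx hle hne))

theorem schur_rho_pos (hx : 1 < x) (a : YoungDiagram) : 0 < schur (rhoPowerSum x ⊥) a := by
  induction hn : a.card using Nat.strong_induction_on generalizing a with
  | _ n ih =>
    by_cases hne : a = ⊥
    · rw [hne, schur_bot]; exact zero_lt_one
    have h := eigen_sub_mul_skewSchur_rho (genericParam_of_one_lt hx) a ⊥
    have h1 : 0 < (x - x⁻¹) * ∑ a' ∈ downs a,
        x ^ (kappa a - kappa a') * skewSchur (rhoPowerSum x ⊥) a' ⊥ := by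
      refine mul_pos (sub_inv_pos hx) (Finset.sum_pos (fun a' ha' => mul_pos
        (zpow_pos (by linarith) _) (ih a'.card (by have := (mem_downs.1 ha').2; omega) a' rfl)) ?_)
      obtain ⟨a', ha'⟩ := exists_covers hne
      exact ⟨a', mem_downs.2 ha'⟩
    rw [← h] at h1
    exact pos_of_mul_pos_right h1 (sub_pos.2 (eigen_lt hx bot_le (Ne.symm hne))).le

/-- The cyclic symmetry writes s_b(q^ρ) s_d(q^{b+ρ}), up to a power of t, as a sum of products of
skew Schur functions of q^ρ. These are nonnegative, and the term with empty inner partition is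
positive. -/
theorem schur_rhoPowerSum_pos (hx : 1 < x) (b d : YoungDiagram) :
    0 < schur (rhoPowerSum x b) d := by
  have hx0 : 0 < x := by linarith
  have h := genVertex_cyclic (genericParam_of_one_lt hx) ⊥ b d.transpose
  have h1 : 0 < genVertex x d.transpose ⊥ b := by
    rw [genVertex, schur_bot, mul_one, legSum, transpose_bot]
    refine mul_pos (zpow_pos hx0 _) (Finset.sum_pos' (fun μ _ => mul_nonneg
      (skewSchur_rho_nonneg hx _ _) (skewSchur_rho_nonneg hx _ _))
      ⟨⊥, mem_below.2 bot_le, mul_pos (schur_rho_pos hx _) (schur_rho_pos hx _)⟩)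
  rw [← h, genVertex, legSum, pairing_bot_left, YoungDiagram.transpose_transpose] at h1
  exact pos_of_mul_pos_right h1 (mul_pos (zpow_pos hx0 _) (schur_rho_pos hx b)).le

end Positivity

/-! ### Specialization to ℚ(q^{1/2}) and the closed formulas. -/

section Specialization

theorem map_rhoPowerSum {K L : Type*} [Field K] [Field L] (f : K →+* L) (t : K) (ν : YoungDiagram)
    (k : ℕ) : f (rhoPowerSum t ν k) = rhoPowerSum (f t) ν k := by
  simp [rhoPowerSum, map_zpow₀]

theorem GenericParam.of_map {K L : Type*} [Field K] [Field L]
    (f : K →+* L) {t : K} (h : GenericParam (f t)) : GenericParam t := by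
  refine ⟨fun h0 => h.ne_zero (by rw [h0, map_zero]), fun k hk h0 => h.pow_ne_one k hk ?_,
    fun b hb h0 => h.eigen_ne_one b hb ?_⟩
  · rw [← map_pow, h0, map_one]
  · rw [← map_one f, ← h0, eigen, eigen, map_mul, map_sub, map_inv₀, map_rhoPowerSum]

/-- Algebraic numbers are countable, so a transcendental real greater than 1 exists and embeds ℚ(t).
Genericity and nonvanishing can then be checked over ℝ. -/
theorem exists_ringHom_real : ∃ f : Kq →+* ℝ, 1 < f qHalf := by
  obtain ⟨x, hx, htr⟩ : ∃ x : ℝ, 1 < x ∧ Transcendental ℚ x := by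
    by_contra! h
    have h1 : (Set.Ioi (1 : ℝ)).Countable := (Algebraic.countable ℚ ℝ).mono fun x hx => by
      have := h x hx
      rwa [Transcendental, not_not] at this
    have h2 := h1.measure_zero MeasureTheory.volume
    rw [Real.volume_Ioi] at h2
    exact ENNReal.top_ne_zero h2
  have hinj : Function.Injective (Polynomial.aeval x : Polynomial ℚ →ₐ[ℚ] ℝ).toRingHom :=
    transcendental_iff_injective.1 htr
  refine ⟨IsFractionRing.lift hinj, ?_⟩
  rw [qHalf, ← RatFunc.algebraMap_X, IsFractionRing.lift_algebraMap]
  simpa using hx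

theorem genericParam_qHalf : GenericParam qHalf := by
  obtain ⟨f, hf⟩ := exists_ringHom_real
  exact GenericParam.of_map f (genericParam_of_one_lt hf)

theorem schur_qRho_ne_zero (b d : YoungDiagram) : schur (qRho b) d ≠ 0 := by
  obtain ⟨f, hf⟩ := exists_ringHom_real
  intro h
  have h1 := congrArg f h
  rw [map_zero, schur, map_skewSchur] at h1
  have h2 := schur_rhoPowerSum_pos hf b d
  rw [schur] at h2
  apply h2.ne'
  rw [← h1]
  congr 1
  funext k
  rw [qRho, map_rhoPowerSum]

theorem qNegRho_eq (β : YoungDiagram) (k : ℕ) : qNegRho β k = -qRho β.transpose k :=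
  rhoPowerSum_inv genericParam_qHalf.ne_zero β k

theorem vertex_eq (a b c : YoungDiagram) : vertex a b c = genVertex qHalf a b c := by
  rw [vertex, genVertex, legSum, pairing, finsum_eq_sum_of_support_subset (s := below a)]
  · rfl
  · intro μ hμ
    rw [Finset.mem_coe, mem_below]
    by_contra h
    exact hμ (mul_eq_zero_of_left (skewSchur_of_not_le _ h) _)

theorem inv_Zconifold : Zconifold⁻¹ = PowerSeries.mk (completeH (conifoldPowerSum q)) := by
  have h : PowerSeries.constantCoeff (PowerSeries.mk (completeH (conifoldPowerSum q))) ≠ 0 := by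
    rw [← PowerSeries.coeff_zero_eq_constantCoeff_apply, PowerSeries.coeff_mk, completeH_zero]
    exact one_ne_zero
  rw [Zconifold, PowerSeries.inv_eq_iff_mul_eq_one]
  · exact PowerSeries.mul_inv_cancel _ h
  · rw [PowerSeries.constantCoeff_inv]; exact inv_ne_zero h

theorem Cprod_eq_prod (a b : YoungDiagram) : Cprod a b = ∏ k ∈ (fPair a b).coeff.support,
    (1 - PowerSeries.X * PowerSeries.C (q ^ k)) ^ (Ccoeff a b k).toNat := by
  refine Finset.prod_congr rfl fun k _ => ?_
  rw [seriesZPow, if_pos (Ccoeff_nonneg a b k)]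

theorem mk_completeH_mul_inv_Zconifold (a b : YoungDiagram) :
    PowerSeries.mk (completeH fun k => -(qRho a k * qRho b k)) * Zconifold⁻¹ = Cprod a b := by
  rw [inv_Zconifold, mul_comm, ← mk_completeH_add, Cprod_eq_prod,
    ← mk_completeH_neg_sum _ _ (Ccoeff_nonneg a b)]
  ext n
  rw [PowerSeries.coeff_mk, PowerSeries.coeff_mk]
  exact completeH_congr (fun k hk => conifold_sub_eq genericParam_qHalf a b hk) n

theorem pairAlphabet_eq (α β : YoungDiagram) : pairAlphabet α β = fun k =>
    PowerSeries.C (qRho α k) + PowerSeries.X ^ k * PowerSeries.C (-qRho β.transpose k) := by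
  funext k; rw [pairAlphabet, qNegRho_eq]

/-- The rotation brings the summation partition to the first leg, so the κ factors and middle Schur
functions leave the sum. -/
theorem Z0_eq (l₁ l₂ l₃ l₄ : YoungDiagram) : Z0 l₁ l₂ l₃ l₄ =
    PowerSeries.C (qHalf ^ (kappa l₂ + kappa l₄) * schur (qRho ⊥) l₁ * schur (qRho ⊥) l₃) *
      PowerSeries.mk (fun n => ∑ μ ∈ parts n, (-1) ^ n *
        pairing (qRho l₃) (qRho l₃.transpose) l₄.transpose μ *
        pairing (qRho l₁) (qRho l₁.transpose) l₂.transpose μ.transpose) := by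
  have ht := genericParam_qHalf
  ext n
  rw [PowerSeries.coeff_C_mul, Z0, PowerSeries.coeff_mk, PowerSeries.coeff_mk, Finset.mul_sum]
  refine Finset.sum_congr rfl fun μ _ => ?_
  rw [vertex_eq, vertex_eq, genVertex_cyclic ht l₁, genVertex_cyclic ht l₃, genVertex, genVertex,
    legSum, legSum, pairing_comm, pairing_comm _ _ μ, zpow_add₀ ht.ne_zero]
  simp only [qRho]
  ring

/-- Here the rotation moves the summation partition from the middle to the third leg; the factors
from κ(μ) and κ(μᵗ) cancel. -/
theorem Z0plus_eq (l₁ l₂ l₃ l₄ : YoungDiagram) : Z0plus l₁ l₂ l₃ l₄ =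
    PowerSeries.C (schur (qRho ⊥) l₁ * schur (qRho ⊥) l₃) *
      PowerSeries.mk (fun n => ∑ μ ∈ parts n, (-1) ^ n *
        pairing (qRho l₁.transpose) (qRho l₁) l₄ μ *
        pairing (qRho l₃.transpose) (qRho l₃) l₂ μ.transpose) := by
  have ht := genericParam_qHalf
  ext n
  rw [PowerSeries.coeff_C_mul, Z0plus, PowerSeries.coeff_mk, PowerSeries.coeff_mk, Finset.mul_sum]
  refine Finset.sum_congr rfl fun μ _ => ?_
  have h : qHalf ^ kappa μ.transpose * qHalf ^ kappa μ = 1 := by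
    rw [← zpow_add₀ ht.ne_zero, kappa_transpose, neg_add_cancel, zpow_zero]
  rw [vertex_eq, vertex_eq, genVertex_cyclic ht l₁, genVertex_cyclic ht l₃, genVertex, genVertex,
    legSum, legSum, YoungDiagram.transpose_transpose]
  simp only [qRho]
  linear_combination ((-1) ^ n * schur (rhoPowerSum qHalf ⊥) l₁ * schur (rhoPowerSum qHalf ⊥) l₃ *
    pairing (rhoPowerSum qHalf l₁.transpose) (rhoPowerSum qHalf l₁) l₄ μ *
    pairing (rhoPowerSum qHalf l₃.transpose) (rhoPowerSum qHalf l₃) l₂ μ.transpose) * h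

theorem finsum_skewSchur_mul_skewSchur {A : Type*} [CommRing A] [Algebra ℚ A] (p p' : ℕ → A)
    (c : ℕ → A) (v u : YoungDiagram) :
    ∑ᶠ τ : YoungDiagram, c τ.card * skewSchur p v τ.transpose * skewSchur p' u τ =
      ∑ τ ∈ below u, c τ.card * skewSchur p v τ.transpose * skewSchur p' u τ := by
  refine finsum_eq_sum_of_support_subset _ fun τ hτ => ?_
  rw [Finset.mem_coe, mem_below]
  by_contra h
  exact hτ (mul_eq_zero_of_right _ (skewSchur_of_not_le _ h))

theorem finsum_skewSchur_mul_skewSchur_transpose {A : Type*} [CommRing A] [Algebra ℚ A]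
    (p p' : ℕ → A) (c : ℕ → A) (v u : YoungDiagram) :
    ∑ᶠ τ : YoungDiagram, c τ.card * skewSchur p v τ * skewSchur p' u τ.transpose =
      ∑ τ ∈ below u, c τ.card * skewSchur p v τ.transpose * skewSchur p' u τ := by
  rw [finsum_eq_sum_of_support_subset (s := below u.transpose), sum_below_transpose]
  · simp only [YoungDiagram.transpose_transpose, card_transpose]
  · intro τ hτ
    rw [Finset.mem_coe, mem_below]
    by_contra h
    refine hτ (mul_eq_zero_of_right _ (skewSchur_of_not_le _ fun h' => h ?_))
    rw [← YoungDiagram.transpose_le_iff, YoungDiagram.transpose_transpose]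
    exact h'

theorem Z0prime_eq (l₁ l₂ l₃ l₄ : YoungDiagram) : Z0prime l₁ l₂ l₃ l₄ =
    PowerSeries.C (qHalf ^ (kappa l₂ + kappa l₄) * schur (qRho ⊥) l₁ * schur (qRho ⊥) l₃) *
      Cprod l₁.transpose l₃.transpose *
      ∑ τ ∈ below l₄.transpose, (-PowerSeries.X) ^ τ.card *
        skewSchur (pairAlphabet l₁ l₃) l₂.transpose τ.transpose *
        skewSchur (pairAlphabet l₃ l₁) l₄.transpose τ := by
  rw [Z0prime, Z0_eq, mk_sum_pairing_mul_pairing, pairAlphabet_eq, pairAlphabet_eq,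
    ← mk_completeH_mul_inv_Zconifold]
  have h : (fun k => -(qRho l₃.transpose k * qRho l₁.transpose k)) =
      fun k => -(qRho l₁.transpose k * qRho l₃.transpose k) := by
    funext k; ring
  rw [h]
  ring

theorem Z0plusPrime_eq (l₁ l₂ l₃ l₄ : YoungDiagram) : Z0plusPrime l₁ l₂ l₃ l₄ =
    PowerSeries.C (schur (qRho ⊥) l₁ * schur (qRho ⊥) l₃) * Cprod l₁ l₃ *
      ∑ τ ∈ below l₄, (-PowerSeries.X) ^ τ.card *
        skewSchur (pairAlphabet l₃.transpose l₁.transpose) l₂ τ.transpose *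
        skewSchur (pairAlphabet l₁.transpose l₃.transpose) l₄ τ := by
  rw [Z0plusPrime, Z0plus_eq, mk_sum_pairing_mul_pairing, pairAlphabet_eq, pairAlphabet_eq,
    ← mk_completeH_mul_inv_Zconifold, YoungDiagram.transpose_transpose,
    YoungDiagram.transpose_transpose]
  ring

/-! ### Polynomiality -/

/-- The polynomial `∏_k (1 - Q q^k)^{C_k(a,b)}`. -/
noncomputable def cprodPoly (a b : YoungDiagram) : Polynomial Kq :=
  ∏ k ∈ (fPair a b).coeff.support,
    (1 - Polynomial.X * Polynomial.C (q ^ k)) ^ (Ccoeff a b k).toNat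

theorem coe_cprodPoly (a b : YoungDiagram) : (cprodPoly a b : PowerSeries Kq) = Cprod a b := by
  rw [Cprod_eq_prod, cprodPoly, ← Polynomial.coeToPowerSeries.ringHom_apply, map_prod]
  simp only [map_pow, map_sub, map_one, map_mul, Polynomial.coeToPowerSeries.ringHom_apply,
    Polynomial.coe_X, Polynomial.coe_C]

/-- Each factor has degree exactly one because q^k ≠ 0, and the exponents sum to |a| + |b|. -/
theorem degree_cprodPoly (a b : YoungDiagram) :
    (cprodPoly a b).degree = ((a.card + b.card : ℕ) : WithBot ℕ) := by
  have hq : q ≠ 0 := pow_ne_zero _ genericParam_qHalf.ne_zero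
  have h1 : ∀ k : ℤ, (1 - Polynomial.X * Polynomial.C (q ^ k)).degree = 1 := by
    intro k
    have h : (1 - Polynomial.X * Polynomial.C (q ^ k)) =
        Polynomial.C (-q ^ k) * Polynomial.X + Polynomial.C 1 := by
      rw [map_neg, map_one]; ring
    rw [h, Polynomial.degree_linear (neg_ne_zero.2 (zpow_ne_zero _ hq))]
  rw [cprodPoly, Polynomial.degree_prod]
  simp only [Polynomial.degree_pow, h1, nsmul_one]
  have h2 := sum_Ccoeff a b
  have h3 : ∑ k ∈ (fPair a b).coeff.support, (Ccoeff a b k).toNat = a.card + b.card := by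
    zify
    rw [← h2]
    exact Finset.sum_congr rfl fun k _ => Int.toNat_of_nonneg (Ccoeff_nonneg a b k)
  rw [← h3]
  push_cast
  rfl

/-- The skew Schur function of the alphabet `(x, Q y)`, as a polynomial in `Q`. -/
noncomputable def pairSchurPoly {K : Type*} [Field K] [Algebra ℚ K] (p p' : ℕ → K)
    (l m : YoungDiagram) : Polynomial K :=
  ∑ ν ∈ below l, Polynomial.C (skewSchur p l ν * skewSchur p' ν m) *
    Polynomial.X ^ (ν.card - m.card)

theorem coe_pairSchurPoly {K : Type*} [Field K] [Algebra ℚ K] (p p' : ℕ → K)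
    (l m : YoungDiagram) : (pairSchurPoly p p' l m : PowerSeries K) =
      skewSchur (fun k => PowerSeries.C (p k) + PowerSeries.X ^ k * PowerSeries.C (p' k)) l m := by
  rw [skewSchur_add_X_mul, pairSchurPoly, ← Polynomial.coeToPowerSeries.ringHom_apply, map_sum]
  simp only [map_pow, map_mul, Polynomial.coeToPowerSeries.ringHom_apply,
    Polynomial.coe_X, Polynomial.coe_C]

theorem natDegree_pairSchurPoly_le {K : Type*} [Field K] [Algebra ℚ K] (p p' : ℕ → K)
    (l m : YoungDiagram) : (pairSchurPoly p p' l m).natDegree ≤ l.card - m.card := by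
  refine Polynomial.natDegree_sum_le_of_forall_le _ _ fun ν hν => ?_
  refine (Polynomial.natDegree_C_mul_X_pow_le _ _).trans ?_
  exact Nat.sub_le_sub_right (card_mono (mem_below.1 hν)) _

theorem pairSchurPoly_of_not_le {K : Type*} [Field K] [Algebra ℚ K] (p p' : ℕ → K)
    {l m : YoungDiagram} (h : ¬ m ≤ l) : pairSchurPoly p p' l m = 0 := by
  refine Finset.sum_eq_zero fun ν hν => ?_
  rw [skewSchur_of_not_le p' fun h' => h (h'.trans (mem_below.1 hν))]
  simp

/-- Only ν = l reaches the top power of the variable. -/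
theorem coeff_card_pairSchurPoly {K : Type*} [Field K] [Algebra ℚ K] (p p' : ℕ → K)
    (l : YoungDiagram) : (pairSchurPoly p p' l ⊥).coeff l.card = schur p' l := by
  rw [pairSchurPoly, Polynomial.finsetSum_coeff, Finset.sum_eq_single l]
  · rw [card_bot, Nat.sub_zero, Polynomial.coeff_C_mul_X_pow, if_pos rfl, skewSchur_self, one_mul,
      schur]
  · intro ν hν hne
    rw [card_bot, Nat.sub_zero, Polynomial.coeff_C_mul_X_pow, if_neg]
    intro hc
    exact hne (eq_of_le_of_card (mem_below.1 hν) hc.le)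
  · intro h
    exact absurd (mem_below.2 le_rfl) h

/-- `Z₀⁺'` as a polynomial. -/
noncomputable def Z0plusPoly (l₁ l₂ l₃ l₄ : YoungDiagram) : Polynomial Kq :=
  Polynomial.C (schur (qRho ⊥) l₁ * schur (qRho ⊥) l₃) * cprodPoly l₁ l₃ *
    ∑ τ ∈ below l₄, (-Polynomial.X) ^ τ.card *
      pairSchurPoly (qRho l₃.transpose) (fun k => -qRho l₁ k) l₂ τ.transpose *
      pairSchurPoly (qRho l₁.transpose) (fun k => -qRho l₃ k) l₄ τ

theorem coe_Z0plusPoly (l₁ l₂ l₃ l₄ : YoungDiagram) :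
    (Z0plusPoly l₁ l₂ l₃ l₄ : PowerSeries Kq) = Z0plusPrime l₁ l₂ l₃ l₄ := by
  rw [Z0plusPrime_eq, Z0plusPoly, pairAlphabet_eq, pairAlphabet_eq,
    YoungDiagram.transpose_transpose, YoungDiagram.transpose_transpose,
    ← Polynomial.coeToPowerSeries.ringHom_apply, map_mul, map_mul, map_sum]
  simp only [map_pow, map_mul, map_neg, Polynomial.coeToPowerSeries.ringHom_apply,
    Polynomial.coe_X, Polynomial.coe_C, coe_cprodPoly, coe_pairSchurPoly]

theorem natDegree_Z0plusPoly_le (l₁ l₂ l₃ l₄ : YoungDiagram) :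
    (Z0plusPoly l₁ l₂ l₃ l₄).natDegree ≤ l₁.card + l₂.card + l₃.card + l₄.card := by
  have h1 : (cprodPoly l₁ l₃).natDegree = l₁.card + l₃.card :=
    Polynomial.natDegree_eq_of_degree_eq_some (degree_cprodPoly l₁ l₃)
  rw [Z0plusPoly]
  refine Polynomial.natDegree_mul_le.trans ?_
  have h2 : (Polynomial.C (schur (qRho ⊥) l₁ * schur (qRho ⊥) l₃) *
      cprodPoly l₁ l₃).natDegree ≤ l₁.card + l₃.card :=
    (Polynomial.natDegree_C_mul_le _ _).trans h1.le
  have h3 : (∑ τ ∈ below l₄, (-Polynomial.X) ^ τ.card *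
      pairSchurPoly (qRho l₃.transpose) (fun k => -qRho l₁ k) l₂ τ.transpose *
      pairSchurPoly (qRho l₁.transpose) (fun k => -qRho l₃ k) l₄ τ).natDegree ≤
      l₂.card + l₄.card := by
    refine Polynomial.natDegree_sum_le_of_forall_le _ _ fun τ hτ => ?_
    -- When τᵗ ≤ l₂ the degree is at most |τ| + (|l₂| - |τ|) + (|l₄| - |τ|) ≤ |l₂| + |l₄|. Otherwise
    -- natural subtraction would break the bound, but the term is zero.
    by_cases hle : τ.transpose ≤ l₂
    · have c1 := card_mono hle
      have c2 := card_mono (mem_below.1 hτ)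
      rw [card_transpose] at c1
      refine Polynomial.natDegree_mul_le.trans ?_
      have e1 := natDegree_pairSchurPoly_le (qRho l₁.transpose) (fun k => -qRho l₃ k) l₄ τ
      have e2 := natDegree_pairSchurPoly_le (qRho l₃.transpose) (fun k => -qRho l₁ k) l₂
        τ.transpose
      have e3 : ((-Polynomial.X : Polynomial Kq) ^ τ.card).natDegree ≤ τ.card := by
        rw [Polynomial.natDegree_pow, Polynomial.natDegree_neg, Polynomial.natDegree_X, mul_one]
      have e4 := Polynomial.natDegree_mul_le (p := (-Polynomial.X : Polynomial Kq) ^ τ.card)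
        (q := pairSchurPoly (qRho l₃.transpose) (fun k => -qRho l₁ k) l₂ τ.transpose)
      rw [card_transpose] at e2
      omega
    · rw [pairSchurPoly_of_not_le _ _ hle]; simp
  omega

/-- Only τ = ∅ remains. The Schur factor has top coefficient ±s_{l₂ᵗ}(q^{l₁+ρ}), which is nonzero,
so the degrees of the factors add up exactly. -/
theorem degree_Z0plusPoly_bot (l₁ l₂ : YoungDiagram) :
    (Z0plusPoly l₁ l₂ ⊥ ⊥).degree = ((l₁.card + l₂.card : ℕ) : WithBot ℕ) := by
  have h1 : pairSchurPoly (qRho l₁.transpose) (fun k => -qRho ⊥ k) ⊥ ⊥ = 1 := by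
    rw [pairSchurPoly, below_bot, Finset.sum_singleton, skewSchur_self, skewSchur_self, mul_one,
      map_one, Nat.sub_self, pow_zero, mul_one]
  have h2 : (pairSchurPoly (qRho ⊥) (fun k => -qRho l₁ k) l₂ ⊥).degree =
      ((l₂.card : ℕ) : WithBot ℕ) := by
    refine Polynomial.degree_eq_of_le_of_coeff_ne_zero ?_ ?_
    · refine Polynomial.degree_le_of_natDegree_le ((natDegree_pairSchurPoly_le _ _ _ _).trans ?_)
      omega
    · rw [coeff_card_pairSchurPoly]
      intro h
      have h3 := skewSchur_neg_transpose (qRho l₁) l₂ ⊥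
      rw [schur] at h
      rw [h, mul_zero, transpose_bot] at h3
      exact schur_qRho_ne_zero _ _ h3
  rw [Z0plusPoly, below_bot, Finset.sum_singleton, card_bot, pow_zero, one_mul, transpose_bot, h1,
    mul_one, Polynomial.degree_mul, Polynomial.degree_C_mul, degree_cprodPoly, h2, card_bot]
  · push_cast; rw [add_zero]
  · exact mul_ne_zero (schur_qRho_ne_zero _ _) (schur_qRho_ne_zero _ _)

end Specialization

end TopVertex

theorem proposition2p2 (l₁ l₂ l₃ l₄ : YoungDiagram) :
    (Z0prime l₁ l₂ l₃ l₄ =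
      PowerSeries.C (qHalf ^ (kappa l₂ + kappa l₄) * schur (qRho ⊥) l₁ * schur (qRho ⊥) l₃) *
        Cprod l₁.transpose l₃.transpose *
        ∑ᶠ τ : YoungDiagram, (-PowerSeries.X) ^ τ.card *
          skewSchur (pairAlphabet l₁ l₃) l₂.transpose τ.transpose *
          skewSchur (pairAlphabet l₃ l₁) l₄.transpose τ) ∧
    (Z0plusPrime l₁ l₂ l₃ l₄ =
      PowerSeries.C (schur (qRho ⊥) l₁ * schur (qRho ⊥) l₃) *
        Cprod l₁ l₃ *
        ∑ᶠ τ : YoungDiagram, (-PowerSeries.X) ^ τ.card *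
          skewSchur (pairAlphabet l₃.transpose l₁.transpose) l₂ τ *
          skewSchur (pairAlphabet l₁.transpose l₃.transpose) l₄ τ.transpose) ∧
    (∃ P : Polynomial Kq, (P : PowerSeries Kq) = Z0plusPrime l₁ l₂ l₃ l₄ ∧
      P.natDegree ≤ l₁.card + l₂.card + l₃.card + l₄.card) ∧
    (l₃ = ⊥ → l₄ = ⊥ →
      ∃ P : Polynomial Kq, (P : PowerSeries Kq) = Z0plusPrime l₁ l₂ l₃ l₄ ∧
        P.degree = ((l₁.card + l₂.card : ℕ) : WithBot ℕ)) := by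
  refine ⟨?_, ?_, ⟨Z0plusPoly l₁ l₂ l₃ l₄, coe_Z0plusPoly _ _ _ _, natDegree_Z0plusPoly_le _ _ _ _⟩,
    ?_⟩
  · rw [Z0prime_eq, finsum_skewSchur_mul_skewSchur _ _ (fun n => (-PowerSeries.X) ^ n)]
  · rw [Z0plusPrime_eq, finsum_skewSchur_mul_skewSchur_transpose _ _ (fun n => (-PowerSeries.X) ^ n)]
  · rintro rfl rfl
    exact ⟨Z0plusPoly l₁ l₂ ⊥ ⊥, coe_Z0plusPoly _ _ _ _, degree_Z0plusPoly_bot _ _⟩
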